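/- **Splitting Theorem for Courant Algebroids.** A *Courant algebroid* $(E,\mathfrak a,\rho,\langle\cdot,\cdot\rangle)$ over a smooth manifold $M$ is a smooth vector bundle $E\to M$ with a fibrewise nondegenerate symmetric pairing $\langle\cdot,\cdot\rangle$ (of any signature), a bundle map $\rho\colon E\to TM$ over $\mathrm{id}_M$ (the anchor) and an $\mathbb R$-bilinear bracket $\mathfrak a=[\cdot,\cdot]$ on $\Gamma(E)$ such that, for all $\alpha,\beta,\gamma\in\Gamma(E)$ and $f\in C^\infty(M)$, $$[\alpha,f\beta]=f[\alpha,\beta]+(\rho(\alpha)f)\beta,\qquad [\alpha,[\beta,\gamma]]=[[\alpha,\beta],\gamma]+[\beta,[\alpha,\gamma]],$$ $$\rho(\alpha)\langle\beta,\gamma\rangle=\langle[\alpha,\beta],\gamma\rangle+\langle\beta,[\alpha,\gamma]\rangle,\qquad [\alpha,\beta]+[\beta,\alpha]=\rho^*d\langle\alpha,\beta\rangle,$$ where $\rho^*\colon T^*M\to E^*\cong E$. For a manifold $L$, the *standard Courant algebroid* on $\mathbb TL=TL\oplus T^*L$ has pairing $\langle X+\alpha,Y+\beta\rangle=\beta(X)+\alpha(Y)$,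 anchor the projection $\rho_L\colon\mathbb TL\to TL$, and the Courant–Dorfman bracket $\mathfrak a_L(X+\alpha,Y+\beta)=[X,Y]+\mathcal L_X\beta-i_Yd\alpha$. The *direct product* of Courant algebroids $E_1\to M_1$ and $E_2\to M_2$ is the Courant algebroid on $E_1\times E_2\to M_1\times M_2$ whose pairing and anchor are the products of the given ones and whose bracket restricts to the given brackets on $\Gamma(E_1)$ and $\Gamma(E_2)$ and vanishes on $\Gamma(E_1)\times\Gamma(E_2)$ and $\Gamma(E_2)\times\Gamma(E_1)$ (sections of the factors being extended by $0$ to sections of $E_1\times E_2$). An isomorphism of Courant algebroids is an isomorphism of vector bundles over a diffeomorphism of the bases that preserves pairings, anchors and brackets. Let $(E,\mathfrak a,\rho,\langle\cdot,\cdot\rangle)$ be a Courant algebroid over $M$ and let $p\in M$ be a point with $r=\operatorname{rank}(\rho_p)\ge 1$. Then there exist an open neighbourhood $U$ of $p$, a product $L$ of $r$ open intervals, an embedded submanifold $N\subset U$ of codimension $r$ in $M$ through $p$ that is transverse to $\rho$ (that is, $T_xN+\rho(E_x)=T_xM$ for all $x\in N$), a Courant algebroid $(E',\mathfrak a',\rho',\langle\cdot,\cdot\rangle')$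 over $N$, and an isomorphism of Courant algebroids $$\varphi\colon (E,\mathfrak a,\rho,\langle\cdot,\cdot\rangle)|_U\to\big(\mathbb TL\times E',\ \mathfrak a_L\times\mathfrak a',\ \rho_L\times\rho',\ \langle\cdot,\cdot\rangle_{\mathbb TL}\times\langle\cdot,\cdot\rangle'\big)$$ onto the direct product of the standard Courant algebroid on $\mathbb TL$ and $E'$, whose base map $U\to L\times N$ sends $x\in N$ to $(l_0,x)$ for some fixed $l_0\in L$. -/

import Mathlib

open Bundle Manifold TopologicalSpace
open scoped ContDiff

noncomputable section

namespace Courant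

section Definition

variable {V H M : Type*} [NormedAddCommGroup V] [NormedSpace ℝ V] [TopologicalSpace H]
  (I : ModelWithCorners ℝ V H) [TopologicalSpace M] [ChartedSpace H M]
  (F : Type*) [NormedAddCommGroup F] [NormedSpace ℝ F]
  (E : M → Type*) [TopologicalSpace (TotalSpace F E)]
  [∀ x, AddCommGroup (E x)] [∀ x, Module ℝ (E x)] [∀ x, TopologicalSpace (E x)]
  [FiberBundle F E] [VectorBundle ℝ F E]

variable {I F E} in
/-- The product `f • β` of a smooth function and a smooth section. -/
def smulSection (f : C^∞⟮I, M; ℝ⟯) (β : Cₛ^∞⟮I; F, E⟯) : Cₛ^∞⟮I; F, E⟯ :=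
  ⟨fun x ↦ f x • β x, f.contMDiff.smul_section β.contMDiff⟩

/-- A Courant algebroid structure on the smooth vector bundle `E → M`: a fibrewise nondegenerate
symmetric pairing (of any signature), an anchor `E → TM`, and an `ℝ`-bilinear bracket on the smooth
sections of `E` satisfying the Leibniz rule, the Jacobi identity (in Loday form), invariance of the
pairing, and `[α, β] + [β, α] = ρ^* d ⟨α, β⟩` with `ρ^* : T^*M → E^* ≅ E`.
The rule `[f α, β] = f [α, β] - (ρ(β) f) α + λ(df ⊗ α ⊗ β)` with co-anchor
`λ(ξ ⊗ α ⊗ β) = ⟨α, β⟩ ρ^* ξ` is a consequence of `leibniz` and `symmetrization`. -/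
structure CourantAlgebroid [IsManifold I ∞ M] where
  /-- the pairing `⟨·,·⟩` -/
  pairing : ∀ x, E x →ₗ[ℝ] E x →ₗ[ℝ] ℝ
  pairing_smooth : ∀ α β : Cₛ^∞⟮I; F, E⟯, ContMDiff I 𝓘(ℝ, ℝ) ∞ fun x ↦ pairing x (α x) (β x)
  pairing_symm : ∀ x (v w : E x), pairing x v w = pairing x w v
  pairing_nondegenerate : ∀ x (v : E x), (∀ w, pairing x v w = 0) → v = 0
  /-- the anchor `ρ` -/
  anchor : ∀ x, E x →ₗ[ℝ] TangentSpace I x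
  anchor_smooth : ContMDiff (I.prod 𝓘(ℝ, F)) I.tangent ∞
    fun v : TotalSpace F E ↦ (⟨v.proj, anchor v.proj v.snd⟩ : TangentBundle I M)
  /-- the bracket `[·,·]` -/
  bracket : Cₛ^∞⟮I; F, E⟯ →ₗ[ℝ] Cₛ^∞⟮I; F, E⟯ →ₗ[ℝ] Cₛ^∞⟮I; F, E⟯
  leibniz : ∀ (α β : Cₛ^∞⟮I; F, E⟯) (f : C^∞⟮I, M; ℝ⟯) (x : M),
    bracket α (smulSection f β) x
      = f x • bracket α β x + mvfderiv I f x (anchor x (α x)) • β x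
  jacobi : ∀ α β γ : Cₛ^∞⟮I; F, E⟯,
    bracket (bracket α β) γ + bracket β (bracket α γ) = bracket α (bracket β γ)
  invariance : ∀ (α β γ : Cₛ^∞⟮I; F, E⟯) (x : M),
    mvfderiv I (fun y ↦ pairing y (β y) (γ y)) x (anchor x (α x))
      = pairing x (bracket α β x) (γ x) + pairing x (β x) (bracket α γ x)
  symmetrization : ∀ (α β : Cₛ^∞⟮I; F, E⟯) (x : M) (e : E x),
    pairing x (bracket α β x + bracket β α x) e
      = mvfderiv I (fun y ↦ pairing y (α y) (β y)) x (anchor x e)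

end Definition

section Isomorphism

variable {V₁ H₁ M₁ : Type*} [NormedAddCommGroup V₁] [NormedSpace ℝ V₁] [TopologicalSpace H₁]
  {I₁ : ModelWithCorners ℝ V₁ H₁} [TopologicalSpace M₁] [ChartedSpace H₁ M₁]
  [IsManifold I₁ ∞ M₁]
  {F₁ : Type*} [NormedAddCommGroup F₁] [NormedSpace ℝ F₁]
  {E₁ : M₁ → Type*} [TopologicalSpace (TotalSpace F₁ E₁)]
  [∀ x, AddCommGroup (E₁ x)] [∀ x, Module ℝ (E₁ x)] [∀ x, TopologicalSpace (E₁ x)]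
  [FiberBundle F₁ E₁] [VectorBundle ℝ F₁ E₁]
  {V₂ H₂ M₂ : Type*} [NormedAddCommGroup V₂] [NormedSpace ℝ V₂] [TopologicalSpace H₂]
  {I₂ : ModelWithCorners ℝ V₂ H₂} [TopologicalSpace M₂] [ChartedSpace H₂ M₂]
  [IsManifold I₂ ∞ M₂]
  {F₂ : Type*} [NormedAddCommGroup F₂] [NormedSpace ℝ F₂]
  {E₂ : M₂ → Type*} [TopologicalSpace (TotalSpace F₂ E₂)]
  [∀ x, AddCommGroup (E₂ x)] [∀ x, Module ℝ (E₂ x)] [∀ x, TopologicalSpace (E₂ x)]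
  [FiberBundle F₂ E₂] [VectorBundle ℝ F₂ E₂]

/-- An isomorphism of Courant algebroids: a diffeomorphism of the bases covered by an isomorphism
of smooth vector bundles that intertwines pairings, anchors and brackets. -/
structure CourantIso (A : CourantAlgebroid I₁ F₁ E₁) (B : CourantAlgebroid I₂ F₂ E₂) where
  /-- the diffeomorphism of the bases -/
  base : M₁ ≃ₘ^∞⟮I₁, I₂⟯ M₂
  /-- the linear isomorphisms between the fibres -/
  fiber : ∀ x, E₁ x ≃ₗ[ℝ] E₂ (base x)
  /-- the resulting diffeomorphism of the total spaces -/
  total : TotalSpace F₁ E₁ ≃ₘ^∞⟮I₁.prod 𝓘(ℝ, F₁), I₂.prod 𝓘(ℝ, F₂)⟯ TotalSpace F₂ E₂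
  total_mk : ∀ x (v : E₁ x), total ⟨x, v⟩ = ⟨base x, fiber x v⟩
  map_pairing : ∀ x (v w : E₁ x),
    B.pairing (base x) (fiber x v) (fiber x w) = A.pairing x v w
  map_anchor : ∀ x (v : E₁ x),
    B.anchor (base x) (fiber x v) = mfderiv I₁ I₂ base x (A.anchor x v)
  /-- If `α', β'` are the images of the sections `α, β`, then `[α', β']` is the image of
  `[α, β]`. -/
  map_bracket : ∀ (α β : Cₛ^∞⟮I₁; F₁, E₁⟯) (α' β' : Cₛ^∞⟮I₂; F₂, E₂⟯),
    (∀ x, α' (base x) = fiber x (α x)) → (∀ x, β' (base x) = fiber x (β x)) →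
    ∀ x, B.bracket α' β' (base x) = fiber x (A.bracket α β x)

end Isomorphism

section Restriction

variable {V H M : Type*} [NormedAddCommGroup V] [NormedSpace ℝ V] [TopologicalSpace H]
  {I : ModelWithCorners ℝ V H} [TopologicalSpace M] [ChartedSpace H M]
  {F : Type*} [NormedAddCommGroup F] [NormedSpace ℝ F]
  {E : M → Type*} [TopologicalSpace (TotalSpace F E)]
  [∀ x, AddCommGroup (E x)] [∀ x, Module ℝ (E x)] [∀ x, TopologicalSpace (E x)]
  [FiberBundle F E] [VectorBundle ℝ F E]
  {V' H' M' : Type*} [NormedAddCommGroup V'] [NormedSpace ℝ V'] [TopologicalSpace H']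
  {I' : ModelWithCorners ℝ V' H'} [TopologicalSpace M'] [ChartedSpace H' M']

instance pullbackAddCommGroup {B B' : Type*} (f : B' → B) (E : B → Type*)
    [∀ x, AddCommGroup (E x)] (x : B') : AddCommGroup ((f *ᵖ E) x) :=
  inferInstanceAs (AddCommGroup (E (f x)))

/-- The pullback `x ↦ α (f x)` of a smooth section, a section of `f^* E`. -/
def pullbackSection (f : C^∞⟮I', M'; I, M⟯) (α : Cₛ^∞⟮I; F, E⟯) :
    Cₛ^∞⟮I'; F, (f *ᵖ E)⟯ where
  toFun x := α (f x)
  contMDiff_toFun x :=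
    (contMDiffAt_section (E := f *ᵖ E) x).2
      (((contMDiffAt_section (f x)).1 (α.contMDiff (f x))).comp x (f.contMDiff x))

variable (I) in
/-- The inclusion `U → M` of an open subset. -/
def openIncl (U : Opens M) : C^∞⟮I, U; I, M⟯ := ⟨Subtype.val, contMDiff_subtype_val⟩

variable (I E) in
/-- The restriction `E|_U` of the bundle `E → M` to an open subset `U`. -/
abbrev restrictBundle (U : Opens M) : U → Type _ := openIncl I U *ᵖ E

/-- `B` is the restriction of `A` to the open subset `U`: pairing and anchor are the restricted
ones, and `[α|_U, β|_U] = [α, β]|_U`. (Brackets are local operators, and sections of `E|_U` agree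
near each point with restrictions of sections of `E`, so this determines `B`.) -/
structure IsRestriction [IsManifold I ∞ M] (A : CourantAlgebroid I F E) (U : Opens M)
    (B : CourantAlgebroid I F (restrictBundle I E U)) : Prop where
  pairing : ∀ (x : U) (v w : E x), B.pairing x v w = A.pairing x v w
  anchor : ∀ (x : U) (v : E x), mfderiv I I (openIncl I U) x (B.anchor x v) = A.anchor x v
  bracket : ∀ α β : Cₛ^∞⟮I; F, E⟯,
    B.bracket (pullbackSection (openIncl I U) α) (pullbackSection (openIncl I U) β)
      = pullbackSection (openIncl I U) (A.bracket α β)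

end Restriction

section Standard

variable {V H : Type*} [NormedAddCommGroup V] [NormedSpace ℝ V] [TopologicalSpace H]
  (I : ModelWithCorners ℝ V H) {M : Type*} [TopologicalSpace M] [ChartedSpace H M]

variable (M) in
/-- The generalized tangent bundle `𝕋M = TM ⊕ T^*M`; its model fibre is `V × V^*`. -/
abbrev GenTangent : M → Type _ :=
  fun x ↦ TangentSpace I x × (TangentSpace I x →L[ℝ] ℝ)

/-- The function `(L_X β)(Z) = X (β(Z)) - β([X, Z])`. -/
def lieDerivForm (X : ∀ x : M, TangentSpace I x) (β : ∀ x : M, TangentSpace I x →L[ℝ] ℝ)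
    (Z : ∀ x : M, TangentSpace I x) (x : M) : ℝ :=
  mvfderiv I (fun y ↦ β y (Z y)) x (X x) - β x (VectorField.mlieBracket I X Z x)

/-- The function `(dα)(Y, Z) = Y (α(Z)) - Z (α(Y)) - α([Y, Z])`. -/
def extDerivForm (α : ∀ x : M, TangentSpace I x →L[ℝ] ℝ) (Y Z : ∀ x : M, TangentSpace I x)
    (x : M) : ℝ :=
  mvfderiv I (fun y ↦ α y (Z y)) x (Y x) - mvfderiv I (fun y ↦ α y (Y y)) x (Z x)
    - α x (VectorField.mlieBracket I Y Z x)

variable {I} in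
/-- `T` is the standard Courant algebroid on `𝕋M`: the pairing is `⟨X + α, Y + β⟩ = β(X) + α(Y)`,
the anchor is the projection to `TM`, and the bracket is the Courant-Dorfman bracket
`[X + α, Y + β] = [X, Y] + L_X β - i_Y dα`. The one-form part is given by its values on smooth
vector fields `Z`. -/
structure IsStandard [IsManifold I ∞ M]
    (T : CourantAlgebroid I (V × (V →L[ℝ] ℝ)) (GenTangent I M)) : Prop where
  pairing : ∀ (x : M) (v w : GenTangent I M x), T.pairing x v w = w.2 v.1 + v.2 w.1
  anchor : ∀ (x : M) (v : GenTangent I M x), T.anchor x v = v.1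
  bracket_fst : ∀ (s t : Cₛ^∞⟮I; V × (V →L[ℝ] ℝ), GenTangent I M⟯) (x : M),
    (T.bracket s t x).1 = VectorField.mlieBracket I (fun y ↦ (s y).1) (fun y ↦ (t y).1) x
  bracket_snd : ∀ (s t : Cₛ^∞⟮I; V × (V →L[ℝ] ℝ), GenTangent I M⟯)
      (Z : Cₛ^∞⟮I; V, (TangentSpace I : M → Type _)⟯) (x : M),
    (T.bracket s t x).2 (Z x) =
      lieDerivForm I (fun y ↦ (s y).1) (fun y ↦ (t y).2) Z x
        - extDerivForm I (fun y ↦ (s y).2) (fun y ↦ (t y).1) Z x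

end Standard

section Product

variable {V₁ H₁ M₁ : Type*} [NormedAddCommGroup V₁] [NormedSpace ℝ V₁] [TopologicalSpace H₁]
  {I₁ : ModelWithCorners ℝ V₁ H₁} [TopologicalSpace M₁] [ChartedSpace H₁ M₁]
  {F₁ : Type*} [NormedAddCommGroup F₁] [NormedSpace ℝ F₁]
  {E₁ : M₁ → Type*} [TopologicalSpace (TotalSpace F₁ E₁)]
  [∀ x, AddCommGroup (E₁ x)] [∀ x, Module ℝ (E₁ x)] [∀ x, TopologicalSpace (E₁ x)]
  [FiberBundle F₁ E₁] [VectorBundle ℝ F₁ E₁]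
  {V₂ H₂ M₂ : Type*} [NormedAddCommGroup V₂] [NormedSpace ℝ V₂] [TopologicalSpace H₂]
  {I₂ : ModelWithCorners ℝ V₂ H₂} [TopologicalSpace M₂] [ChartedSpace H₂ M₂]
  {F₂ : Type*} [NormedAddCommGroup F₂] [NormedSpace ℝ F₂]
  {E₂ : M₂ → Type*} [TopologicalSpace (TotalSpace F₂ E₂)]
  [∀ x, AddCommGroup (E₂ x)] [∀ x, Module ℝ (E₂ x)] [∀ x, TopologicalSpace (E₂ x)]
  [FiberBundle F₂ E₂] [VectorBundle ℝ F₂ E₂]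

/-- The pullback to `M₁ × M₂` of a bundle on the first factor. -/
abbrev fstBundle (I₁ : ModelWithCorners ℝ V₁ H₁) (E₁ : M₁ → Type*)
    (I₂ : ModelWithCorners ℝ V₂ H₂) (M₂ : Type*) [TopologicalSpace M₂] [ChartedSpace H₂ M₂] :
    M₁ × M₂ → Type _ :=
  (ContMDiffMap.fst : C^∞⟮I₁.prod I₂, M₁ × M₂; I₁, M₁⟯) *ᵖ E₁

/-- The pullback to `M₁ × M₂` of a bundle on the second factor. -/
abbrev sndBundle (I₁ : ModelWithCorners ℝ V₁ H₁) (M₁ : Type*) [TopologicalSpace M₁]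
    [ChartedSpace H₁ M₁] (I₂ : ModelWithCorners ℝ V₂ H₂) (E₂ : M₂ → Type*) :
    M₁ × M₂ → Type _ :=
  (ContMDiffMap.snd : C^∞⟮I₁.prod I₂, M₁ × M₂; I₂, M₂⟯) *ᵖ E₂

variable (I₁ E₁ I₂ E₂) in
/-- The product bundle `E₁ × E₂ → M₁ × M₂`, with fibre `(E₁)_x × (E₂)_y` over `(x, y)`. -/
abbrev prodBundle : M₁ × M₂ → Type _ :=
  fstBundle I₁ E₁ I₂ M₂ ×ᵇ sndBundle I₁ M₁ I₂ E₂

/-- The section `z ↦ (s z, t z)` of a Whitney sum. -/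
def pairSection {E E' : M₁ → Type*} {F F' : Type*}
    [NormedAddCommGroup F] [NormedSpace ℝ F] [NormedAddCommGroup F'] [NormedSpace ℝ F']
    [TopologicalSpace (TotalSpace F E)] [TopologicalSpace (TotalSpace F' E')]
    [∀ x, AddCommGroup (E x)] [∀ x, Module ℝ (E x)] [∀ x, TopologicalSpace (E x)]
    [∀ x, AddCommGroup (E' x)] [∀ x, Module ℝ (E' x)] [∀ x, TopologicalSpace (E' x)]
    [FiberBundle F E] [VectorBundle ℝ F E] [FiberBundle F' E'] [VectorBundle ℝ F' E']
    (s : Cₛ^∞⟮I₁; F, E⟯) (t : Cₛ^∞⟮I₁; F', E'⟯) : Cₛ^∞⟮I₁; F × F', E ×ᵇ E'⟯ where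
  toFun z := (s z, t z)
  contMDiff_toFun z :=
    (contMDiffAt_section (E := E ×ᵇ E') z).2
      (((contMDiffAt_section z).1 (s.contMDiff z)).prodMk_space
        ((contMDiffAt_section z).1 (t.contMDiff z)))

variable (I₂ F₂ E₂) in
/-- The section `(x, y) ↦ (σ x, 0)` of `E₁ × E₂` defined by a section `σ` of `E₁`. -/
def inlSection (σ : Cₛ^∞⟮I₁; F₁, E₁⟯) :
    Cₛ^∞⟮I₁.prod I₂; F₁ × F₂, prodBundle I₁ E₁ I₂ E₂⟯ :=
  pairSection (pullbackSection ContMDiffMap.fst σ) 0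

variable (I₁ F₁ E₁) in
/-- The section `(x, y) ↦ (0, σ y)` of `E₁ × E₂` defined by a section `σ` of `E₂`. -/
def inrSection (σ : Cₛ^∞⟮I₂; F₂, E₂⟯) :
    Cₛ^∞⟮I₁.prod I₂; F₁ × F₂, prodBundle I₁ E₁ I₂ E₂⟯ :=
  pairSection 0 (pullbackSection ContMDiffMap.snd σ)

/-- `C` is the direct product of the Courant algebroids `A₁` and `A₂`: pairing and anchor are the
products `⟨·,·⟩₁ × ⟨·,·⟩₂` and `ρ₁ × ρ₂`, the bracket restricts to the given brackets on `Γ(E₁)` and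
`Γ(E₂)`, and sections of `E₁` and of `E₂` have zero bracket. (As `Γ(E₁)` and `Γ(E₂)` generate the
sections of `E₁ × E₂` and `C` satisfies the Leibniz rules, this determines the bracket.) -/
structure IsDirectProduct [IsManifold I₁ ∞ M₁] [IsManifold I₂ ∞ M₂]
    (A₁ : CourantAlgebroid I₁ F₁ E₁) (A₂ : CourantAlgebroid I₂ F₂ E₂)
    (C : CourantAlgebroid (I₁.prod I₂) (F₁ × F₂) (prodBundle I₁ E₁ I₂ E₂)) : Prop where
  pairing : ∀ (z : M₁ × M₂) (v w : prodBundle I₁ E₁ I₂ E₂ z),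
    C.pairing z v w = A₁.pairing z.1 v.1 w.1 + A₂.pairing z.2 v.2 w.2
  anchor_fst : ∀ (z : M₁ × M₂) (v : prodBundle I₁ E₁ I₂ E₂ z),
    mfderiv (I₁.prod I₂) I₁ Prod.fst z (C.anchor z v) = A₁.anchor z.1 v.1
  anchor_snd : ∀ (z : M₁ × M₂) (v : prodBundle I₁ E₁ I₂ E₂ z),
    mfderiv (I₁.prod I₂) I₂ Prod.snd z (C.anchor z v) = A₂.anchor z.2 v.2
  bracket_inl_inl : ∀ σ τ : Cₛ^∞⟮I₁; F₁, E₁⟯,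
    C.bracket (inlSection I₂ F₂ E₂ σ) (inlSection I₂ F₂ E₂ τ)
      = inlSection I₂ F₂ E₂ (A₁.bracket σ τ)
  bracket_inr_inr : ∀ σ τ : Cₛ^∞⟮I₂; F₂, E₂⟯,
    C.bracket (inrSection I₁ F₁ E₁ σ) (inrSection I₁ F₁ E₁ τ)
      = inrSection I₁ F₁ E₁ (A₂.bracket σ τ)
  bracket_inl_inr : ∀ (σ : Cₛ^∞⟮I₁; F₁, E₁⟯) (τ : Cₛ^∞⟮I₂; F₂, E₂⟯),
    C.bracket (inlSection I₂ F₂ E₂ σ) (inrSection I₁ F₁ E₁ τ) = 0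
  bracket_inr_inl : ∀ (σ : Cₛ^∞⟮I₁; F₁, E₁⟯) (τ : Cₛ^∞⟮I₂; F₂, E₂⟯),
    C.bracket (inrSection I₁ F₁ E₁ τ) (inlSection I₂ F₂ E₂ σ) = 0

end Product

/-- The product `∏ i, (a i, b i)` of `r` open intervals, as an open subset of `ℝ^r`. -/
def openBox {r : ℕ} (a b : Fin r → ℝ) : Opens (EuclideanSpace ℝ (Fin r)) where
  carrier := {x | ∀ i, x i ∈ Set.Ioo (a i) (b i)}
  is_open' := by
    simp only [Set.ofPred_forall]
    exact isOpen_iInter_of_finite fun i ↦ isOpen_Ioo.preimage (by fun_prop)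

end Courant

end

/-! The standard part is split off one hyperbolic plane at a time, as in Weinstein's splitting of a
Poisson manifold. Suppose that near `p` there are commuting isotropic sections `α i`, gradients `β i
= ρ^* d(t i)` and coordinates `t, y` in which `ρ(α i)` is the coordinate field of `t i`, and that
every vector of `E p` extends to an invariant section, one whose brackets with all `α i` vanish.
These data form a `Splitting`.

If the `α i` are fewer than the rank of the anchor at `p`, some `e` in `E p` has an anchor outside
the span of the `ρ(α i)`. Extend `e` to an invariant section and subtract its components along the
`α i`, `β i` to get `γ`. The functions `ρ(γ) y_l` are killed by all `ρ(α i)`, hence depend on `y`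
only: `γ` acts on the `y`-coordinates by a vector field `η`, which does not vanish at `p`
(`exists_transverse`). Straightening `η` gives a function `t'` of `y` with `η t' = 1`. Put `β' = ρ^*
dt'` and `α' = γ - ½⟨γ,γ⟩β'`. As `⟨γ,β'⟩ = ρ(γ)t' = 1` and `⟨β',β'⟩ = 0`, the section `α'` is
isotropic, so `2[α',α'] = ρ^* d⟨α',α'⟩ = 0`; the remaining brackets vanish because gradients have
zero left bracket and the pairings involved are constant. An invariant section for the enlarged
family comes from a linear differential equation along `η`, whose coefficients are functions of `y`
by the Jacobi identity (`exists_invariant_of_bracket`). This is `exists_succ`; iteration gives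
`exists_splitting`.

With as many `α i` as the rank, invariant sections `γ a` orthogonal to all `α i`, `β i` complete
them to a local frame (`exists_frame`). A chart with components `t, y` identifies a neighbourhood
`U` with `L × N`, where `N` is a level set of `t`. Sending `α i`, `β i`, `γ a` to the constant
vector fields, the constant one-forms and the frame of a trivial bundle over `N` transports the
structure to `𝕋L × E'` (`exists_courantIso`). Pairings, anchors and structure functions of the `γ a`
are invariant, so they do not depend on the point of `L` and descend to `N`
(`exists_isDirectProduct_of_frames`). The factor on `𝕋L` is standard because its constant vector
fields commute, which leaves no room for a twisting three-form (`isStandard_of_constSection`).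

The analytic input is a flow box with smooth dependence on initial values (`exists_flowBox`). It
rests on the inverse function theorem in the Banach space of continuous curves
(`exists_smooth_flow`). -/

noncomputable section

namespace Courant

open Set Filter Topology

/-! ### Smoothness of composition with a fixed smooth map, on spaces of continuous maps. -/

section CompositionOperator

variable {X : Type*} [TopologicalSpace X] [CompactSpace X]
  {A W G : Type*} [NormedAddCommGroup A] [NormedSpace ℝ A] [NormedAddCommGroup W] [NormedSpace ℝ W]
  [NormedAddCommGroup G] [NormedSpace ℝ G]

variable (X) in
/-- A continuous bilinear map induces one on spaces of continuous maps. -/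
def bilinPostcomp (b : A →L[ℝ] W →L[ℝ] G) : C(X, A) →L[ℝ] C(X, W) →L[ℝ] C(X, G) :=
  LinearMap.mkContinuous₂
    (LinearMap.mk₂ ℝ (fun (a : C(X, A)) (h : C(X, W)) ↦
      (⟨fun x ↦ b (a x) (h x), by fun_prop⟩ : C(X, G)))
      (fun _ _ _ ↦ by ext; simp) (fun _ _ _ ↦ by ext; simp)
      (fun _ _ _ ↦ by ext; simp) (fun _ _ _ ↦ by ext; simp)) ‖b‖
    (fun a h ↦ by
      rw [ContinuousMap.norm_le _ (by positivity)]
      intro x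
      simp only [LinearMap.mk₂_apply, ContinuousMap.coe_mk]
      refine (b.le_opNorm₂ _ _).trans ?_
      gcongr
      · exact a.norm_coe_le_norm x
      · exact h.norm_coe_le_norm x)

@[simp] theorem bilinPostcomp_apply (b : A →L[ℝ] W →L[ℝ] G) (a : C(X, A)) (h : C(X, W)) (x : X) :
    bilinPostcomp X b a h x = b (a x) (h x) := rfl

/-- The remainder is estimated pointwise by the mean value inequality. The bound has to be uniform
in the point of `X`; this uniformity is the continuity of `γ ↦ f' ∘ γ` in the supremum norm. -/
theorem hasFDerivAt_postcomp (b : A →L[ℝ] W →L[ℝ] G) (hb : ‖b‖ ≤ 1) (f : C(W, G)) (f' : C(W, A))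
    (hf : ∀ x, HasFDerivAt f (b (f' x)) x) (γ : C(X, W)) :
    HasFDerivAt (fun γ : C(X, W) ↦ f.comp γ) (bilinPostcomp X b (f'.comp γ)) γ := by
  rw [hasFDerivAt_iff_isLittleO_nhds_zero, Asymptotics.isLittleO_iff]
  intro c hc
  have hcont : Continuous fun γ : C(X, W) ↦ f'.comp γ := ContinuousMap.continuous_postcomp f'
  obtain ⟨δ, hδ, H⟩ := Metric.continuous_iff.1 hcont γ c hc
  filter_upwards [Metric.ball_mem_nhds (0 : C(X, W)) hδ] with h hh
  rw [ContinuousMap.norm_le _ (by positivity)]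
  intro x
  -- A value `k` near `γ x` is taken at `x` by the translate `γ + (k - γ x)`, whose uniform distance
  -- from `γ` is at most `‖k - γ x‖`. Hence `δ` serves every `x` at once.
  have key : ∀ k ∈ Metric.ball (γ x) δ, ‖b (f' k) - b (f' (γ x))‖ ≤ c := by
    intro k hk
    have h1 : dist (γ + ContinuousMap.const X (k - γ x)) γ < δ := by
      rw [dist_eq_norm, add_sub_cancel_left]
      refine lt_of_le_of_lt ((ContinuousMap.norm_le _ (norm_nonneg _)).2 fun y ↦ ?_)
        (mem_ball_iff_norm.1 hk)
      simp
    have h2 := H _ h1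
    rw [dist_eq_norm] at h2
    have h3 := (ContinuousMap.norm_coe_le_norm
      (f'.comp (γ + ContinuousMap.const X (k - γ x)) - f'.comp γ) x).trans h2.le
    rw [← map_sub]
    refine (b.le_of_opNorm_le hb _).trans ?_
    simpa using h3
  have hx : ‖h x‖ < δ := lt_of_le_of_lt (h.norm_coe_le_norm x) (by simpa using hh)
  have := (convex_ball (γ x) δ).norm_image_sub_le_of_norm_hasFDerivWithin_le'
    (f := f) (φ := b (f' (γ x))) (C := c) (x := γ x) (y := γ x + h x)
    (fun k _ ↦ (hf k).hasFDerivWithinAt) key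
    (Metric.mem_ball_self hδ) (by simpa using hx)
  simp only [add_sub_cancel_left] at this
  refine le_trans ?_ (this.trans (mul_le_mul_of_nonneg_left (h.norm_coe_le_norm x) hc.le))
  simp

end CompositionOperator

section CompositionOperator

universe u

variable {X : Type*} [TopologicalSpace X] [CompactSpace X]
  {W : Type u} [NormedAddCommGroup W] [NormedSpace ℝ W]

/-- The derivative of composition with `f` is composition with `fderiv ℝ f` followed by a bounded
linear map, so the induction passes from `f` to `fderiv ℝ f`. This replaces the target `G` by `W
→L[ℝ] G`; therefore `G` varies in the induction and lives in the universe of `W`. -/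
theorem contDiff_postcomp_nat (n : ℕ) : ∀ {G : Type u} [NormedAddCommGroup G] [NormedSpace ℝ G]
    (f : C(W, G)) (_ : ContDiff ℝ ∞ f), ContDiff ℝ n (fun γ : C(X, W) ↦ f.comp γ) := by
  induction n with
  | zero =>
    intro G _ _ f hf
    exact contDiff_zero.2 (ContinuousMap.continuous_postcomp _)
  | succ n ih =>
    intro G _ _ f hf
    obtain ⟨hd, hf'⟩ := contDiff_infty_iff_fderiv.1 hf
    have h2 := fun γ ↦ hasFDerivAt_postcomp (X := X) (ContinuousLinearMap.id ℝ (W →L[ℝ] G))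
      ContinuousLinearMap.norm_id_le f ⟨fderiv ℝ f, hf'.continuous⟩ (fun x ↦ (hd x).hasFDerivAt) γ
    exact (contDiff_succ_iff_hasFDerivAt (n := n)).2 ⟨_,
      (bilinPostcomp X (ContinuousLinearMap.id ℝ (W →L[ℝ] G))).contDiff.comp (ih _ hf'), h2⟩

theorem contDiff_postcomp {G : Type u} [NormedAddCommGroup G] [NormedSpace ℝ G]
    (f : C(W, G)) (hf : ContDiff ℝ ∞ f) : ContDiff ℝ ∞ (fun γ : C(X, W) ↦ f.comp γ) :=
  contDiff_infty.2 fun n ↦ contDiff_postcomp_nat n f hf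

end CompositionOperator

/-! ### Inverse function theorem with a smooth inverse on the whole target. -/

section InverseFunction

variable {X Y : Type*} [NormedAddCommGroup X] [NormedSpace ℝ X] [CompleteSpace X]
  [NormedAddCommGroup Y] [NormedSpace ℝ Y]

/-- The inverse function theorem for smooth maps, with smoothness on a whole neighbourhood. -/
theorem exists_openPartialHomeomorph_contDiffOn {f : X → Y} {a : X} {s : Set X} (hs : IsOpen s)
    (ha : a ∈ s) (hf : ContDiffOn ℝ ∞ f s) {f' : X ≃L[ℝ] Y}
    (hf' : HasFDerivAt f (f' : X →L[ℝ] Y) a) :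
    ∃ e : OpenPartialHomeomorph X Y, a ∈ e.source ∧ e.source ⊆ s ∧ (∀ x, e x = f x) ∧
      ContDiffOn ℝ ∞ e.symm e.target := by
  have hat : ContDiffAt ℝ ∞ f a := hf.contDiffAt (hs.mem_nhds ha)
  let e₀ := hat.toOpenPartialHomeomorph f hf' (by simp)
  have hcont : ContinuousOn (fderiv ℝ f) s := hf.continuousOn_fderiv_of_isOpen hs (by simp)
  -- Invertible operators form an open set, so `t` is open. Over `t` the local inverse is smooth at
  -- every point, not just at the image of `a`.
  let t : Set X := s ∩ fderiv ℝ f ⁻¹' (range ((↑) : (X ≃L[ℝ] Y) → X →L[ℝ] Y))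
  have ht : IsOpen t := hcont.isOpen_inter_preimage hs ContinuousLinearEquiv.isOpen
  have hat' : a ∈ t := ⟨ha, f', hf'.fderiv.symm⟩
  refine ⟨e₀.restrOpen t ht, ⟨hat.mem_toOpenPartialHomeomorph_source hf' (by simp), hat'⟩,
    fun x hx ↦ hx.2.1, fun x ↦ rfl, ?_⟩
  intro y hy
  have hx := (e₀.restrOpen t ht).map_target hy
  obtain ⟨-, hxs, g, hg⟩ := hx
  refine ContDiffAt.contDiffWithinAt ?_
  refine (e₀.restrOpen t ht).contDiffAt_symm (f₀' := g) hy ?_ (hf.contDiffAt (hs.mem_nhds hxs))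
  rw [hg]
  exact ((hf.contDiffAt (hs.mem_nhds hxs)).differentiableAt (by simp)).hasFDerivAt

end InverseFunction

/-! ### Local flows with smooth dependence on initial values. -/

section Flow

theorem continuous_comp_projIcc {W : Type*} [TopologicalSpace W] (g : C(Icc (0 : ℝ) 1, W)) :
    Continuous fun τ : ℝ ↦ g (projIcc 0 1 zero_le_one τ) :=
  g.continuous.comp continuous_projIcc

variable {W : Type*} [NormedAddCommGroup W] [NormedSpace ℝ W]

/-- The primitive of the extension of a continuous map on `[0, 1]` to the real line. -/
def primitiveIcc (g : C(Icc (0 : ℝ) 1, W)) (s : ℝ) : W :=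
  ∫ τ in (0 : ℝ)..s, g (projIcc 0 1 zero_le_one τ)

theorem norm_primitiveIcc_le (g : C(Icc (0 : ℝ) 1, W)) (s : Icc (0 : ℝ) 1) :
    ‖primitiveIcc g s‖ ≤ ‖g‖ := by
  have := intervalIntegral.norm_integral_le_of_norm_le_const (a := (0 : ℝ)) (b := s) (C := ‖g‖)
    (f := fun τ ↦ g (projIcc 0 1 zero_le_one τ)) fun τ _ ↦ g.norm_coe_le_norm _
  refine this.trans ?_
  rw [sub_zero, abs_of_nonneg s.2.1]
  exact mul_le_of_le_one_right (norm_nonneg _) s.2.2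

variable (W) in
/-- The constant maps as a continuous linear operator. -/
def constCLM : W →L[ℝ] C(Icc (0 : ℝ) 1, W) :=
  LinearMap.mkContinuous
    { toFun := fun w ↦ ContinuousMap.const _ w
      map_add' := fun _ _ ↦ rfl
      map_smul' := fun _ _ ↦ rfl } 1 fun w ↦ by
    rw [ContinuousMap.norm_le _ (by positivity), one_mul]
    exact fun _ ↦ le_rfl

@[simp] theorem constCLM_apply (w : W) (s : Icc (0 : ℝ) 1) : constCLM W w s = w := rfl

variable [CompleteSpace W]

theorem hasDerivAt_primitiveIcc (g : C(Icc (0 : ℝ) 1, W)) (s : ℝ) :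
    HasDerivAt (primitiveIcc g) (g (projIcc 0 1 zero_le_one s)) s :=
  intervalIntegral.integral_hasDerivAt_right
    ((continuous_comp_projIcc g).intervalIntegrable _ _)
    ((continuous_comp_projIcc g).stronglyMeasurableAtFilter _ _)
    (continuous_comp_projIcc g).continuousAt

variable (W) in
/-- Integration from `0` as a continuous linear operator on `C([0, 1], W)`. -/
def primitiveCLM : C(Icc (0 : ℝ) 1, W) →L[ℝ] C(Icc (0 : ℝ) 1, W) :=
  LinearMap.mkContinuous
    { toFun := fun g ↦ ⟨fun s ↦ primitiveIcc g s, (continuous_iff_continuousAt.2 fun s ↦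
        (hasDerivAt_primitiveIcc g s).continuousAt).comp continuous_subtype_val⟩
      map_add' := fun g h ↦ by
        ext s
        exact intervalIntegral.integral_add ((continuous_comp_projIcc g).intervalIntegrable _ _)
          ((continuous_comp_projIcc h).intervalIntegrable _ _)
      map_smul' := fun c g ↦ by
        ext s
        exact intervalIntegral.integral_smul c _ }
    1 fun g ↦ by
      rw [ContinuousMap.norm_le _ (by positivity), one_mul]
      exact norm_primitiveIcc_le g

theorem primitiveCLM_apply (g : C(Icc (0 : ℝ) 1, W)) (s : Icc (0 : ℝ) 1) :
    primitiveCLM W g s = primitiveIcc g s := rfl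

/-- The equation `γ = x + ε ∫ f(γ)` for integral curves, with time rescaled to `[0, 1]`. -/
def curveMap (f : C(W, W)) (z : ℝ × W × C(Icc (0 : ℝ) 1, W)) : ℝ × W × C(Icc (0 : ℝ) 1, W) :=
  (z.1, z.2.1, z.2.2 - constCLM W z.2.1 - z.1 • primitiveCLM W (f.comp z.2.2))

theorem contDiff_curveMap (f : C(W, W)) (hf : ContDiff ℝ ∞ f) : ContDiff ℝ ∞ (curveMap f) := by
  have h := (primitiveCLM W).contDiff.comp ((contDiff_postcomp (X := Icc (0 : ℝ) 1) f hf).comp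
    (contDiff_snd.comp (contDiff_snd (E := ℝ) (F := W × C(Icc (0 : ℝ) 1, W)))))
  exact contDiff_fst.prodMk ((contDiff_fst.comp contDiff_snd).prodMk
    (((contDiff_snd.comp contDiff_snd).sub
      ((constCLM W).contDiff.comp (contDiff_fst.comp contDiff_snd))).sub (contDiff_fst.smul h)))

variable (W) in
/-- The linear automorphism `(e, v, h) ↦ (e, v, h - v - e c)`. -/
def shearEquiv (c : C(Icc (0 : ℝ) 1, W)) :
    (ℝ × W × C(Icc (0 : ℝ) 1, W)) ≃L[ℝ] (ℝ × W × C(Icc (0 : ℝ) 1, W)) :=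
  let p₁ := ContinuousLinearMap.fst ℝ ℝ (W × C(Icc (0 : ℝ) 1, W))
  let p₂ := (ContinuousLinearMap.fst ℝ W C(Icc (0 : ℝ) 1, W)).comp
    (ContinuousLinearMap.snd ℝ ℝ (W × C(Icc (0 : ℝ) 1, W)))
  let p₃ := (ContinuousLinearMap.snd ℝ W C(Icc (0 : ℝ) 1, W)).comp
    (ContinuousLinearMap.snd ℝ ℝ (W × C(Icc (0 : ℝ) 1, W)))
  ContinuousLinearEquiv.equivOfInverse
    (p₁.prod (p₂.prod (p₃ - (constCLM W).comp p₂ - p₁.smulRight c)))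
    (p₁.prod (p₂.prod (p₃ + (constCLM W).comp p₂ + p₁.smulRight c)))
    (fun z ↦ by ext <;> simp [p₁, p₂, p₃] <;> abel)
    (fun z ↦ by ext <;> simp [p₁, p₂, p₃] <;> abel)

/-- At parameter `0` the factor in front of the integral vanishes, so the integral contributes only
its value, as the coefficient of the parameter direction. What remains is triangular, hence
invertible. -/
theorem hasFDerivAt_curveMap (f : C(W, W)) (hf : ContDiff ℝ ∞ f) (w : W) :
    HasFDerivAt (curveMap f) (shearEquiv W (primitiveCLM W (f.comp (constCLM W w))) :
      (ℝ × W × C(Icc (0 : ℝ) 1, W)) →L[ℝ] (ℝ × W × C(Icc (0 : ℝ) 1, W)))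
      (0, w, constCLM W w) := by
  have h : ContDiff ℝ ∞ fun z : ℝ × W × C(Icc (0 : ℝ) 1, W) ↦ primitiveCLM W (f.comp z.2.2) :=
    (primitiveCLM W).contDiff.comp ((contDiff_postcomp (X := Icc (0 : ℝ) 1) f hf).comp
    (contDiff_snd.comp (contDiff_snd (𝕜 := ℝ) (E := ℝ) (F := W × C(Icc (0 : ℝ) 1, W)))))
  have h' := (h.differentiable (by simp) (0, w, constCLM W w)).hasFDerivAt
  have h1 : HasFDerivAt (𝕜 := ℝ) (fun z : ℝ × W × C(Icc (0 : ℝ) 1, W) ↦ z.1) _ (0, w, constCLM W w) :=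
    hasFDerivAt_fst
  have h2 : HasFDerivAt (𝕜 := ℝ) (fun z : ℝ × W × C(Icc (0 : ℝ) 1, W) ↦ z.2) _ (0, w, constCLM W w) :=
    hasFDerivAt_snd
  refine (h1.prodMk (h2.fst.prodMk ((h2.snd.sub ((constCLM W).hasFDerivAt.comp _ h2.fst)).sub
    (h1.smul h')))).congr_fderiv ?_
  refine ContinuousLinearMap.ext fun z ↦ ?_
  simp [shearEquiv]

/-- Inverting `curveMap` at `(ε, x, 0)` yields the integral curve from `x` rescaled from `[0, ε]` to
`[0, 1]`, as a smooth function of `(ε, x)` with values in a space of curves. Its value at `1` is the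
flow. -/
theorem exists_smooth_flow (f : W → W) (hf : ContDiff ℝ ∞ f) (w₀ : W) :
    ∃ φ : ℝ × W → W, ∀ᶠ z in 𝓝 ((0 : ℝ), w₀), ContDiffAt ℝ ∞ φ z ∧ φ (0, z.2) = z.2 ∧
      HasDerivAt (fun s ↦ φ (s, z.2)) (f (φ z)) z.1 := by
  set F : C(W, W) := ⟨f, hf.continuous⟩ with hF
  obtain ⟨e, hea, -, hef, hes⟩ := exists_openPartialHomeomorph_contDiffOn isOpen_univ
    (mem_univ _) (contDiff_curveMap F hf).contDiffOn (hasFDerivAt_curveMap F hf w₀)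
  have he₀ : e (0, w₀, constCLM W w₀) = (0, w₀, 0) := by simp [hef, curveMap]
  let γ : ℝ × W → C(Icc (0 : ℝ) 1, W) := fun z ↦ (e.symm (z.1, z.2, 0)).2.2
  let j : ℝ × W → ℝ × W × C(Icc (0 : ℝ) 1, W) := fun z ↦ (z.1, z.2, 0)
  have hj : ContDiff ℝ ∞ j := contDiff_fst.prodMk (contDiff_snd.prodMk contDiff_const)
  have hT : IsOpen (j ⁻¹' e.target) := e.open_target.preimage hj.continuous
  have hγs : ContDiffOn ℝ ∞ γ (j ⁻¹' e.target) :=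
    contDiff_snd.comp_contDiffOn (contDiff_snd.comp_contDiffOn
      (hes.comp hj.contDiffOn fun z hz ↦ hz))
  have hγ : ∀ z ∈ j ⁻¹' e.target,
      γ z = constCLM W z.2 + z.1 • primitiveCLM W (F.comp (γ z)) := by
    intro z hz
    have h := e.right_inv hz
    rw [hef] at h
    have h1 : (e.symm (j z)).1 = z.1 := congrArg Prod.fst h
    have h2 : (e.symm (j z)).2.1 = z.2 := congrArg (fun q ↦ q.2.1) h
    have h3 : (e.symm (j z)).2.2 - constCLM W (e.symm (j z)).2.1
        - (e.symm (j z)).1 • primitiveCLM W (F.comp (e.symm (j z)).2.2) = 0 :=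
      congrArg (fun q ↦ q.2.2) h
    rw [h1, h2, sub_sub, sub_eq_zero] at h3
    exact h3
  -- Injectivity of `e` on its source is the uniqueness statement for integral curves.
  have huniq : ∀ (z : ℝ × W) (δ : C(Icc (0 : ℝ) 1, W)), (z.1, z.2, δ) ∈ e.source →
      δ = constCLM W z.2 + z.1 • primitiveCLM W (F.comp δ) → δ = γ z := by
    intro z δ hz hδ
    have h : e (z.1, z.2, δ) = (z.1, z.2, 0) := by
      rw [hef]
      simp only [curveMap, Prod.mk.injEq, true_and]
      rw [sub_sub, sub_eq_zero]
      exact hδ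
    change δ = (e.symm (z.1, z.2, 0)).2.2
    rw [← h, e.left_inv hz]
  obtain ⟨ρ, hρ, hball⟩ := Metric.isOpen_iff.1 e.open_source _ hea
  have hγ₀ : γ (0, w₀) = constCLM W w₀ := by
    change (e.symm (0, w₀, 0)).2.2 = _
    rw [← he₀, e.left_inv hea]
  have hT₀ : ((0 : ℝ), w₀) ∈ j ⁻¹' e.target := by
    change ((0 : ℝ), w₀, (0 : C(Icc (0 : ℝ) 1, W))) ∈ e.target
    rw [← he₀]
    exact e.map_source hea
  -- points for which the rescaled curves stay in the domain of uniqueness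
  have hgood : ∀ᶠ z in 𝓝 ((0 : ℝ), w₀), z ∈ j ⁻¹' e.target ∧ |z.1| < ρ ∧ dist z.2 w₀ < ρ ∧
      dist (γ z) (constCLM W w₀) < ρ := by
    have c1 : ContinuousAt γ ((0 : ℝ), w₀) := (hγs.contDiffAt (hT.mem_nhds hT₀)).continuousAt
    have c2 : ContinuousAt (fun z : ℝ × W ↦ |z.1|) ((0 : ℝ), w₀) := by fun_prop
    have c3 : ContinuousAt (fun z : ℝ × W ↦ dist z.2 w₀) ((0 : ℝ), w₀) := by fun_prop
    have c4 : ContinuousAt (fun z : ℝ × W ↦ dist (γ z) (constCLM W w₀)) ((0 : ℝ), w₀) := by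
      fun_prop
    filter_upwards [hT.mem_nhds hT₀, c2.eventually_lt_const (u := ρ) (by simpa using hρ),
      c3.eventually_lt_const (u := ρ) (by simpa using hρ),
      c4.eventually_lt_const (u := ρ) (by simpa [hγ₀] using hρ)] with z h1 h2 h3 h4
    exact ⟨h1, h2, h3, h4⟩
  -- The part of the curve over `[0, s]`, stretched back to `[0, 1]`, solves the equation with
  -- parameter `s * z.1` and stays in the ball of uniqueness.
  have hscale : ∀ z : ℝ × W, (z ∈ j ⁻¹' e.target ∧ |z.1| < ρ ∧ dist z.2 w₀ < ρ ∧
      dist (γ z) (constCLM W w₀) < ρ) → ∀ s : Icc (0 : ℝ) 1,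
      γ (s * z.1, z.2) 1 = γ z s := by
    rintro z ⟨h1, h2, h3, h4⟩ s
    let m : C(Icc (0 : ℝ) 1, Icc (0 : ℝ) 1) := ⟨fun τ ↦ s * τ, by fun_prop⟩
    have h5 := huniq (s * z.1, z.2) ((γ z).comp m) ?_ ?_
    · rw [← h5]
      simp [m]
    · apply hball
      simp only [Metric.mem_ball, Prod.dist_eq, max_lt_iff]
      refine ⟨?_, h3, lt_of_le_of_lt ((ContinuousMap.dist_le dist_nonneg).2 fun τ ↦ ?_) h4⟩
      · rw [Real.dist_eq, sub_zero, abs_mul, abs_of_nonneg s.2.1]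
        exact lt_of_le_of_lt (mul_le_of_le_one_left (abs_nonneg _) s.2.2) h2
      · exact (ContinuousMap.dist_apply_le_dist (f := γ z) (g := constCLM W w₀) (m τ))
    · ext τ
      have h6 := congrArg (fun g : C(Icc (0 : ℝ) 1, W) ↦ g (s * τ)) (hγ z h1)
      simp only [ContinuousMap.add_apply, constCLM_apply, ContinuousMap.smul_apply,
        primitiveCLM_apply] at h6
      simp only [ContinuousMap.comp_apply, ContinuousMap.add_apply, constCLM_apply,
        ContinuousMap.smul_apply, primitiveCLM_apply]
      change γ z (s * τ) = _
      rw [h6, mul_smul, smul_comm]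
      congr 2
      simp only [primitiveIcc]
      rw [show ((s * τ : Icc (0 : ℝ) 1) : ℝ) = (s : ℝ) * τ from rfl]
      have h7 := intervalIntegral.smul_integral_comp_mul_left (a := 0) (b := (τ : ℝ))
        (fun σ ↦ F.comp (γ z) (projIcc 0 1 zero_le_one σ)) (s : ℝ)
      rw [mul_zero] at h7
      rw [← h7]
      congr 1
      refine intervalIntegral.integral_congr fun σ hσ ↦ ?_
      rw [uIcc_of_le τ.2.1] at hσ
      have hσ' : σ ∈ Icc (0 : ℝ) 1 := ⟨hσ.1, hσ.2.trans τ.2.2⟩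
      have hσ'' : (s : ℝ) * σ ∈ Icc (0 : ℝ) 1 := ⟨mul_nonneg s.2.1 hσ'.1, mul_le_one₀ s.2.2 hσ'.1 hσ'.2⟩
      simp only [ContinuousMap.comp_apply]
      rw [projIcc_of_mem _ hσ', projIcc_of_mem _ hσ'']
      rfl
  refine ⟨fun z ↦ γ z 1, ?_⟩
  -- The flow near time `η ≠ 0` is read off the curve with parameter `2 * η`, where time `η` is the
  -- interior point `1 / 2` of `[0, 1]`; hence doubled parameters must be good too.
  have hdbl : Tendsto (fun z : ℝ × W ↦ (2 * z.1, z.2)) (𝓝 ((0 : ℝ), w₀)) (𝓝 ((0 : ℝ), w₀)) := by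
    have : Continuous fun z : ℝ × W ↦ (2 * z.1, z.2) := by fun_prop
    simpa using this.tendsto ((0 : ℝ), w₀)
  have hzero : Tendsto (fun z : ℝ × W ↦ ((0 : ℝ), z.2)) (𝓝 ((0 : ℝ), w₀)) (𝓝 ((0 : ℝ), w₀)) := by
    have : Continuous fun z : ℝ × W ↦ ((0 : ℝ), z.2) := by fun_prop
    simpa using this.tendsto ((0 : ℝ), w₀)
  filter_upwards [hgood, hdbl.eventually hgood, hzero.eventually hgood] with z hz hz2 hz0
  have hγ0 : γ (0, z.2) = constCLM W z.2 := by simpa using hγ _ hz0.1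
  refine ⟨?_, by simp [hγ0], ?_⟩
  · exact (ContinuousMap.evalCLM ℝ (1 : Icc (0 : ℝ) 1)).contDiff.contDiffAt.comp z
      (hγs.contDiffAt (hT.mem_nhds hz.1))
  -- At time `0` the scaling relation degenerates. There the integral equation itself is
  -- differentiated, and the derivative is the integral of `f` over a constant curve.
  by_cases h0 : z.1 = 0
  · obtain ⟨z1, x⟩ := z
    simp only at h0 hγ0 hz ⊢
    subst h0
    have hd : DifferentiableAt ℝ (fun s : ℝ ↦ primitiveCLM W (F.comp (γ (s, x))) 1) 0 := by
      have h1 : ContDiffAt ℝ ∞ (fun s : ℝ ↦ γ (s, x)) 0 :=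
        ContDiffAt.comp (g := γ) (f := fun s : ℝ ↦ (s, x)) (0 : ℝ)
          (hγs.contDiffAt (hT.mem_nhds hz.1)) (contDiff_id.prodMk contDiff_const).contDiffAt
      have h2 := (contDiff_postcomp (X := Icc (0 : ℝ) 1) F hf).contDiffAt.comp (0 : ℝ) h1
      have h3 := ((ContinuousMap.evalCLM ℝ (1 : Icc (0 : ℝ) 1)).contDiff.comp
        (primitiveCLM W).contDiff).contDiffAt.comp (0 : ℝ) h2
      exact h3.differentiableAt (by simp)
    have h4 := ((hasDerivAt_id (0 : ℝ)).smul hd.hasDerivAt).const_add x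
    refine (h4.congr_of_eventuallyEq ?_).congr_deriv ?_
    · have hc : ContinuousAt (fun s : ℝ ↦ (s, x)) 0 := by fun_prop
      filter_upwards [hc.preimage_mem_nhds (hT.mem_nhds hz.1)] with s hs
      have := congrArg (fun g : C(Icc (0 : ℝ) 1, W) ↦ g 1) (hγ (s, x) hs)
      simpa using this
    · simp only [id_eq, zero_smul, zero_add, one_smul, hγ0, constCLM_apply, primitiveCLM_apply,
        primitiveIcc, ContinuousMap.comp_apply]
      simp [hF]
  · obtain ⟨η, x⟩ := z
    simp only at h0 hz2 ⊢
    have h1 : ∀ᶠ u in 𝓝 η, γ (u, x) 1 =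
        x + (2 * η) • primitiveIcc (F.comp (γ (2 * η, x))) (u / (2 * η)) := by
      have hc : ContinuousAt (fun u : ℝ ↦ u / (2 * η)) η := by fun_prop
      have hI : Icc (0 : ℝ) 1 ∈ 𝓝 (η / (2 * η)) := by
        apply Icc_mem_nhds <;> · rw [mul_comm, ← div_div, div_self h0]; norm_num
      filter_upwards [hc.preimage_mem_nhds hI] with u hu
      have h2 := hscale (2 * η, x) hz2 ⟨_, hu⟩
      simp only at h2
      rw [div_mul_cancel₀ u (mul_ne_zero two_ne_zero h0)] at h2
      rw [h2]
      exact congrArg (fun g : C(Icc (0 : ℝ) 1, W) ↦ g ⟨_, hu⟩) (hγ (2 * η, x) hz2.1)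
    have h3 : HasDerivAt (fun u : ℝ ↦ u / (2 * η)) (1 / (2 * η)) η :=
      (hasDerivAt_id η).div_const _
    have h4 := (((hasDerivAt_primitiveIcc (F.comp (γ (2 * η, x))) (η / (2 * η))).scomp η h3).const_smul
      (2 * η)).const_add x
    refine (h4.congr_of_eventuallyEq h1).congr_deriv ?_
    have h5 : η / (2 * η) = 1 / 2 := by field_simp
    have h6 : (1 / 2 : ℝ) ∈ Icc (0 : ℝ) 1 := by constructor <;> norm_num
    have h7 := hscale (2 * η, x) hz2 ⟨_, h6⟩
    simp only at h7
    rw [show (1 / 2 : ℝ) * (2 * η) = η by ring] at h7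
    rw [h5, projIcc_of_mem _ h6, ContinuousMap.comp_apply, ← h7, smul_smul,
      mul_one_div_cancel (mul_ne_zero two_ne_zero h0), one_smul]
    rfl

end Flow

/-! ### Flow boxes, with a linear differential equation solved along the flow. -/

section FlowBox

variable {Y : Type*} [NormedAddCommGroup Y] [NormedSpace ℝ Y] [FiniteDimensional ℝ Y]

theorem exists_contDiff_eventuallyEq {Z : Type*} [NormedAddCommGroup Z] [NormedSpace ℝ Z]
    {f : Y → Z} {u : Set Y} (hu : IsOpen u) (hf : ContDiffOn ℝ ∞ f u) {y₀ : Y} (hy₀ : y₀ ∈ u) :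
    ∃ g : Y → Z, ContDiff ℝ ∞ g ∧ g =ᶠ[𝓝 y₀] f := by
  obtain ⟨ε, hε, hball⟩ := Metric.isOpen_iff.1 hu y₀ hy₀
  let b : ContDiffBump y₀ := ⟨ε / 4, ε / 2, by positivity, by linarith⟩
  refine ⟨fun y ↦ b y • f y, contDiff_iff_contDiffAt.2 fun y ↦ ?_, ?_⟩
  · by_cases hy : y ∈ u
    · exact b.contDiff.contDiffAt.smul (hf.contDiffAt (hu.mem_nhds hy))
    · have hy' : y ∉ tsupport b := by
        rw [b.tsupport_eq]
        intro h
        exact hy (hball (lt_of_le_of_lt h (by change ε / 2 < ε; linarith)))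
      refine contDiffAt_const (c := (0 : Z)).congr_of_eventuallyEq ?_
      filter_upwards [(isClosed_tsupport b).isOpen_compl.mem_nhds hy'] with z hz
      rw [image_eq_zero_of_notMem_tsupport hz, zero_smul]
  · filter_upwards [b.eventuallyEq_one] with y hy
    simp [hy]

/-- Straightening of a nonvanishing vector field `η`, together with a solution of the linear
differential equation `η g = - Γ g`. -/
theorem exists_flowBox {R : Type*} [NormedRing R] [NormedAlgebra ℝ R] [CompleteSpace R]
    (η : Y → Y) (hη : ContDiff ℝ ∞ η) (Γ : Y → R) (hΓ : ContDiff ℝ ∞ Γ) (y₀ : Y)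
    (hy₀ : η y₀ ≠ 0) :
    ∃ (K : Submodule ℝ Y) (e : OpenPartialHomeomorph Y (ℝ × K)) (g : Y → R),
      Module.finrank ℝ K + 1 = Module.finrank ℝ Y ∧ y₀ ∈ e.source ∧
      ContDiffOn ℝ ∞ e e.source ∧ ContDiffOn ℝ ∞ e.symm e.target ∧
      (∀ y ∈ e.source, fderiv ℝ e y (η y) = (1, 0)) ∧
      ContDiffOn ℝ ∞ g e.source ∧ g y₀ = 1 ∧
      ∀ y ∈ e.source, fderiv ℝ g y (η y) = - (Γ y * g y) := by
  have : CompleteSpace Y := FiniteDimensional.complete ℝ Y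
  -- The flow of the augmented field carries `y` along `η` and at the same time solves the linear
  -- equation in the second component.
  let f : Y × R → Y × R := fun w ↦ (η w.1, - (Γ w.1 * w.2))
  have hf : ContDiff ℝ ∞ f :=
    (hη.comp contDiff_fst).prodMk (((hΓ.comp contDiff_fst).mul contDiff_snd).neg)
  obtain ⟨φ, hφ⟩ := exists_smooth_flow f hf (y₀, 1)
  -- Flowing out of the affine hyperplane `y₀ + K`, transverse to `η y₀`, gives the coordinates; the
  -- linear equation starts there with the value `1`.
  obtain ⟨K, hK⟩ := Submodule.exists_isCompl (Submodule.span ℝ {η y₀})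
  let j : ℝ × K → ℝ × (Y × R) := fun z ↦ (z.1, (y₀ + z.2, 1))
  have hj : ContDiff ℝ ∞ j :=
    contDiff_fst.prodMk ((contDiff_const.add (K.subtypeL.contDiff.comp contDiff_snd)).prodMk
      contDiff_const)
  have hj0 : j 0 = (0, (y₀, 1)) := by simp [j]
  have hev : ∀ᶠ z in 𝓝 (0 : ℝ × K), ContDiffAt ℝ ∞ φ (j z) ∧ φ (0, (j z).2) = (j z).2 ∧
      HasDerivAt (fun s ↦ φ (s, (j z).2)) (f (φ (j z))) (j z).1 := by
    have h1 := hj.continuous.tendsto 0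
    rw [hj0] at h1
    exact h1.eventually hφ
  obtain ⟨u, hu, huo, h0u⟩ := eventually_nhds_iff.1 hev
  let S : ℝ × K → Y := fun z ↦ (φ (j z)).1
  have hφj : ContDiffOn ℝ ∞ (fun z ↦ φ (j z)) u := fun z hz ↦
    ((hu z hz).1.comp z hj.contDiffAt).contDiffWithinAt
  have hS : ContDiffOn ℝ ∞ S u := contDiff_fst.comp_contDiffOn hφj
  have hDφ : ∀ z ∈ u, HasFDerivAt (fun z ↦ φ (j z)) (fderiv ℝ (fun z ↦ φ (j z)) z) z := fun z hz ↦
    ((hφj.contDiffAt (huo.mem_nhds hz)).differentiableAt (by simp)).hasFDerivAt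
  have hφs : ∀ z ∈ u, fderiv ℝ (fun z ↦ φ (j z)) z (1, 0) = f (φ (j z)) := by
    intro z hz
    have hc : HasDerivAt (fun s : ℝ ↦ (s, z.2)) ((1 : ℝ), (0 : K)) z.1 :=
      (hasDerivAt_id z.1).prodMk (hasDerivAt_const _ _)
    exact ((hDφ z hz).comp_hasDerivAt (f := fun s : ℝ ↦ (s, z.2)) z.1 hc).unique (hu z hz).2.2
  have hDS : ∀ z ∈ u, HasFDerivAt S
      ((ContinuousLinearMap.fst ℝ Y R).comp (fderiv ℝ (fun z ↦ φ (j z)) z)) z := fun z hz ↦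
    (ContinuousLinearMap.fst ℝ Y R).hasFDerivAt.comp z (hDφ z hz)
  have hφ0 : φ (j 0) = (y₀, 1) := by
    have := (hu 0 h0u).2.1
    rw [hj0] at this ⊢
    exact this
  have hS0 : S 0 = y₀ := congrArg Prod.fst hφ0
  let D := (ContinuousLinearMap.fst ℝ Y R).comp (fderiv ℝ (fun z ↦ φ (j z)) 0)
  -- The time direction contributes `η y₀`. On the hyperplane the flow at time `0` is the identity.
  -- So `D` is bijective because `K` is complementary to the line of `η y₀`.
  have hD : ∀ z : ℝ × K, D z = z.1 • η y₀ + z.2 := by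
    rintro ⟨a, k⟩
    have h1 : D (1, 0) = η y₀ := by
      change (fderiv ℝ (fun z ↦ φ (j z)) 0 (1, 0)).1 = _
      rw [hφs 0 h0u, hφ0]
    have h2 : D (0, k) = k := by
      have hc : HasDerivAt (fun s : ℝ ↦ ((0 : ℝ), s • k)) ((0 : ℝ), k) 0 := by
        simpa using (hasDerivAt_const (0 : ℝ) (0 : ℝ)).prodMk
          ((hasDerivAt_id (0 : ℝ)).smul_const k)
      have hDS0 : HasFDerivAt S D ((0 : ℝ), (0 : ℝ) • k) := by
        rw [zero_smul]; exact hDS 0 h0u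
      have h3 := hDS0.comp_hasDerivAt (f := fun s : ℝ ↦ ((0 : ℝ), s • k)) 0 hc
      have h4 : HasDerivAt (fun s : ℝ ↦ y₀ + s • (k : Y)) (k : Y) 0 := by
        simpa using ((hasDerivAt_id (0 : ℝ)).smul_const (k : Y)).const_add y₀
      refine h3.unique (h4.congr_of_eventuallyEq ?_)
      have hcc : ContinuousAt (fun s : ℝ ↦ ((0 : ℝ), s • k)) 0 := hc.continuousAt
      have hmem : u ∈ 𝓝 ((0 : ℝ), (0 : ℝ) • k) := by
        rw [zero_smul]; exact huo.mem_nhds h0u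
      filter_upwards [hcc.preimage_mem_nhds hmem] with s hs
      exact congrArg Prod.fst (hu _ hs).2.1
    have : ((a, k) : ℝ × K) = a • (1, 0) + (0, k) := by simp
    rw [this, map_add, map_smul, h1, h2]
    simp
  have hker : LinearMap.ker (D : ℝ × K →ₗ[ℝ] Y) = ⊥ := by
    rw [LinearMap.ker_eq_bot']
    rintro ⟨a, k⟩ hz
    have h1 : a • η y₀ + k = 0 := by rw [← hD (a, k)]; exact hz
    have h2 : a • η y₀ ∈ Submodule.span ℝ {η y₀} :=
      Submodule.smul_mem _ _ (Submodule.mem_span_singleton_self _)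
    have h3 : a • η y₀ ∈ K := by
      rw [eq_neg_of_add_eq_zero_left h1]
      exact K.neg_mem k.2
    have h4 : a • η y₀ = 0 := Submodule.disjoint_def.1 hK.disjoint _ h2 h3
    have h5 : a = 0 := (smul_eq_zero.1 h4).resolve_right hy₀
    rw [h4, zero_add] at h1
    exact Prod.ext h5 (Subtype.ext h1)
  have hran : LinearMap.range (D : ℝ × K →ₗ[ℝ] Y) = ⊤ := by
    rw [eq_top_iff]
    intro y _
    obtain ⟨v, hv, k, hk, rfl⟩ := Submodule.mem_sup.1 (hK.sup_eq_top ▸ Submodule.mem_top (x := y))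
    obtain ⟨a, rfl⟩ := Submodule.mem_span_singleton.1 hv
    exact ⟨(a, ⟨k, hk⟩), hD _⟩
  have hDS0 : HasFDerivAt S ((ContinuousLinearEquiv.ofBijective D hker hran :
      (ℝ × K) ≃L[ℝ] Y) : ℝ × K →L[ℝ] Y) 0 := by
    rw [ContinuousLinearEquiv.coe_ofBijective]
    exact hDS 0 h0u
  obtain ⟨e, h0e, heu, heS, hes⟩ := exists_openPartialHomeomorph_contDiffOn huo h0u hS hDS0
  have hesd : ∀ y ∈ e.target, HasFDerivAt e.symm (fderiv ℝ e.symm y) y := fun y hy ↦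
    ((hes.contDiffAt (e.open_target.mem_nhds hy)).differentiableAt (by simp)).hasFDerivAt
  have hstr : ∀ y ∈ e.target, fderiv ℝ e.symm y (η y) = (1, 0) := by
    intro y hy
    have hz := e.map_target hy
    have hSz : S (e.symm y) = y := by rw [← heS, e.right_inv hy]
    have h1 := (hDS _ (heu hz))
    have h2 : HasFDerivAt e.symm (fderiv ℝ e.symm y) (S (e.symm y)) := by
      rw [hSz]; exact hesd y hy
    have h3 := (h2.comp _ h1).congr_of_eventuallyEq (f₁ := id) (by
      filter_upwards [e.open_source.mem_nhds hz] with z hz'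
      simp only [id, Function.comp]
      rw [← heS, e.left_inv hz'])
    have h4 := congrArg (fun l : (ℝ × K) →L[ℝ] (ℝ × K) ↦ l (1, 0)) (h3.unique (hasFDerivAt_id _))
    simp only [ContinuousLinearMap.comp_apply, ContinuousLinearMap.id_apply] at h4
    rw [hφs _ (heu hz)] at h4
    have h5 : (ContinuousLinearMap.fst ℝ Y R) (f (φ (j (e.symm y)))) = η y := by
      change η (S (e.symm y)) = _
      rw [hSz]
    rwa [h5] at h4
  refine ⟨K, e.symm, fun y ↦ (φ (j (e.symm y))).2, ?_, ?_, hes, ?_, hstr, ?_, ?_, ?_⟩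
  · have := Submodule.finrank_add_eq_of_isCompl hK
    rw [finrank_span_singleton hy₀] at this
    omega
  · have := e.map_source h0e
    rwa [heS, hS0] at this
  · exact (hS.mono heu).congr fun z _ ↦ heS z
  · exact contDiff_snd.comp_contDiffOn (hφj.comp hes fun y hy ↦ heu (e.map_target hy))
  · have : e.symm y₀ = 0 := by rw [← hS0, ← heS, e.left_inv h0e]
    simp only
    rw [this, hφ0]
  · intro y hy
    have hz := e.map_target hy
    have hSz : (φ (j (e.symm y))).1 = y := by
      change S (e.symm y) = y
      rw [← heS, e.right_inv hy]
    have h1 := (ContinuousLinearMap.snd ℝ Y R).hasFDerivAt.comp y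
      ((hDφ _ (heu hz)).comp y (hesd y hy))
    have h2 : HasFDerivAt (fun y ↦ (φ (j (e.symm y))).2) _ y := h1
    rw [h2.fderiv]
    simp only [ContinuousLinearMap.comp_apply]
    rw [hstr y hy, hφs _ (heu hz)]
    simp [f, hSz]

end FlowBox

/-! ### Extension of local functions, sections and coordinates by cut-off. -/

section Extension

variable {V H M : Type*} [NormedAddCommGroup V] [NormedSpace ℝ V] [FiniteDimensional ℝ V]
  [TopologicalSpace H] {I : ModelWithCorners ℝ V H} [TopologicalSpace M] [ChartedSpace H M]
  [T2Space M] [IsManifold I ∞ M]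
  {F : Type*} [NormedAddCommGroup F] [NormedSpace ℝ F]
  {E : M → Type*} [TopologicalSpace (TotalSpace F E)]
  [∀ x, AddCommGroup (E x)] [∀ x, Module ℝ (E x)] [∀ x, TopologicalSpace (E x)]
  [FiberBundle F E] [VectorBundle ℝ F E]

variable (I) in
theorem exists_bump {u : Set M} {p : M} (hu : u ∈ 𝓝 p) :
    ∃ χ : C^∞⟮I, M; ℝ⟯, (∀ᶠ x in 𝓝 p, χ x = 1) ∧ tsupport χ ⊆ u := by
  obtain ⟨f, -, hf⟩ := (SmoothBumpFunction.nhds_basis_tsupport (I := I) p).mem_iff.1 hu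
  exact ⟨⟨f, f.contMDiff⟩, f.eventuallyEq_one, hf⟩

theorem exists_section_eventuallyEq {s : ∀ x, E x} {u : Set M} (hu : IsOpen u) {p : M} (hp : p ∈ u)
    (hs : ContMDiffOn I (I.prod 𝓘(ℝ, F)) ∞ (fun x ↦ TotalSpace.mk' F x (s x)) u) :
    ∃ σ : Cₛ^∞⟮I; F, E⟯, (∀ᶠ x in 𝓝 p, σ x = s x) ∧ ∀ x, σ x ≠ 0 → x ∈ u := by
  obtain ⟨χ, h1, h2⟩ := exists_bump I (hu.mem_nhds hp)
  refine ⟨⟨fun x ↦ χ x • s x, ContMDiffOn.smul_section_of_tsupport χ.contMDiff.contMDiffOn hu h2 hs⟩, ?_, ?_⟩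
  · filter_upwards [h1] with x hx
    change χ x • s x = s x
    rw [hx, one_smul]
  · intro x hx
    by_contra hxu
    refine hx ?_
    change χ x • s x = 0
    rw [image_eq_zero_of_notMem_tsupport fun h ↦ hxu (h2 h), zero_smul]

theorem exists_contMDiffMap_eventuallyEq {G : Type*} [NormedAddCommGroup G] [NormedSpace ℝ G]
    {f : M → G} {u : Set M} (hu : IsOpen u) {p : M} (hp : p ∈ u)
    (hf : ContMDiffOn I 𝓘(ℝ, G) ∞ f u) :
    ∃ g : C^∞⟮I, M; 𝓘(ℝ, G), G⟯, ∀ᶠ x in 𝓝 p, g x = f x := by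
  obtain ⟨χ, h1, h2⟩ := exists_bump I (hu.mem_nhds hp)
  refine ⟨⟨fun x ↦ χ x • f x, fun x ↦ ?_⟩, ?_⟩
  · by_cases hx : x ∈ u
    · exact χ.contMDiff.contMDiffAt.smul (hf.contMDiffAt (hu.mem_nhds hx))
    · refine (contMDiffAt_const (c := (0 : G))).congr_of_eventuallyEq ?_
      filter_upwards [(isClosed_tsupport χ).isOpen_compl.mem_nhds fun h ↦ hx (h2 h)] with z hz
      rw [image_eq_zero_of_notMem_tsupport hz, zero_smul]
  · filter_upwards [h1] with x hx
    change χ x • f x = f x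
    rw [hx, one_smul]

variable (I F E) in
theorem exists_section_apply_eq [ContMDiffVectorBundle ∞ F E I] (p : M) (v : E p) :
    ∃ σ : Cₛ^∞⟮I; F, E⟯, σ p = v := by
  let e := trivializationAt F E p
  have hp : p ∈ e.baseSet := mem_baseSet_trivializationAt F E p
  have hs : ContMDiffOn I (I.prod 𝓘(ℝ, F)) ∞
      (fun x ↦ TotalSpace.mk' F x (e.symm x (e ⟨p, v⟩).2)) e.baseSet := by
    rw [e.contMDiffOn_section_baseSet_iff]
    refine (contMDiffOn_const (c := (e ⟨p, v⟩).2)).congr fun x hx ↦ ?_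
    rw [e.apply_mk_symm hx]
  obtain ⟨σ, hσ, -⟩ := exists_section_eventuallyEq e.open_baseSet hp hs
  refine ⟨σ, hσ.self_of_nhds.trans ?_⟩
  exact e.symm_proj_apply ⟨p, v⟩ hp

-- The components of a chart, cut off to global functions, do this: the derivative of the chart at
-- `x` is invertible.
variable (I) in
theorem exists_coordinates (x : M) :
    ∃ y : Fin (Module.finrank ℝ V) → C^∞⟮I, M; ℝ⟯,
      ∀ v : TangentSpace I x, (∀ i, mvfderiv I (y i) x v = 0) → v = 0 := by
  have hc : ContMDiffOn I 𝓘(ℝ, V) ∞ (extChartAt I x) (chartAt H x).source := contMDiffOn_extChartAt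
  obtain ⟨g, hg⟩ := exists_contMDiffMap_eventuallyEq (chartAt H x).open_source
    (mem_chart_source H x) hc
  let l (i : Fin (Module.finrank ℝ V)) : V →L[ℝ] ℝ :=
    LinearMap.toContinuousLinearMap ((Module.finBasis ℝ V).coord i)
  refine ⟨fun i ↦ ⟨fun y ↦ l i (g y), (l i).contMDiff.comp g.contMDiff⟩, fun v hv ↦ ?_⟩
  have h1 : mfderiv I 𝓘(ℝ, V) (extChartAt I x) x v = 0 := by
    have h2 : mfderiv I 𝓘(ℝ, V) g x = mfderiv I 𝓘(ℝ, V) (extChartAt I x) x :=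
      Filter.EventuallyEq.mfderiv_eq hg
    rw [← h2]
    refine (Module.finBasis ℝ V).forall_coord_eq_zero_iff.1 fun i ↦ ?_
    have h4 : mvfderiv I (l i ∘ g) x v
        = mvfderiv 𝓘(ℝ, V) (l i) (g x) (mfderiv I 𝓘(ℝ, V) g x v) :=
      mvfderiv_comp_apply x ((l i).contMDiff.mdifferentiableAt (n := ∞) (by simp))
        (g.contMDiff.mdifferentiableAt (by simp)) v
    have h5 : mvfderiv 𝓘(ℝ, V) (l i) (g x) (mfderiv I 𝓘(ℝ, V) g x v)
        = l i (mfderiv I 𝓘(ℝ, V) g x v) := by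
      change (mfderiv 𝓘(ℝ, V) 𝓘(ℝ, ℝ) (l i) (g x)) _ = _
      rw [mfderiv_eq_fderiv, (l i).fderiv]
      rfl
    exact h5.symm.trans (h4.symm.trans (hv i))
  have h6 := isInvertible_mfderiv_extChartAt (I := I) (mem_extChartAt_source (I := I) x)
  exact h6.injective (by rw [h1, map_zero])

/-- Smooth functions separate tangent vectors. -/
theorem tangentVector_eq_zero (x : M) (v : TangentSpace I x)
    (hv : ∀ f : C^∞⟮I, M; ℝ⟯, mvfderiv I f x v = 0) : v = 0 :=
  let ⟨y, hy⟩ := exists_coordinates I x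
  hy v fun i ↦ hv (y i)

end Extension

/-! ### Calculus of brackets, pairings and anchors. -/

section Algebra

variable {V H M : Type*} [NormedAddCommGroup V] [NormedSpace ℝ V]
  [TopologicalSpace H] {I : ModelWithCorners ℝ V H} [TopologicalSpace M] [ChartedSpace H M]
  {F : Type*} [NormedAddCommGroup F] [NormedSpace ℝ F]
  {E : M → Type*} [TopologicalSpace (TotalSpace F E)]
  [∀ x, AddCommGroup (E x)] [∀ x, Module ℝ (E x)] [∀ x, TopologicalSpace (E x)]
  [FiberBundle F E] [VectorBundle ℝ F E]

/-- The module of smooth sections over the ring of smooth functions. -/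
instance sectionModule : Module C^∞⟮I, M; ℝ⟯ Cₛ^∞⟮I; F, E⟯ where
  smul := smulSection
  one_smul _ := ContMDiffSection.ext fun _ ↦ one_smul ℝ _
  mul_smul _ _ _ := ContMDiffSection.ext fun _ ↦ mul_smul (α := ℝ) _ _ _
  smul_zero _ := ContMDiffSection.ext fun _ ↦ smul_zero (M := ℝ) _
  smul_add _ _ _ := ContMDiffSection.ext fun _ ↦ smul_add (M := ℝ) _ _ _
  add_smul _ _ _ := ContMDiffSection.ext fun _ ↦ add_smul (R := ℝ) _ _ _
  zero_smul _ := ContMDiffSection.ext fun _ ↦ zero_smul ℝ _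

theorem section_smul_apply (f : C^∞⟮I, M; ℝ⟯) (α : Cₛ^∞⟮I; F, E⟯) (x : M) :
    (f • α) x = f x • α x := rfl

theorem section_add_apply (α β : Cₛ^∞⟮I; F, E⟯) (x : M) : (α + β) x = α x + β x := rfl

theorem section_sub_apply (α β : Cₛ^∞⟮I; F, E⟯) (x : M) : (α - β) x = α x - β x := rfl

theorem section_zero_apply (x : M) : (0 : Cₛ^∞⟮I; F, E⟯) x = 0 := rfl

theorem section_sum_apply {ι : Type*} (s : Finset ι) (α : ι → Cₛ^∞⟮I; F, E⟯) (x : M) :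
    (∑ i ∈ s, α i) x = ∑ i ∈ s, α i x := by
  classical
  induction s using Finset.induction_on with
  | empty => simp [section_zero_apply]
  | insert i s hi ih => rw [Finset.sum_insert hi, Finset.sum_insert hi, section_add_apply, ih]

theorem map_add_apply (f g : C^∞⟮I, M; ℝ⟯) (x : M) : (f + g) x = f x + g x := rfl

theorem map_sub_apply (f g : C^∞⟮I, M; ℝ⟯) (x : M) : (f - g) x = f x - g x := rfl

theorem map_mul_apply (f g : C^∞⟮I, M; ℝ⟯) (x : M) : (f * g) x = f x * g x := rfl

theorem map_zero_apply (x : M) : (0 : C^∞⟮I, M; ℝ⟯) x = 0 := rfl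

theorem map_one_apply (x : M) : (1 : C^∞⟮I, M; ℝ⟯) x = 1 := rfl

theorem map_sum_apply {ι : Type*} (s : Finset ι) (f : ι → C^∞⟮I, M; ℝ⟯) (x : M) :
    (∑ i ∈ s, f i) x = ∑ i ∈ s, f i x := by
  classical
  induction s using Finset.induction_on with
  | empty => simp [map_zero_apply]
  | insert i s hi ih => rw [Finset.sum_insert hi, Finset.sum_insert hi, map_add_apply, ih]

theorem mdiffAt_map (f : C^∞⟮I, M; ℝ⟯) (x : M) : MDifferentiableAt I 𝓘(ℝ, ℝ) f x :=
  f.contMDiff.mdifferentiableAt (by simp)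

variable [IsManifold I ∞ M]

namespace CourantAlgebroid

variable (A : CourantAlgebroid I F E)

/-- The pairing of two sections, as a smooth function. -/
def pair (α β : Cₛ^∞⟮I; F, E⟯) : C^∞⟮I, M; ℝ⟯ :=
  ⟨fun x ↦ A.pairing x (α x) (β x), A.pairing_smooth α β⟩

theorem pair_apply (α β : Cₛ^∞⟮I; F, E⟯) (x : M) :
    A.pair α β x = A.pairing x (α x) (β x) := rfl

theorem contMDiff_anchor_section (α : Cₛ^∞⟮I; F, E⟯) :
    ContMDiff I I.tangent ∞ fun x ↦ (⟨x, A.anchor x (α x)⟩ : TangentBundle I M) :=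
  A.anchor_smooth.comp α.contMDiff

/-- The derivative `ρ(α) f` of a function in the direction of the anchor of a section. -/
def der (α : Cₛ^∞⟮I; F, E⟯) (f : C^∞⟮I, M; ℝ⟯) : C^∞⟮I, M; ℝ⟯ :=
  ⟨fun x ↦ mvfderiv I f x (A.anchor x (α x)), by
    have h := (f.contMDiff.contMDiff_tangentMap (m := ∞) (by simp)).comp
      (A.contMDiff_anchor_section α)
    exact (contMDiff_snd_tangentBundle_modelSpace ℝ 𝓘(ℝ, ℝ)).comp h⟩

theorem der_apply (α : Cₛ^∞⟮I; F, E⟯) (f : C^∞⟮I, M; ℝ⟯) (x : M) :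
    A.der α f x = mvfderiv I f x (A.anchor x (α x)) := rfl

theorem pair_comm (α β : Cₛ^∞⟮I; F, E⟯) : A.pair α β = A.pair β α :=
  ContMDiffMap.ext fun _ ↦ A.pairing_symm _ _ _

theorem pair_add_left (α β γ : Cₛ^∞⟮I; F, E⟯) :
    A.pair (α + β) γ = A.pair α γ + A.pair β γ :=
  ContMDiffMap.ext fun x ↦ by
    simp only [pair_apply, section_add_apply, map_add, LinearMap.add_apply, map_add_apply]

theorem pair_sub_left (α β γ : Cₛ^∞⟮I; F, E⟯) :
    A.pair (α - β) γ = A.pair α γ - A.pair β γ :=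
  ContMDiffMap.ext fun x ↦ by
    simp only [pair_apply, section_sub_apply, map_sub, LinearMap.sub_apply, map_sub_apply]

theorem pair_zero_left (γ : Cₛ^∞⟮I; F, E⟯) : A.pair 0 γ = 0 :=
  ContMDiffMap.ext fun x ↦ by
    simp only [pair_apply, section_zero_apply, map_zero, LinearMap.zero_apply, map_zero_apply]

theorem pair_smul_left (f : C^∞⟮I, M; ℝ⟯) (α γ : Cₛ^∞⟮I; F, E⟯) :
    A.pair (f • α) γ = f * A.pair α γ :=
  ContMDiffMap.ext fun x ↦ by
    simp only [pair_apply, section_smul_apply, map_smul, LinearMap.smul_apply, map_mul_apply,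
      smul_eq_mul]

theorem pair_sum_left {ι : Type*} (s : Finset ι) (α : ι → Cₛ^∞⟮I; F, E⟯) (γ : Cₛ^∞⟮I; F, E⟯) :
    A.pair (∑ i ∈ s, α i) γ = ∑ i ∈ s, A.pair (α i) γ :=
  ContMDiffMap.ext fun x ↦ by
    simp only [pair_apply, section_sum_apply, map_sum, LinearMap.sum_apply, map_sum_apply]

theorem pair_sub_right (α β γ : Cₛ^∞⟮I; F, E⟯) :
    A.pair γ (α - β) = A.pair γ α - A.pair γ β := by
  simp only [A.pair_comm γ, pair_sub_left]

theorem pair_zero_right (γ : Cₛ^∞⟮I; F, E⟯) : A.pair γ 0 = 0 := by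
  rw [A.pair_comm, pair_zero_left]

theorem pair_smul_right (f : C^∞⟮I, M; ℝ⟯) (α γ : Cₛ^∞⟮I; F, E⟯) :
    A.pair γ (f • α) = f * A.pair γ α := by
  simp only [A.pair_comm γ, pair_smul_left]

theorem pair_sum_right {ι : Type*} (s : Finset ι) (α : ι → Cₛ^∞⟮I; F, E⟯) (γ : Cₛ^∞⟮I; F, E⟯) :
    A.pair γ (∑ i ∈ s, α i) = ∑ i ∈ s, A.pair γ (α i) := by
  simp only [A.pair_comm γ, pair_sum_left]

theorem der_add_left (α β : Cₛ^∞⟮I; F, E⟯) (f : C^∞⟮I, M; ℝ⟯) :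
    A.der (α + β) f = A.der α f + A.der β f :=
  ContMDiffMap.ext fun x ↦ by
    simp only [der_apply, section_add_apply, map_add, map_add_apply]

theorem der_sub_left (α β : Cₛ^∞⟮I; F, E⟯) (f : C^∞⟮I, M; ℝ⟯) :
    A.der (α - β) f = A.der α f - A.der β f :=
  ContMDiffMap.ext fun x ↦ by
    simp only [der_apply, section_sub_apply, map_sub, map_sub_apply]

theorem der_zero_left (f : C^∞⟮I, M; ℝ⟯) : A.der 0 f = 0 :=
  ContMDiffMap.ext fun x ↦ by
    simp only [der_apply, section_zero_apply, map_zero, map_zero_apply]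

theorem der_smul_left (g : C^∞⟮I, M; ℝ⟯) (α : Cₛ^∞⟮I; F, E⟯) (f : C^∞⟮I, M; ℝ⟯) :
    A.der (g • α) f = g * A.der α f :=
  ContMDiffMap.ext fun x ↦ by
    simp only [der_apply, section_smul_apply, map_smul, map_mul_apply, smul_eq_mul]

theorem der_add (α : Cₛ^∞⟮I; F, E⟯) (f g : C^∞⟮I, M; ℝ⟯) :
    A.der α (f + g) = A.der α f + A.der α g :=
  ContMDiffMap.ext fun x ↦ by
    simp only [der_apply, map_add_apply]
    rw [ContMDiffMap.coe_add, mvfderiv_add (mdiffAt_map f x) (mdiffAt_map g x)]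
    rfl

theorem der_mul (α : Cₛ^∞⟮I; F, E⟯) (f g : C^∞⟮I, M; ℝ⟯) :
    A.der α (f * g) = f * A.der α g + g * A.der α f :=
  ContMDiffMap.ext fun x ↦ by
    simp only [der_apply, map_add_apply, map_mul_apply]
    rw [ContMDiffMap.coe_mul, mvfderiv_mul (mdiffAt_map f x) (mdiffAt_map g x)]
    rfl

theorem der_zero (α : Cₛ^∞⟮I; F, E⟯) : A.der α 0 = 0 := by
  have := A.der_add α 0 0
  simpa using this

theorem der_congr {f g : C^∞⟮I, M; ℝ⟯} {x : M} (h : ∀ᶠ y in 𝓝 x, f y = g y)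
    (α : Cₛ^∞⟮I; F, E⟯) : A.der α f x = A.der α g x := by
  rw [der_apply, der_apply, mvfderiv, mvfderiv, Filter.EventuallyEq.mfderiv_eq h]
  have := h.self_of_nhds
  rfl

theorem der_eq_zero_of_eventually_const {f : C^∞⟮I, M; ℝ⟯} {x : M} {c : ℝ}
    (h : ∀ᶠ y in 𝓝 x, f y = c) (α : Cₛ^∞⟮I; F, E⟯) : A.der α f x = 0 := by
  let g : C^∞⟮I, M; ℝ⟯ := ⟨fun _ ↦ c, contMDiff_const⟩
  refine (A.der_congr (g := g) h α).trans ?_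
  have h1 : mvfderiv I (fun _ : M ↦ c) x = 0 := mvfderiv_const c
  exact congrArg (fun L : TangentSpace I x →L[ℝ] ℝ ↦ L (A.anchor x (α x))) h1

theorem bracket_smul_right (f : C^∞⟮I, M; ℝ⟯) (α β : Cₛ^∞⟮I; F, E⟯) :
    A.bracket α (f • β) = f • A.bracket α β + A.der α f • β :=
  ContMDiffSection.ext fun x ↦ A.leibniz α β f x

theorem der_pair (α β γ : Cₛ^∞⟮I; F, E⟯) :
    A.der α (A.pair β γ) = A.pair (A.bracket α β) γ + A.pair β (A.bracket α γ) :=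
  ContMDiffMap.ext fun x ↦ A.invariance α β γ x

theorem pair_bracket_add_bracket (α β ε : Cₛ^∞⟮I; F, E⟯) :
    A.pair (A.bracket α β + A.bracket β α) ε = A.der ε (A.pair α β) :=
  ContMDiffMap.ext fun x ↦ A.symmetrization α β x (ε x)

theorem pair_bracket_eq (α β ε : Cₛ^∞⟮I; F, E⟯) :
    A.pair (A.bracket α β) ε = A.der ε (A.pair α β) - A.pair (A.bracket β α) ε := by
  rw [← pair_bracket_add_bracket, pair_add_left, add_sub_cancel_right]

/-- Symmetrization trades `[fα, β]` for `[β, fα]`, to which the Leibniz rule applies. The last term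
is the contribution of `ρ^* df`. -/
theorem pair_bracket_smul_left (f : C^∞⟮I, M; ℝ⟯) (α β ε : Cₛ^∞⟮I; F, E⟯) :
    A.pair (A.bracket (f • α) β) ε = f * A.pair (A.bracket α β) ε - A.der β f * A.pair α ε
      + A.pair α β * A.der ε f := by
  rw [A.pair_bracket_eq, A.pair_bracket_eq α β, bracket_smul_right, pair_smul_left, der_mul,
    pair_add_left, pair_smul_left, pair_smul_left]
  ring

/-- Expanding the Jacobi identity for `α, β, fγ` by the Leibniz rule, everything cancels against the
identity for `α, β, γ` except the terms with two derivatives of `f`. -/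
theorem der_bracket_smul (α β γ : Cₛ^∞⟮I; F, E⟯) (f : C^∞⟮I, M; ℝ⟯) :
    (A.der (A.bracket α β) f - (A.der α (A.der β f) - A.der β (A.der α f))) • γ = 0 := by
  have h := A.jacobi α β (f • γ)
  have h0 := A.jacobi α β γ
  simp only [bracket_smul_right, map_add, ← h0, smul_add] at h
  rw [← sub_eq_zero] at h
  rw [← h]
  module

section Local

variable [FiniteDimensional ℝ V] [T2Space M] [ContMDiffVectorBundle ∞ F E I]

/-- With a cut-off `χ` supported where `β` vanishes, `β = (1 - χ) β`, and both Leibniz terms vanish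
at `x`. -/
theorem bracket_apply_eq_zero_right {α β : Cₛ^∞⟮I; F, E⟯} {x : M} (h : ∀ᶠ y in 𝓝 x, β y = 0) :
    A.bracket α β x = 0 := by
  obtain ⟨χ, h1, h2⟩ := exists_bump I h
  have hβ : β = (1 - χ) • β := by
    refine ContMDiffSection.ext fun y ↦ ?_
    rw [section_smul_apply, map_sub_apply, map_one_apply]
    by_cases hy : y ∈ tsupport χ
    · rw [show β y = 0 from h2 hy, smul_zero]
    · rw [image_eq_zero_of_notMem_tsupport hy, sub_zero, one_smul]
  rw [hβ, bracket_smul_right, section_add_apply, section_smul_apply, section_smul_apply,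
    h.self_of_nhds, smul_zero, add_zero, map_sub_apply, map_one_apply, h1.self_of_nhds, sub_self,
    zero_smul]

/-- The gradient of a locally constant pairing is zero. Most brackets in the splitting are shown to
vanish this way, from the bracket in the opposite order. -/
theorem bracket_add_bracket_apply_eq_zero {α β : Cₛ^∞⟮I; F, E⟯} {x : M} {c : ℝ}
    (h : ∀ᶠ y in 𝓝 x, A.pair α β y = c) : A.bracket α β x + A.bracket β α x = 0 := by
  refine A.pairing_nondegenerate x _ fun e ↦ ?_
  obtain ⟨ε, rfl⟩ := exists_section_apply_eq I F E x e
  have h1 := congrArg (fun f : C^∞⟮I, M; ℝ⟯ ↦ f x) (A.pair_bracket_add_bracket α β ε)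
  exact h1.trans (A.der_eq_zero_of_eventually_const h ε)

theorem bracket_apply_eq_zero_left {α β : Cₛ^∞⟮I; F, E⟯} {x : M} (h : ∀ᶠ y in 𝓝 x, α y = 0) :
    A.bracket α β x = 0 := by
  have h1 := A.bracket_add_bracket_apply_eq_zero (α := α) (β := β) (x := x) (c := 0) (by
    filter_upwards [h] with y hy
    rw [pair_apply, hy, map_zero, LinearMap.zero_apply])
  rwa [A.bracket_apply_eq_zero_right h, add_zero] at h1

theorem bracket_congr {α α' β β' : Cₛ^∞⟮I; F, E⟯} {x : M} (hα : ∀ᶠ y in 𝓝 x, α y = α' y)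
    (hβ : ∀ᶠ y in 𝓝 x, β y = β' y) : A.bracket α β x = A.bracket α' β' x := by
  have h1 : A.bracket (α - α') β x = 0 := A.bracket_apply_eq_zero_left (by
    filter_upwards [hα] with y hy
    rw [section_sub_apply, hy, sub_self])
  have h2 : A.bracket α' (β - β') x = 0 := A.bracket_apply_eq_zero_right (by
    filter_upwards [hβ] with y hy
    rw [section_sub_apply, hy, sub_self])
  rw [map_sub, LinearMap.sub_apply, section_sub_apply, sub_eq_zero] at h1
  rw [map_sub, section_sub_apply, sub_eq_zero] at h2
  rw [h1, h2]

/-- Where the fibre is nonzero, `der_bracket_smul` can be cancelled with a section `γ` that does not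
vanish at the point. Where the fibre is zero, every anchor is zero. -/
theorem der_bracket (α β : Cₛ^∞⟮I; F, E⟯) (f : C^∞⟮I, M; ℝ⟯) :
    A.der (A.bracket α β) f = A.der α (A.der β f) - A.der β (A.der α f) := by
  refine ContMDiffMap.ext fun x ↦ ?_
  by_cases hx : ∃ e : E x, e ≠ 0
  · obtain ⟨e, he⟩ := hx
    obtain ⟨γ, rfl⟩ := exists_section_apply_eq I F E x e
    have h := congrArg (fun σ : Cₛ^∞⟮I; F, E⟯ ↦ σ x) (A.der_bracket_smul α β γ f)
    exact sub_eq_zero.1 ((smul_eq_zero.1 h).resolve_right he)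
  · push Not at hx
    have h0 (γ : Cₛ^∞⟮I; F, E⟯) (g : C^∞⟮I, M; ℝ⟯) : A.der γ g x = 0 := by
      rw [der_apply, hx (γ x), map_zero, map_zero]
    rw [map_sub_apply, h0, h0, h0, sub_zero]

/-- Near a point where the fibre is nonzero, every function `f` has a gradient `ρ^* df`. -/
theorem exists_gradient {p : M} {e₀ : E p} (he₀ : e₀ ≠ 0) (f : C^∞⟮I, M; ℝ⟯) :
    ∃ δ : Cₛ^∞⟮I; F, E⟯, (∀ᶠ x in 𝓝 p, ∀ ε, A.pair δ ε x = A.der ε f x) ∧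
      (∀ σ, A.bracket δ σ = 0) ∧ ∀ g, A.der δ g = 0 := by
  obtain ⟨e₁, he₁⟩ : ∃ e₁, A.pairing p e₀ e₁ ≠ 0 := by
    by_contra! h
    exact he₀ (A.pairing_nondegenerate p _ h)
  obtain ⟨α, rfl⟩ := exists_section_apply_eq I F E p e₀
  obtain ⟨β, rfl⟩ := exists_section_apply_eq I F E p e₁
  have hne : ∀ᶠ x in 𝓝 p, A.pair α β x ≠ 0 :=
    (A.pair α β).contMDiff.continuous.continuousAt.eventually_ne he₁
  -- Near `p` the function `g` is `f / ⟨α, β⟩`, so `⟨α, gβ⟩ = f` there and the symmetrized bracket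
  -- of `α` and `gβ` is the gradient of `f`.
  obtain ⟨g, hg⟩ := exists_contMDiffMap_eventuallyEq (I := I) (G := ℝ)
    (f := fun x ↦ f x * (A.pair α β x)⁻¹) (isOpen_ne_fun (A.pair α β).contMDiff.continuous
      continuous_const) he₁ (f.contMDiff.contMDiffOn.mul
        ((A.pair α β).contMDiff.contMDiffOn.inv₀ fun x hx ↦ hx))
  have hgf : ∀ᶠ x in 𝓝 p, A.pair α (g • β) x = f x := by
    filter_upwards [hg, hne] with x h1 h2
    rw [pair_smul_right, map_mul_apply, h1, inv_mul_cancel_right₀ h2]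
  -- Jacobi writes `[[α, gβ], σ]` as a commutator that changes sign when `α` and `gβ` are exchanged.
  -- This holds on all of `M`, not just near `p`.
  have hbr (σ) : A.bracket (A.bracket α (g • β) + A.bracket (g • β) α) σ = 0 := by
    rw [map_add, LinearMap.add_apply, ← sub_eq_zero]
    have h1 := A.jacobi α (g • β) σ
    have h2 := A.jacobi (g • β) α σ
    rw [← eq_sub_iff_add_eq] at h1 h2
    rw [h1, h2]
    abel
  refine ⟨A.bracket α (g • β) + A.bracket (g • β) α, ?_, hbr, fun h ↦ ?_⟩
  · filter_upwards [hgf.eventually_nhds] with x hx ε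
    rw [pair_bracket_add_bracket]
    exact A.der_congr hx ε
  · rw [der_add_left, der_bracket, der_bracket]
    abel

end Local

end CourantAlgebroid

end Algebra

/-! ### Local coordinates and functions annihilated by commuting fields. -/

section Coordinates

variable {V : Type*} [NormedAddCommGroup V] [NormedSpace ℝ V] [FiniteDimensional ℝ V]
  {M : Type*} [TopologicalSpace M] [ChartedSpace V M] [T2Space M] [IsManifold 𝓘(ℝ, V) ∞ M]
  {F : Type*} [NormedAddCommGroup F] [NormedSpace ℝ F]
  {E : M → Type*} [TopologicalSpace (TotalSpace F E)]
  [∀ x, AddCommGroup (E x)] [∀ x, Module ℝ (E x)] [∀ x, TopologicalSpace (E x)]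
  [FiberBundle F E] [VectorBundle ℝ F E]

/-- Functions with jointly injective differentials at `p` are coordinates near `p`. -/
theorem exists_chart {ι : Type*} [Fintype ι] (u : ι → C^∞⟮𝓘(ℝ, V), M; ℝ⟯) (p : M)
    (hcard : Fintype.card ι = Module.finrank ℝ V)
    (hinj : ∀ v : TangentSpace 𝓘(ℝ, V) p, (∀ i, mvfderiv 𝓘(ℝ, V) (u i) p v = 0) → v = 0) :
    ∃ e : OpenPartialHomeomorph M (ι → ℝ), p ∈ e.source ∧
      (∀ x ∈ e.source, e x = fun i ↦ u i x) ∧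
      ContMDiffOn 𝓘(ℝ, ι → ℝ) 𝓘(ℝ, V) ∞ e.symm e.target := by
  let c := chartAt V p
  have hc : ContMDiffOn 𝓘(ℝ, V) 𝓘(ℝ, V) ∞ c.symm c.target := contMDiffOn_chart_symm
  let f : V → ι → ℝ := fun v i ↦ u i (c.symm v)
  have hfi (i : ι) : ContDiffOn ℝ ∞ (fun v ↦ u i (c.symm v)) c.target :=
    ((u i).contMDiff.comp_contMDiffOn hc).contDiffOn
  have hf : ContDiffOn ℝ ∞ f c.target := contDiffOn_pi.2 hfi
  have hcp : c p ∈ c.target := mem_chart_target V p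
  have hL := ((hf.contDiffAt (c.open_target.mem_nhds hcp)).differentiableAt (by simp)).hasFDerivAt
  have hLi (i : ι) (v : V) : fderiv ℝ f (c p) v i = mvfderiv 𝓘(ℝ, V) (u i) p v := by
    have h1 := (hasFDerivAt_pi'.1 hL i).fderiv
    have h2 : mfderiv 𝓘(ℝ, V) 𝓘(ℝ, ℝ) (u i) p = fderiv ℝ (fun v ↦ u i (c.symm v)) (c p) := by
      have h3 : fderivWithin ℝ (writtenInExtChartAt 𝓘(ℝ, V) 𝓘(ℝ, ℝ) p (u i)) (range 𝓘(ℝ, V))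
          (extChartAt 𝓘(ℝ, V) p p) = fderiv ℝ (fun v ↦ u i (c.symm v)) (c p) := by
        rw [modelWithCornersSelf_coe, range_id, fderivWithin_univ]
        rfl
      exact (mdiffAt_map (u i) p).mfderiv.trans h3
    calc fderiv ℝ f (c p) v i = fderiv ℝ (fun v ↦ u i (c.symm v)) (c p) v := by
          rw [h1]; rfl
      _ = mvfderiv 𝓘(ℝ, V) (u i) p v := by
          exact (congrArg (fun L : V →L[ℝ] ℝ ↦ L v) h2).symm
  have hLinj : Function.Injective (fderiv ℝ f (c p)) := by
    rw [injective_iff_map_eq_zero]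
    intro v hv
    exact hinj v fun i ↦ by rw [← hLi, hv]; rfl
  let L₀ : V ≃ₗ[ℝ] (ι → ℝ) := LinearEquiv.ofInjectiveOfFinrankEq
    (fderiv ℝ f (c p)).toLinearMap hLinj (by rw [Module.finrank_fintype_fun_eq_card, hcard])
  have hL₀ : HasFDerivAt f (L₀.toContinuousLinearEquiv : V →L[ℝ] (ι → ℝ)) (c p) := by
    have h : (L₀.toContinuousLinearEquiv : V →L[ℝ] (ι → ℝ)) = fderiv ℝ f (c p) :=
      ContinuousLinearMap.ext fun v ↦ rfl
    exact h ▸ hL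
  obtain ⟨e, he1, he2, he3, he4⟩ := exists_openPartialHomeomorph_contDiffOn c.open_target hcp hf hL₀
  refine ⟨c ≫ₕ e, ?_, fun x hx ↦ ?_, ?_⟩
  · rw [OpenPartialHomeomorph.trans_source]
    exact ⟨mem_chart_source V p, he1⟩
  · rw [OpenPartialHomeomorph.trans_source] at hx
    rw [OpenPartialHomeomorph.trans_apply, he3]
    funext i
    change u i (c.symm (c x)) = u i x
    rw [c.left_inv hx.1]
  · have h : (c ≫ₕ e).target ⊆ e.target := by
      rw [OpenPartialHomeomorph.trans_target]
      exact inter_subset_left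
    have h1 := (hc.comp he4.contMDiffOn fun z hz ↦ he2 (e.map_target hz)).mono h
    exact h1

theorem mvfderiv_eq_fderiv {ι : Type*} [Fintype ι] (u : ι → C^∞⟮𝓘(ℝ, V), M; ℝ⟯)
    {h : (ι → ℝ) → ℝ} {f : C^∞⟮𝓘(ℝ, V), M; ℝ⟯} {x : M} (hh : DifferentiableAt ℝ h fun i ↦ u i x)
    (hf : ∀ᶠ y in 𝓝 x, f y = h fun i ↦ u i y) (v : TangentSpace 𝓘(ℝ, V) x) :
    mvfderiv 𝓘(ℝ, V) f x v
      = fderiv ℝ h (fun i ↦ u i x) fun i ↦ mvfderiv 𝓘(ℝ, V) (u i) x v := by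
  have hu : HasMFDerivAt 𝓘(ℝ, V) 𝓘(ℝ, ι → ℝ) (fun y i ↦ u i y) x
      (ContinuousLinearMap.pi fun i ↦ mvfderiv 𝓘(ℝ, V) (u i) x :
        TangentSpace 𝓘(ℝ, V) x →L[ℝ] (ι → ℝ)) := by
    refine ⟨continuousAt_pi.2 fun i ↦ (u i).contMDiff.continuous.continuousAt, ?_⟩
    refine hasFDerivWithinAt_pi'.2 fun i ↦ ?_
    exact (mdiffAt_map (u i) x).hasMFDerivAt.2
  have h1 : HasMFDerivAt 𝓘(ℝ, V) 𝓘(ℝ, ℝ) f x _ :=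
    (HasMFDerivAt.comp x hh.hasFDerivAt.hasMFDerivAt hu).congr_of_eventuallyEq hf
  exact congrArg (fun L : TangentSpace 𝓘(ℝ, V) x →L[ℝ] ℝ ↦ L v) h1.mfderiv

namespace CourantAlgebroid

variable (A : CourantAlgebroid 𝓘(ℝ, V) F E)

theorem der_comp {ι : Type*} [Fintype ι] (u : ι → C^∞⟮𝓘(ℝ, V), M; ℝ⟯) {h : (ι → ℝ) → ℝ}
    {f : C^∞⟮𝓘(ℝ, V), M; ℝ⟯} {x : M} (hh : DifferentiableAt ℝ h fun i ↦ u i x)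
    (hf : ∀ᶠ y in 𝓝 x, f y = h fun i ↦ u i y) (α : Cₛ^∞⟮𝓘(ℝ, V); F, E⟯) :
    A.der α f x = fderiv ℝ h (fun i ↦ u i x) fun i ↦ A.der α (u i) x :=
  mvfderiv_eq_fderiv u hh hf _

variable {κ μ : Type*} [Fintype κ] [Fintype μ]

/-- In the chart `e` the anchor of `α i` is the coordinate field of `t i`. A segment along which the
`y`-coordinates are fixed runs in the span of these fields, so the derivative of `f` along it
vanishes. -/
theorem apply_symm_eq_of_der_eq_zero [DecidableEq κ] [DecidableEq μ] {t : κ → C^∞⟮𝓘(ℝ, V), M; ℝ⟯}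
    {y : μ → C^∞⟮𝓘(ℝ, V), M; ℝ⟯} {α : κ → Cₛ^∞⟮𝓘(ℝ, V); F, E⟯}
    {e : OpenPartialHomeomorph M (κ ⊕ μ → ℝ)}
    (he : ∀ x ∈ e.source, e x = fun i ↦ (Sum.elim t y i : C^∞⟮𝓘(ℝ, V), M; ℝ⟯) x)
    (hes : ContMDiffOn 𝓘(ℝ, κ ⊕ μ → ℝ) 𝓘(ℝ, V) ∞ e.symm e.target)
    {f : C^∞⟮𝓘(ℝ, V), M; ℝ⟯} {s : Set (κ ⊕ μ → ℝ)} (hs : s ⊆ e.target)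
    (ht : ∀ z ∈ s, ∀ i j, A.der (α i) (t j) (e.symm z) = if i = j then 1 else 0)
    (hy : ∀ z ∈ s, ∀ i j, A.der (α i) (y j) (e.symm z) = 0)
    (hf : ∀ z ∈ s, ∀ i, A.der (α i) f (e.symm z) = 0)
    {z z' : κ ⊕ μ → ℝ} (hz : segment ℝ z z' ⊆ s) (hzz' : ∀ j, z (Sum.inr j) = z' (Sum.inr j)) :
    f (e.symm z) = f (e.symm z') := by
  have hd (w) (hw : w ∈ e.target) : DifferentiableAt ℝ (fun w ↦ f (e.symm w)) w :=
    ((f.contMDiff.comp_contMDiffOn hes).contDiffOn.contDiffAt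
      (e.open_target.mem_nhds hw)).differentiableAt (by simp)
  have key (w) (hw : w ∈ s) : fderiv ℝ (fun w ↦ f (e.symm w)) w (z' - z) = 0 := by
    have hsrc := e.map_target (hs hw)
    have hew : (fun i ↦ (Sum.elim t y i : C^∞⟮𝓘(ℝ, V), M; ℝ⟯) (e.symm w)) = w := by
      rw [← he _ hsrc, e.right_inv (hs hw)]
    have h1 (i : κ) : fderiv ℝ (fun w ↦ f (e.symm w)) w (Pi.single (Sum.inl i) 1) = 0 := by
      have h2 := A.der_comp (Sum.elim t y) (h := fun w ↦ f (e.symm w)) (f := f) (x := e.symm w)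
        (by rw [hew]; exact hd w (hs hw)) (by
          filter_upwards [e.open_source.mem_nhds hsrc] with x hx
          rw [← he x hx, e.left_inv hx]) (α i)
      rw [hf w hw, hew] at h2
      rw [h2]
      congr 1
      funext j
      rcases j with j | j
      · rw [Sum.elim_inl, ht w hw, Pi.single_apply]
        simp only [Sum.inl.injEq, eq_comm]
      · rw [Sum.elim_inr, hy w hw, Pi.single_apply, if_neg (by simp)]
    have h3 : z' - z = ∑ i : κ, (z' - z) (Sum.inl i) • Pi.single (Sum.inl i) (1 : ℝ) := by
      funext j
      rw [Finset.sum_apply]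
      rcases j with j | j
      · simp [Pi.single_apply]
      · simp [hzz']
    rw [h3, map_sum]
    exact Finset.sum_eq_zero fun i _ ↦ by rw [map_smul, h1, smul_zero]
  have hseg (a : ℝ) (ha : a ∈ Icc (0 : ℝ) 1) : z + a • (z' - z) ∈ s :=
    hz (by rw [segment_eq_image']; exact ⟨a, ha, rfl⟩)
  have hD (a : ℝ) (ha : a ∈ Icc (0 : ℝ) 1) :
      HasDerivAt (fun a : ℝ ↦ f (e.symm (z + a • (z' - z)))) 0 a := by
    have h4 : HasDerivAt (fun a : ℝ ↦ z + a • (z' - z)) (z' - z) a := by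
      simpa using ((hasDerivAt_id a).smul_const (z' - z)).const_add z
    have h5 := (hd _ (hs (hseg a ha))).hasFDerivAt.comp_hasDerivAt a h4
    rwa [key _ (hseg a ha)] at h5
  have h6 := constant_of_has_deriv_right_zero
    (fun a ha ↦ (hD a ha).continuousAt.continuousWithinAt)
    (fun a ha ↦ (hD a (Ico_subset_Icc_self ha)).hasDerivWithinAt) 1 (right_mem_Icc.2 zero_le_one)
  simpa using h6.symm

/-- In a coordinate ball, which is convex, a point can be moved into the slice `t = t p` along a
segment with `y` fixed, and `f` does not change. So `g` is the restriction of `f` to the slice, cut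
off to a globally smooth function. -/
theorem exists_eq_comp_of_der_eq_zero [DecidableEq κ] [DecidableEq μ] {p : M} {t : κ → C^∞⟮𝓘(ℝ, V), M; ℝ⟯}
    {y : μ → C^∞⟮𝓘(ℝ, V), M; ℝ⟯} {α : κ → Cₛ^∞⟮𝓘(ℝ, V); F, E⟯}
    (hcard : Fintype.card κ + Fintype.card μ = Module.finrank ℝ V)
    (hinj : ∀ v : TangentSpace 𝓘(ℝ, V) p, (∀ i, mvfderiv 𝓘(ℝ, V) (t i) p v = 0) →
      (∀ i, mvfderiv 𝓘(ℝ, V) (y i) p v = 0) → v = 0)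
    (ht : ∀ᶠ x in 𝓝 p, ∀ i j, A.der (α i) (t j) x = if i = j then 1 else 0)
    (hy : ∀ᶠ x in 𝓝 p, ∀ i j, A.der (α i) (y j) x = 0)
    {f : C^∞⟮𝓘(ℝ, V), M; ℝ⟯} (hf : ∀ᶠ x in 𝓝 p, ∀ i, A.der (α i) f x = 0) :
    ∃ g : (μ → ℝ) → ℝ, ContDiff ℝ ∞ g ∧ ∀ᶠ x in 𝓝 p, f x = g fun j ↦ y j x := by
  obtain ⟨e, hp, he, hes⟩ := exists_chart (Sum.elim t y) p (by simpa using hcard)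
    fun v hv ↦ hinj v (fun i ↦ hv (Sum.inl i)) fun i ↦ hv (Sum.inr i)
  have htar : e.target ∈ 𝓝 (e p) := e.open_target.mem_nhds (e.map_source hp)
  have hgood : {z | z ∈ e.target ∧ (∀ i j, A.der (α i) (t j) (e.symm z) = if i = j then 1 else 0) ∧
      (∀ i j, A.der (α i) (y j) (e.symm z) = 0) ∧ ∀ i, A.der (α i) f (e.symm z) = 0}
      ∈ 𝓝 (e p) := by
    have hcont : Tendsto e.symm (𝓝 (e p)) (𝓝 p) := by
      simpa [e.left_inv hp] using (e.continuousAt_symm (e.map_source hp)).tendsto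
    filter_upwards [htar, hcont.eventually ht, hcont.eventually hy, hcont.eventually hf]
      with z h1 h2 h3 h4 using ⟨h1, h2, h3, h4⟩
  obtain ⟨ε, hε, hball⟩ := Metric.mem_nhds_iff.1 hgood
  let z₀ : κ → ℝ := fun i ↦ t i p
  have hez (x) (hx : x ∈ e.source) : e x = Sum.elim (fun i ↦ t i x) fun j ↦ y j x := by
    rw [he x hx]
    funext j
    rcases j with j | j <;> rfl
  let ins : (μ → ℝ) → κ ⊕ μ → ℝ := fun b ↦ Sum.elim z₀ b
  have hins : ContDiff ℝ ∞ ins := by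
    refine contDiff_pi.2 fun j ↦ ?_
    rcases j with j | j
    · exact contDiff_const
    · exact contDiff_apply ℝ ℝ j
  have hsmooth : ContDiffOn ℝ ∞ (fun b ↦ f (e.symm (ins b))) (ins ⁻¹' Metric.ball (e p) ε) :=
    (f.contMDiff.comp_contMDiffOn hes).contDiffOn.comp hins.contDiffOn
      fun b hb ↦ (hball hb).1
  have hmem : (fun j ↦ y j p) ∈ ins ⁻¹' Metric.ball (e p) ε := by
    rw [mem_preimage, show ins (fun j ↦ y j p) = e p from (hez p hp).symm]
    exact Metric.mem_ball_self hε
  obtain ⟨g, hg1, hg2⟩ := exists_contDiff_eventuallyEq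
    (Metric.isOpen_ball.preimage hins.continuous) hsmooth hmem
  refine ⟨g, hg1, ?_⟩
  have hyc : Continuous fun x j ↦ y j x :=
    continuous_pi fun j ↦ (y j).contMDiff.continuous
  filter_upwards [e.open_source.mem_nhds hp, hyc.continuousAt.eventually hg2,
    hyc.continuousAt.eventually
      ((Metric.isOpen_ball.preimage hins.continuous).mem_nhds hmem),
    (e.continuousAt hp).eventually (Metric.ball_mem_nhds (e p) hε)] with x h1 h2 h3 h4
  rw [h2]
  have h5 := A.apply_symm_eq_of_der_eq_zero he hes (f := f) (s := Metric.ball (e p) ε)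
    (z := e x) (z' := ins fun j ↦ y j x)
    (fun z hz ↦ (hball hz).1) (fun z hz ↦ (hball hz).2.1) (fun z hz ↦ (hball hz).2.2.1)
    (fun z hz ↦ (hball hz).2.2.2) ((convex_ball _ _).segment_subset h4 h3)
    (fun j ↦ by rw [hez x h1]; rfl)
  rw [← h5, e.left_inv h1]

end CourantAlgebroid

end Coordinates

/-! ### Gram matrices and local frames. -/

section Frames

variable {V : Type*} [NormedAddCommGroup V] [NormedSpace ℝ V] [FiniteDimensional ℝ V]
  {M : Type*} [TopologicalSpace M] [ChartedSpace V M] [T2Space M] [IsManifold 𝓘(ℝ, V) ∞ M]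
  {F : Type*} [NormedAddCommGroup F] [NormedSpace ℝ F] [FiniteDimensional ℝ F]
  {E : M → Type*} [TopologicalSpace (TotalSpace F E)]
  [∀ x, AddCommGroup (E x)] [∀ x, Module ℝ (E x)] [∀ x, TopologicalSpace (E x)]
  [FiberBundle F E] [VectorBundle ℝ F E]

variable (F E) in
theorem finrank_fiber (x : M) : Module.finrank ℝ (E x) = Module.finrank ℝ F :=
  (((trivializationAt F E x).continuousLinearEquivAt ℝ x
    (mem_baseSet_trivializationAt F E x)).toLinearEquiv).finrank_eq

theorem finiteDimensional_fiber {M : Type*} [TopologicalSpace M] (F : Type*)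
    [NormedAddCommGroup F] [NormedSpace ℝ F] [FiniteDimensional ℝ F]
    (E : M → Type*) [TopologicalSpace (TotalSpace F E)]
    [∀ x, AddCommGroup (E x)] [∀ x, Module ℝ (E x)] [∀ x, TopologicalSpace (E x)]
    [FiberBundle F E] [VectorBundle ℝ F E] (x : M) : FiniteDimensional ℝ (E x) :=
  (((trivializationAt F E x).continuousLinearEquivAt ℝ x
    (mem_baseSet_trivializationAt F E x)).toLinearEquiv).symm.finiteDimensional

namespace CourantAlgebroid

variable (A : CourantAlgebroid 𝓘(ℝ, V) F E) {ι : Type*} [Fintype ι] [DecidableEq ι]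

/-- The Gram matrix of a family of sections. -/
def gram (s : ι → Cₛ^∞⟮𝓘(ℝ, V); F, E⟯) : Matrix ι ι C^∞⟮𝓘(ℝ, V), M; ℝ⟯ :=
  fun a b ↦ A.pair (s a) (s b)

theorem det_gram_apply (s : ι → Cₛ^∞⟮𝓘(ℝ, V); F, E⟯) (x : M) :
    (A.gram s).det x = Matrix.det fun a b ↦ A.pair (s a) (s b) x := by
  have h := RingHom.map_det (ContMDiffMap.evalRingHom (I := 𝓘(ℝ, V)) (n := ∞) (I' := 𝓘(ℝ, ℝ))
    (R := ℝ) x) (A.gram s)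
  exact h

variable {A} in
theorem linearIndependent_of_det_gram_ne_zero {s : ι → Cₛ^∞⟮𝓘(ℝ, V); F, E⟯} {x : M}
    (h : (A.gram s).det x ≠ 0) : LinearIndependent ℝ fun i ↦ s i x := by
  rw [det_gram_apply] at h
  rw [Fintype.linearIndependent_iff]
  intro g hg
  have h1 : Matrix.mulVec (fun a b ↦ A.pair (s a) (s b) x) g = 0 := by
    funext a
    have h2 : A.pairing x (s a x) (∑ i, g i • s i x) = 0 := by rw [hg, map_zero]
    rw [map_sum] at h2
    simp only [map_smul, smul_eq_mul] at h2
    rw [Pi.zero_apply, ← h2]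
    exact Finset.sum_congr rfl fun i _ ↦ mul_comm _ _
  by_contra! hne
  refine h (Matrix.exists_mulVec_eq_zero_iff.1 ⟨g, fun h0 ↦ ?_, h1⟩)
  obtain ⟨i, hi⟩ := hne
  exact hi (congrFun h0 i)

-- A kernel vector of the Gram matrix gives a combination orthogonal to a spanning family, which is
-- zero by nondegeneracy of the pairing. Nonvanishing of the Gram determinant thus makes being a
-- frame an open condition.
variable {A} in
theorem det_gram_ne_zero {s : ι → Cₛ^∞⟮𝓘(ℝ, V); F, E⟯} {x : M}
    (hcard : Fintype.card ι = Module.finrank ℝ F)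
    (h : LinearIndependent ℝ fun i ↦ s i x) : (A.gram s).det x ≠ 0 := by
  rw [det_gram_apply]
  intro h0
  obtain ⟨v, hv, hv0⟩ := Matrix.exists_mulVec_eq_zero_iff.2 h0
  have := finiteDimensional_fiber F E x
  have hspan := h.span_eq_top_of_card_eq_finrank' (by rw [hcard, finrank_fiber F E x])
  have h1 : ∑ i, v i • s i x = 0 := by
    refine A.pairing_nondegenerate x _ fun w ↦ ?_
    rw [A.pairing_symm]
    have hw : w ∈ Submodule.span ℝ (range fun i ↦ s i x) := by rw [hspan]; trivial
    induction hw using Submodule.span_induction with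
    | mem w hw =>
      obtain ⟨a, rfl⟩ := hw
      rw [map_sum]
      refine Eq.trans ?_ (congrFun hv0 a)
      exact Finset.sum_congr rfl fun i _ ↦ by rw [map_smul, smul_eq_mul, mul_comm]; rfl
    | zero => rw [map_zero, LinearMap.zero_apply]
    | add a b _ _ ha hb => rw [map_add, LinearMap.add_apply, ha, hb, add_zero]
    | smul c a _ ha => rw [map_smul, LinearMap.smul_apply, ha, smul_zero]
  exact hv (funext fun i ↦ Fintype.linearIndependent_iff.1 h v h1 i)

theorem eventually_linearIndependent (A : CourantAlgebroid 𝓘(ℝ, V) F E) {s : ι → Cₛ^∞⟮𝓘(ℝ, V); F, E⟯} {p : M}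
    (hcard : Fintype.card ι = Module.finrank ℝ F) (h : LinearIndependent ℝ fun i ↦ s i p) :
    ∀ᶠ x in 𝓝 p, LinearIndependent ℝ fun i ↦ s i x := by
  filter_upwards [(A.gram s).det.contMDiff.continuous.continuousAt.eventually_ne
    (det_gram_ne_zero (A := A) hcard h)] with x hx using
    linearIndependent_of_det_gram_ne_zero hx

/-- Cramer's rule for the Gram matrix: near `p` the coefficients are its adjugate applied to the
functions `⟨s b, σ⟩`, divided by the determinant. -/
theorem exists_coeff (A : CourantAlgebroid 𝓘(ℝ, V) F E) {s : ι → Cₛ^∞⟮𝓘(ℝ, V); F, E⟯} {p : M}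
    (hcard : Fintype.card ι = Module.finrank ℝ F) (h : LinearIndependent ℝ fun i ↦ s i p)
    (σ : Cₛ^∞⟮𝓘(ℝ, V); F, E⟯) :
    ∃ c : ι → C^∞⟮𝓘(ℝ, V), M; ℝ⟯, ∀ᶠ x in 𝓝 p, σ x = ∑ i, c i x • s i x := by
  let d := (A.gram s).det
  have hd : d p ≠ 0 := det_gram_ne_zero hcard h
  obtain ⟨g, hg⟩ := exists_contMDiffMap_eventuallyEq (I := 𝓘(ℝ, V)) (G := ℝ)
    (f := fun x ↦ (d x)⁻¹) (isOpen_ne_fun d.contMDiff.continuous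
      continuous_const) hd (d.contMDiff.contMDiffOn.inv₀ fun x hx ↦ hx)
  let c (a : ι) : C^∞⟮𝓘(ℝ, V), M; ℝ⟯ := g * ((A.gram s).adjugate.mulVec fun b ↦ A.pair (s b) σ) a
  refine ⟨c, ?_⟩
  have hc (b : ι) : A.pair (s b) (∑ i, c i • s i) = g * d * A.pair (s b) σ := by
    have h1 : (A.gram s).mulVec ((A.gram s).adjugate.mulVec fun b ↦ A.pair (s b) σ)
        = d • fun b ↦ A.pair (s b) σ := by
      rw [Matrix.mulVec_mulVec, Matrix.mul_adjugate, Matrix.smul_mulVec, Matrix.one_mulVec]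
    have h2 := congrFun h1 b
    rw [Pi.smul_apply, smul_eq_mul] at h2
    rw [pair_sum_right, mul_assoc, ← h2, Matrix.mulVec, dotProduct, Finset.mul_sum]
    refine Finset.sum_congr rfl fun i _ ↦ ?_
    rw [pair_smul_right]
    simp only [c, gram]
    ring
  filter_upwards [hg, d.contMDiff.continuous.continuousAt.eventually_ne hd,
    A.eventually_linearIndependent hcard h] with x h1 h2 h3
  have h4 : σ x = (∑ i, c i • s i) x := by
    have := finiteDimensional_fiber F E x
    have hspan := h3.span_eq_top_of_card_eq_finrank' (by rw [hcard, finrank_fiber F E x])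
    refine sub_eq_zero.1 (A.pairing_nondegenerate x _ fun w ↦ ?_)
    rw [A.pairing_symm]
    have hw : w ∈ Submodule.span ℝ (range fun i ↦ s i x) := by rw [hspan]; trivial
    induction hw using Submodule.span_induction with
    | mem w hw =>
      obtain ⟨b, rfl⟩ := hw
      have h5 := congrArg (fun f : C^∞⟮𝓘(ℝ, V), M; ℝ⟯ ↦ f x) (hc b)
      simp only [map_mul_apply, h1, inv_mul_cancel₀ h2, one_mul] at h5
      rw [map_sub]
      exact sub_eq_zero.2 h5.symm
    | zero => rw [map_zero, LinearMap.zero_apply]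
    | add a b _ _ ha hb => rw [map_add, LinearMap.add_apply, ha, hb, add_zero]
    | smul c a _ ha => rw [map_smul, LinearMap.smul_apply, ha, smul_zero]
  rw [h4, section_sum_apply]
  rfl

end CourantAlgebroid

end Frames

/-! ### The inductive data of the splitting and their first consequences. -/

section Splitting

variable {V : Type*} [NormedAddCommGroup V] [NormedSpace ℝ V] [FiniteDimensional ℝ V]
  {M : Type*} [TopologicalSpace M] [ChartedSpace V M] [T2Space M] [IsManifold 𝓘(ℝ, V) ∞ M]
  {F : Type*} [NormedAddCommGroup F] [NormedSpace ℝ F]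
  {E : M → Type*} [TopologicalSpace (TotalSpace F E)]
  [∀ x, AddCommGroup (E x)] [∀ x, Module ℝ (E x)] [∀ x, TopologicalSpace (E x)]
  [FiberBundle F E] [VectorBundle ℝ F E]

/-- The smooth function `x ↦ h (y₁ x, …, y_m x)`. -/
def compMap {μ : Type*} [Fintype μ] (h : (μ → ℝ) → ℝ) (hh : ContDiff ℝ ∞ h)
    (y : μ → C^∞⟮𝓘(ℝ, V), M; ℝ⟯) : C^∞⟮𝓘(ℝ, V), M; ℝ⟯ :=
  ⟨fun x ↦ h fun j ↦ y j x, hh.contMDiff.comp (contMDiff_pi_space.2 fun j ↦ (y j).contMDiff)⟩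

theorem compMap_apply {μ : Type*} [Fintype μ] (h : (μ → ℝ) → ℝ) (hh : ContDiff ℝ ∞ h)
    (y : μ → C^∞⟮𝓘(ℝ, V), M; ℝ⟯) (x : M) : compMap h hh y x = h fun j ↦ y j x := rfl

theorem tendsto_pi_map {μ : Type*} (y : μ → C^∞⟮𝓘(ℝ, V), M; ℝ⟯) (p : M) :
    Tendsto (fun x j ↦ y j x) (𝓝 p) (𝓝 fun j ↦ y j p) :=
  (continuous_pi fun j ↦ (y j).contMDiff.continuous).continuousAt

namespace CourantAlgebroid

theorem der_compMap (A : CourantAlgebroid 𝓘(ℝ, V) F E) {μ : Type*} [Fintype μ] (h : (μ → ℝ) → ℝ)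
    (hh : ContDiff ℝ ∞ h) (y : μ → C^∞⟮𝓘(ℝ, V), M; ℝ⟯) (α : Cₛ^∞⟮𝓘(ℝ, V); F, E⟯) (x : M) :
    A.der α (compMap h hh y) x = fderiv ℝ h (fun j ↦ y j x) fun j ↦ A.der α (y j) x :=
  A.der_comp y (hh.contDiffAt.differentiableAt (by simp)) (Eventually.of_forall fun _ ↦ rfl) α

/-- Sections `α i` and `β i = ρ^* d(t i)` and coordinates `t, y` near `p` which exhibit the
Courant algebroid, near `p`, as the product of a standard one of rank `2k` with a transverse one:
every vector of `E p` extends to a section invariant under all `α i`. -/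
structure Splitting (A : CourantAlgebroid 𝓘(ℝ, V) F E) (p : M) (k m : ℕ) where
  α : Fin k → Cₛ^∞⟮𝓘(ℝ, V); F, E⟯
  β : Fin k → Cₛ^∞⟮𝓘(ℝ, V); F, E⟯
  t : Fin k → C^∞⟮𝓘(ℝ, V), M; ℝ⟯
  y : Fin m → C^∞⟮𝓘(ℝ, V), M; ℝ⟯
  card : k + m = Module.finrank ℝ V
  der_t : ∀ᶠ x in 𝓝 p, ∀ i j, A.der (α i) (t j) x = if i = j then 1 else 0
  der_y : ∀ᶠ x in 𝓝 p, ∀ i j, A.der (α i) (y j) x = 0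
  pair_α : ∀ᶠ x in 𝓝 p, ∀ i j, A.pair (α i) (α j) x = 0
  bracket_α : ∀ᶠ x in 𝓝 p, ∀ i j, A.bracket (α i) (α j) x = 0
  pair_β : ∀ᶠ x in 𝓝 p, ∀ i ε, A.pair (β i) ε x = A.der ε (t i) x
  bracket_β : ∀ i σ, A.bracket (β i) σ = 0
  der_β : ∀ i g, A.der (β i) g = 0
  inj : ∀ v : TangentSpace 𝓘(ℝ, V) p, (∀ i, mvfderiv 𝓘(ℝ, V) (t i) p v = 0) →
    (∀ i, mvfderiv 𝓘(ℝ, V) (y i) p v = 0) → v = 0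
  exists_invariant : ∀ v : E p, ∃ γ : Cₛ^∞⟮𝓘(ℝ, V); F, E⟯, γ p = v ∧
    ∀ᶠ x in 𝓝 p, ∀ i, A.bracket (α i) γ x = 0

theorem nonempty_splitting_zero [ContMDiffVectorBundle ∞ F E 𝓘(ℝ, V)]
    (A : CourantAlgebroid 𝓘(ℝ, V) F E) (p : M) :
    Nonempty (A.Splitting p 0 (Module.finrank ℝ V)) := by
  obtain ⟨y, hy⟩ := exists_coordinates 𝓘(ℝ, V) p
  exact ⟨{
    α := Fin.elim0
    β := Fin.elim0
    t := Fin.elim0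
    y := y
    card := zero_add _
    der_t := Eventually.of_forall fun _ i ↦ i.elim0
    der_y := Eventually.of_forall fun _ i ↦ i.elim0
    pair_α := Eventually.of_forall fun _ i ↦ i.elim0
    bracket_α := Eventually.of_forall fun _ i ↦ i.elim0
    pair_β := Eventually.of_forall fun _ i ↦ i.elim0
    bracket_β := fun i ↦ i.elim0
    der_β := fun i ↦ i.elim0
    inj := fun v _ hv ↦ hy v hv
    exists_invariant := fun v ↦
      let ⟨γ, hγ⟩ := exists_section_apply_eq 𝓘(ℝ, V) F E p v
      ⟨γ, hγ, Eventually.of_forall fun _ i ↦ i.elim0⟩ }⟩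

namespace Splitting

variable [ContMDiffVectorBundle ∞ F E 𝓘(ℝ, V)] {A : CourantAlgebroid 𝓘(ℝ, V) F E} {p : M}
  {k m : ℕ} (S : A.Splitting p k m)

theorem pair_α_β : ∀ᶠ x in 𝓝 p, ∀ i j, A.pair (S.α i) (S.β j) x = if i = j then 1 else 0 := by
  filter_upwards [S.pair_β, S.der_t] with x h1 h2 i j
  rw [A.pair_comm, h1, h2]

theorem pair_β_β : ∀ᶠ x in 𝓝 p, ∀ i j, A.pair (S.β i) (S.β j) x = 0 := by
  filter_upwards [S.pair_β] with x h1 i j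
  rw [h1, S.der_β, map_zero_apply]

/-- The pairings `⟨α i, β j⟩` are constant near `p` and gradients have zero left bracket, so
symmetrization settles the other order. -/
theorem bracket_α_β : ∀ᶠ x in 𝓝 p, ∀ i j, A.bracket (S.α i) (S.β j) x = 0 := by
  filter_upwards [S.pair_α_β.eventually_nhds] with x hx i j
  have h := A.bracket_add_bracket_apply_eq_zero (hx.mono fun z hz ↦ hz i j)
  rwa [S.bracket_β, section_zero_apply, add_zero] at h

/-- The component of a section orthogonal to all `α i` and `β i`. -/
def ortho (γ : Cₛ^∞⟮𝓘(ℝ, V); F, E⟯) : Cₛ^∞⟮𝓘(ℝ, V); F, E⟯ :=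
  γ - ∑ i, (A.pair γ (S.β i) • S.α i + A.pair γ (S.α i) • S.β i)

theorem pair_ortho (γ : Cₛ^∞⟮𝓘(ℝ, V); F, E⟯) :
    ∀ᶠ x in 𝓝 p, ∀ i, A.pair (S.ortho γ) (S.α i) x = 0 ∧ A.pair (S.ortho γ) (S.β i) x = 0 := by
  filter_upwards [S.pair_α, S.pair_β_β, S.pair_α_β] with x h1 h2 h3 i
  simp only [ortho, pair_sub_left, pair_sum_left, pair_add_left, pair_smul_left, map_sub_apply,
    map_sum_apply, map_add_apply, map_mul_apply, h1, h2, h3, A.pair_comm (S.β _) (S.α _)]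
  simp

/-- The coefficients `⟨γ, β j⟩` and `⟨γ, α j⟩` are killed by `ρ(α i)`, since all sections involved
commute with `α i`. So the subtracted terms commute with `α i` as well. -/
theorem bracket_ortho {γ : Cₛ^∞⟮𝓘(ℝ, V); F, E⟯}
    (hγ : ∀ᶠ x in 𝓝 p, ∀ i, A.bracket (S.α i) γ x = 0) :
    ∀ᶠ x in 𝓝 p, ∀ i, A.bracket (S.α i) (S.ortho γ) x = 0 := by
  filter_upwards [hγ, S.bracket_α, S.bracket_α_β] with x h1 h2 h3 i
  have h4 (j) : A.der (S.α i) (A.pair γ (S.α j)) x = 0 := by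
    rw [A.der_pair, map_add_apply, pair_apply, pair_apply, h1, h2, map_zero, map_zero,
      LinearMap.zero_apply, add_zero]
  have h5 (j) : A.der (S.α i) (A.pair γ (S.β j)) x = 0 := by
    rw [A.der_pair, map_add_apply, pair_apply, pair_apply, h1, h3, map_zero, map_zero,
      LinearMap.zero_apply, add_zero]
  simp only [ortho, map_sub, map_sum, map_add, bracket_smul_right, section_sub_apply,
    section_sum_apply, section_add_apply, section_smul_apply, h1, h2, h3, h4, h5, smul_zero,
    zero_smul, add_zero, Finset.sum_const_zero, sub_zero]

/-- A function invariant under all `α i` is a function of the coordinates `y`. -/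
theorem exists_eq_compMap {f : C^∞⟮𝓘(ℝ, V), M; ℝ⟯} (hf : ∀ᶠ x in 𝓝 p, ∀ i, A.der (S.α i) f x = 0) :
    ∃ (g : (Fin m → ℝ) → ℝ) (hg : ContDiff ℝ ∞ g), ∀ᶠ x in 𝓝 p, f x = compMap g hg S.y x := by
  obtain ⟨g, hg, h⟩ := A.exists_eq_comp_of_der_eq_zero (by simpa using S.card) S.inj S.der_t
    S.der_y hf
  exact ⟨g, hg, h⟩

theorem der_compMap_α {g : (Fin m → ℝ) → ℝ} (hg : ContDiff ℝ ∞ g) :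
    ∀ᶠ x in 𝓝 p, ∀ i, A.der (S.α i) (compMap g hg S.y) x = 0 := by
  filter_upwards [S.der_y] with x hx i
  rw [A.der_compMap]
  have h : (fun j ↦ A.der (S.α i) (S.y j) x) = 0 := funext fun j ↦ hx i j
  rw [h, map_zero]

end Splitting

end CourantAlgebroid

end Splitting

/-! ### Straightening a vector field and parallel transport along it. -/

section Calculus

variable {Y : Type*} [NormedAddCommGroup Y] [NormedSpace ℝ Y] [FiniteDimensional ℝ Y]

/-- A nonvanishing vector field is `∂/∂s` in suitable coordinates `s, z`. -/
theorem exists_straightening {η : Y → Y} (hη : ContDiff ℝ ∞ η) {y₀ : Y} (hy₀ : η y₀ ≠ 0) :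
    ∃ (m : ℕ) (s : Y → ℝ) (z : Fin m → Y → ℝ), m + 1 = Module.finrank ℝ Y ∧ ContDiff ℝ ∞ s ∧
      (∀ l, ContDiff ℝ ∞ (z l)) ∧
      (∀ᶠ b in 𝓝 y₀, fderiv ℝ s b (η b) = 1 ∧ ∀ l, fderiv ℝ (z l) b (η b) = 0) ∧
      ∀ w, fderiv ℝ s y₀ w = 0 → (∀ l, fderiv ℝ (z l) y₀ w = 0) → w = 0 := by
  obtain ⟨K, e, -, hK, he, he1, he2, he3, -⟩ :=
    exists_flowBox (R := ℝ) η hη (fun _ ↦ 0) contDiff_const y₀ hy₀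
  let b := Module.finBasis ℝ K
  let l (i : Fin (Module.finrank ℝ K)) : K →L[ℝ] ℝ := LinearMap.toContinuousLinearMap (b.coord i)
  have hed (x) (hx : x ∈ e.source) : DifferentiableAt ℝ e x :=
    (he1.contDiffAt (e.open_source.mem_nhds hx)).differentiableAt (by simp)
  obtain ⟨s, hs, hs'⟩ := exists_contDiff_eventuallyEq e.open_source he1.fst he
  have hz (i) := exists_contDiff_eventuallyEq e.open_source
    ((l i).contDiff.comp_contDiffOn he1.snd) he
  choose z hz hz' using hz
  have hds : ∀ᶠ x in 𝓝 y₀, ∀ w, fderiv ℝ s x w = (fderiv ℝ e x w).1 := by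
    filter_upwards [hs'.eventually_nhds, e.open_source.mem_nhds he] with x hx hxs w
    rw [Filter.EventuallyEq.fderiv_eq hx, (hed x hxs).hasFDerivAt.fst.fderiv]
    rfl
  have hdz : ∀ᶠ x in 𝓝 y₀, ∀ i w, fderiv ℝ (z i) x w = l i (fderiv ℝ e x w).2 := by
    filter_upwards [(eventually_all.2 hz').eventually_nhds, e.open_source.mem_nhds he]
      with x hx hxs i w
    have h1 : z i =ᶠ[𝓝 x] l i ∘ fun x ↦ (e x).2 := hx.mono fun a ha ↦ ha i
    rw [h1.fderiv_eq, ((l i).hasFDerivAt.comp x (hed x hxs).hasFDerivAt.snd).fderiv]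
    rfl
  refine ⟨Module.finrank ℝ K, s, z, hK, hs, hz, ?_, fun w h1 h2 ↦ ?_⟩
  · filter_upwards [hds, hdz, e.open_source.mem_nhds he] with x h1 h2 h3
    refine ⟨by rw [h1, he3 x h3], fun i ↦ by rw [h2, he3 x h3, map_zero]⟩
  · have h3 : fderiv ℝ e y₀ w = 0 := by
      refine Prod.ext ?_ (b.forall_coord_eq_zero_iff.1 fun i ↦ ?_)
      · rw [← hds.self_of_nhds, h1]; rfl
      · exact (hdz.self_of_nhds i w).symm.trans (h2 i)
    have h4 : HasFDerivAt (e.symm ∘ e) _ y₀ := HasFDerivAt.comp y₀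
      ((he2.contDiffAt (e.open_target.mem_nhds (e.map_source he))).differentiableAt
        (by simp)).hasFDerivAt (hed y₀ he).hasFDerivAt
    have h5 : e.symm ∘ e =ᶠ[𝓝 y₀] id := by
      filter_upwards [e.open_source.mem_nhds he] with x hx using e.left_inv hx
    have h6 := (h4.congr_of_eventuallyEq h5.symm).unique (hasFDerivAt_id y₀)
    have h7 := congrArg (fun L : Y →L[ℝ] Y ↦ L w) h6
    simp only [ContinuousLinearMap.comp_apply, h3, map_zero, ContinuousLinearMap.id_apply] at h7
    exact h7.symm

/-- Linear differential equations along a nonvanishing vector field are solvable. -/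
theorem exists_parallel {ι : Type*} [Fintype ι] {η : Y → Y} (hη : ContDiff ℝ ∞ η) {y₀ : Y}
    (hy₀ : η y₀ ≠ 0) {Γ : ι → ι → Y → ℝ} (hΓ : ∀ a b, ContDiff ℝ ∞ (Γ a b)) (c : ι → ℝ) :
    ∃ h : ι → Y → ℝ, (∀ b, ContDiff ℝ ∞ (h b)) ∧ (∀ b, h b y₀ = c b) ∧
      ∀ᶠ y in 𝓝 y₀, ∀ b, fderiv ℝ (h b) y (η y) = - ∑ a, h a y * Γ a b y := by
  classical
  -- The transpose of the matrix `Γ`: its `b`-th component on `v` is the sum of `v a * Γ a b`, as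
  -- the required equation has it.
  let G : Y → (ι → ℝ) →L[ℝ] (ι → ℝ) := fun y ↦
    ∑ a, ∑ b, Γ a b y • (ContinuousLinearMap.proj (R := ℝ) (φ := fun _ : ι ↦ ℝ) a).smulRight
      (Pi.single b (1 : ℝ) : ι → ℝ)
  have hG : ContDiff ℝ ∞ G := ContDiff.sum fun a _ ↦ ContDiff.sum fun b _ ↦
    (hΓ a b).smul contDiff_const
  have hGapp (y) (v : ι → ℝ) (b : ι) : G y v b = ∑ a, v a * Γ a b y := by
    simp [G, Pi.single_apply, mul_comm]
  obtain ⟨K, e, g, -, he, -, -, -, hg1, hg2, hg3⟩ := exists_flowBox η hη G hG y₀ hy₀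
  have hgd (x) (hx : x ∈ e.source) : DifferentiableAt ℝ g x :=
    (hg1.contDiffAt (e.open_source.mem_nhds hx)).differentiableAt (by simp)
  -- The solution with value `c` at `y₀` is the fundamental solution `g`, which is `1` at `y₀`,
  -- applied to `c`.
  let L (b : ι) : ((ι → ℝ) →L[ℝ] (ι → ℝ)) →L[ℝ] ℝ :=
    (ContinuousLinearMap.proj b).comp (ContinuousLinearMap.apply ℝ (ι → ℝ) c)
  have hh (b) := exists_contDiff_eventuallyEq e.open_source ((L b).contDiff.comp_contDiffOn hg1) he
  choose h hh1 hh2 using hh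
  refine ⟨h, hh1, fun b ↦ ?_, ?_⟩
  · rw [(hh2 b).self_of_nhds]
    change g y₀ c b = c b
    rw [hg2]
    rfl
  · filter_upwards [(eventually_all.2 hh2).eventually_nhds, e.open_source.mem_nhds he]
      with x hx hxs b
    have h1 : h b =ᶠ[𝓝 x] L b ∘ g := hx.mono fun a ha ↦ ha b
    rw [h1.fderiv_eq, ((L b).hasFDerivAt.comp x (hgd x hxs).hasFDerivAt).fderiv]
    change L b (fderiv ℝ g x (η x)) = _
    rw [hg3 x hxs]
    change - (G x (g x c) b) = _
    rw [hGapp]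
    refine congrArg _ (Finset.sum_congr rfl fun a _ ↦ ?_)
    rw [hx.self_of_nhds a]
    rfl

end Calculus

/-! ### The induction step: one more hyperbolic plane. -/

section Induction

variable {V : Type*} [NormedAddCommGroup V] [NormedSpace ℝ V] [FiniteDimensional ℝ V]
  {M : Type*} [TopologicalSpace M] [ChartedSpace V M] [T2Space M] [IsManifold 𝓘(ℝ, V) ∞ M]
  {F : Type*} [NormedAddCommGroup F] [NormedSpace ℝ F] [FiniteDimensional ℝ F]
  {E : M → Type*} [TopologicalSpace (TotalSpace F E)]
  [∀ x, AddCommGroup (E x)] [∀ x, Module ℝ (E x)] [∀ x, TopologicalSpace (E x)]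
  [FiberBundle F E] [VectorBundle ℝ F E]

namespace CourantAlgebroid.Splitting

variable [ContMDiffVectorBundle ∞ F E 𝓘(ℝ, V)] {A : CourantAlgebroid 𝓘(ℝ, V) F E} {p : M}
  {k m : ℕ} (S : A.Splitting p k m)

/-- Take an invariant extension of `e` and its part `γ` orthogonal to the `α i`, `β i`. As `[α i, γ]
= 0` and the `y l` are invariant, so are the functions `ρ(γ) y_l`; they are therefore functions of
`y` and define `η`. Orthogonality to `β i` means `ρ(γ) t_i = 0`. If `η` vanished at `p`, so would
the anchor of `γ`, and the anchor of `e` would lie in the excluded span. -/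
theorem exists_transverse {e : E p}
    (he : A.anchor p e ∉ Submodule.span ℝ (range fun i ↦ A.anchor p (S.α i p))) :
    ∃ (γ : Cₛ^∞⟮𝓘(ℝ, V); F, E⟯) (η : (Fin m → ℝ) → Fin m → ℝ),
      (∀ᶠ x in 𝓝 p, ∀ i, A.bracket (S.α i) γ x = 0) ∧
      (∀ᶠ x in 𝓝 p, ∀ i, A.pair γ (S.α i) x = 0 ∧ A.pair γ (S.β i) x = 0) ∧
      ContDiff ℝ ∞ η ∧ (∀ᶠ x in 𝓝 p, (fun l ↦ A.der γ (S.y l) x) = η fun l ↦ S.y l x) ∧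
      η (fun l ↦ S.y l p) ≠ 0 := by
  obtain ⟨γ₀, hγ₀, hinv⟩ := S.exists_invariant e
  have h1 := S.bracket_ortho hinv
  have h2 := S.pair_ortho γ₀
  have h3 (l : Fin m) : ∀ᶠ x in 𝓝 p, ∀ i, A.der (S.α i) (A.der (S.ortho γ₀) (S.y l)) x = 0 := by
    filter_upwards [h1, S.der_y.eventually_nhds] with x hx hy i
    have h4 : A.der (A.bracket (S.α i) (S.ortho γ₀)) (S.y l) x = 0 := by
      rw [der_apply, hx, map_zero, map_zero]
    rw [A.der_bracket, map_sub_apply,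
      A.der_eq_zero_of_eventually_const (hy.mono fun z hz ↦ hz i l), sub_zero] at h4
    exact h4
  choose η hη hη' using fun l ↦ S.exists_eq_compMap (h3 l)
  have hηev : ∀ᶠ x in 𝓝 p, (fun l ↦ A.der (S.ortho γ₀) (S.y l) x)
      = fun l ↦ η l fun l ↦ S.y l x := by
    filter_upwards [eventually_all.2 hη'] with x hx using funext hx
  refine ⟨S.ortho γ₀, fun b l ↦ η l b, h1, h2, contDiff_pi.2 hη, hηev, fun h0 ↦ he ?_⟩
  have h5 : A.anchor p (S.ortho γ₀ p) = 0 := by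
    refine S.inj _ (fun i ↦ ?_) fun l ↦ ?_
    · have h6 := (h2.self_of_nhds i).2
      rwa [A.pair_comm, S.pair_β.self_of_nhds] at h6
    · exact (congrFun hηev.self_of_nhds l).trans (congrFun h0 l)
  have h6 : A.anchor p e = ∑ i, A.pair γ₀ (S.β i) p • A.anchor p (S.α i p) := by
    rw [ortho, section_sub_apply, map_sub, sub_eq_zero, hγ₀, section_sum_apply, map_sum] at h5
    rw [h5]
    refine Finset.sum_congr rfl fun i _ ↦ ?_
    rw [section_add_apply, section_smul_apply, section_smul_apply, map_add, map_smul, map_smul]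
    have h7 : A.anchor p (S.β i p) = 0 :=
      tangentVector_eq_zero p _ fun f ↦ congrArg (fun g : C^∞⟮𝓘(ℝ, V), M; ℝ⟯ ↦ g p) (S.der_β i f)
    rw [h7, smul_zero, add_zero]
  rw [h6]
  exact Submodule.sum_mem _ fun i _ ↦ Submodule.smul_mem _ _ (Submodule.subset_span ⟨i, rfl⟩)

/-- If `α'` commutes with all `α i` and acts on the coordinates `y` by a nonvanishing vector field,
then every vector extends to a section invariant under all `α i` and `α'`. -/
theorem exists_invariant_of_bracket {α' : Cₛ^∞⟮𝓘(ℝ, V); F, E⟯} {η : (Fin m → ℝ) → Fin m → ℝ}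
    (hα' : ∀ᶠ x in 𝓝 p, ∀ i, A.bracket (S.α i) α' x = 0) (hη : ContDiff ℝ ∞ η)
    (hηy : ∀ᶠ x in 𝓝 p, (fun l ↦ A.der α' (S.y l) x) = η fun l ↦ S.y l x)
    (hη0 : η (fun l ↦ S.y l p) ≠ 0) (v : E p) :
    ∃ γ : Cₛ^∞⟮𝓘(ℝ, V); F, E⟯, γ p = v ∧ (∀ᶠ x in 𝓝 p, ∀ i, A.bracket (S.α i) γ x = 0) ∧
      ∀ᶠ x in 𝓝 p, A.bracket α' γ x = 0 := by
  have := finiteDimensional_fiber F E p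
  let b := Module.finBasis ℝ (E p)
  choose γ hγp hγ using fun a ↦ S.exists_invariant (b a)
  have hγ := eventually_all.2 hγ
  have hcard : Fintype.card (Fin (Module.finrank ℝ (E p))) = Module.finrank ℝ F := by
    rw [Fintype.card_fin, finrank_fiber F E p]
  have hli : LinearIndependent ℝ fun a ↦ γ a p := by simpa only [hγp] using b.linearIndependent
  choose Γ hΓ using fun a ↦ A.exists_coeff hcard hli (A.bracket α' (γ a))
  have hΓ := eventually_all.2 hΓ
  -- By Jacobi `α i` annihilates `[α', γ a]`. Expanding this bracket in the invariant frame leaves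
  -- only the derivatives of the coefficients, which must vanish by linear independence.
  have hΓinv (a c) : ∀ᶠ x in 𝓝 p, ∀ i, A.der (S.α i) (Γ a c) x = 0 := by
    filter_upwards [hα'.eventually_nhds, hγ.eventually_nhds, hΓ.eventually_nhds,
      A.eventually_linearIndependent hcard hli] with x h1 h2 h3 h4 i
    have h5 : A.bracket (S.α i) (A.bracket α' (γ a)) x = 0 := by
      rw [← A.jacobi, section_add_apply,
        A.bracket_apply_eq_zero_left (h1.mono fun z hz ↦ hz i),
        A.bracket_apply_eq_zero_right (h2.mono fun z hz ↦ hz a i), add_zero]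
    have h6 : A.bracket (S.α i) (A.bracket α' (γ a)) x
        = A.bracket (S.α i) (∑ d, Γ a d • γ d) x :=
      A.bracket_congr (Eventually.of_forall fun _ ↦ rfl) (h3.mono fun z hz ↦ by
        rw [hz a, section_sum_apply]; rfl)
    rw [h5] at h6
    simp only [map_sum, bracket_smul_right, section_sum_apply, section_add_apply,
      section_smul_apply, h2.self_of_nhds _ i, smul_zero, zero_add] at h6
    exact Fintype.linearIndependent_iff.1 h4 _ h6.symm c
  choose G hG hG' using fun a c ↦ S.exists_eq_compMap (hΓinv a c)
  have hG' := eventually_all.2 fun a ↦ eventually_all.2 (hG' a)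
  -- The equation `η h_c = -∑ h_a Γ_ac` says that `α'` annihilates `∑ h_a γ_a`. Since the `h_a` are
  -- functions of `y`, invariance under the `α i` is kept.
  obtain ⟨h, hh, hh0, hhη⟩ := exists_parallel hη hη0 hG fun a ↦ b.repr v a
  refine ⟨∑ a, compMap (h a) (hh a) S.y • γ a, ?_, ?_, ?_⟩
  · rw [section_sum_apply]
    conv_rhs => rw [← b.sum_repr v]
    refine Finset.sum_congr rfl fun a _ ↦ ?_
    rw [section_smul_apply, compMap_apply, hh0, hγp]
  · filter_upwards [hγ, eventually_all.2 fun a ↦ S.der_compMap_α (hh a)] with x h1 h2 i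
    simp only [map_sum, bracket_smul_right, section_sum_apply, section_add_apply,
      section_smul_apply, h1, h2, smul_zero, zero_smul, zero_add, Finset.sum_const_zero]
  · filter_upwards [hΓ, hG', hηy, (tendsto_pi_map S.y p).eventually hhη] with x h1 h2 h3 h4
    simp only [map_sum, bracket_smul_right, section_sum_apply, section_add_apply,
      section_smul_apply, h1, h2, A.der_compMap, h3, h4, Finset.sum_add_distrib, Finset.smul_sum]
    rw [Finset.sum_comm, ← Finset.sum_add_distrib]
    refine Finset.sum_eq_zero fun c _ ↦ ?_
    rw [neg_smul, Finset.sum_smul, ← sub_eq_add_neg, sub_eq_zero]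
    exact Finset.sum_congr rfl fun a _ ↦ by rw [smul_smul]; rfl

/-- The new function `t'` straightens the field `η` by which `γ` acts on `y`, and the other
straightening coordinates replace `y`. The new pair is `β' = ρ^* dt'` and `α' = γ - ½⟨γ,γ⟩β'`. The
correction makes `α'` isotropic and leaves its anchor unchanged, since gradients have zero anchor.
-/
theorem exists_succ {e : E p}
    (he : A.anchor p e ∉ Submodule.span ℝ (range fun i ↦ A.anchor p (S.α i p))) :
    ∃ m', Nonempty (A.Splitting p (k + 1) m') := by
  obtain ⟨γ, η, hγ1, hγ2, hη, hηy, hη0⟩ := S.exists_transverse he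
  obtain ⟨m', s, z, hm', hs, hz, hsz, hinj⟩ := exists_straightening hη hη0
  let t' := compMap s hs S.y
  have he0 : e ≠ 0 := by
    rintro rfl
    exact he (by rw [map_zero]; exact Submodule.zero_mem _)
  obtain ⟨β', hβ1, hβ2, hβ3⟩ := A.exists_gradient he0 t'
  let c : C^∞⟮𝓘(ℝ, V), M; ℝ⟯ := ⟨fun _ ↦ 1 / 2, contMDiff_const⟩
  let q : C^∞⟮𝓘(ℝ, V), M; ℝ⟯ := c * A.pair γ γ
  let α' := γ - q • β'
  have hderα' (g) : A.der α' g = A.der γ g := by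
    rw [der_sub_left, der_smul_left, hβ3, mul_zero, sub_zero]
  have hq (x) : q x = 1 / 2 * A.pair γ γ x := rfl
  have hst := (tendsto_pi_map S.y p).eventually hsz
  have hγt : ∀ᶠ x in 𝓝 p, A.der γ t' x = 1 := by
    filter_upwards [hst, hηy] with x h1 h2
    rw [A.der_compMap, h2, h1.1]
  have hγz : ∀ᶠ x in 𝓝 p, ∀ l, A.der γ (compMap (z l) (hz l) S.y) x = 0 := by
    filter_upwards [hst, hηy] with x h1 h2 l
    rw [A.der_compMap, h2, h1.2]
  have hαt := S.der_compMap_α hs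
  have hαz := eventually_all.2 fun l ↦ S.der_compMap_α (hz l)
  have hββ : ∀ᶠ x in 𝓝 p, A.pair β' β' x = 0 := by
    filter_upwards [hβ1] with x h1
    rw [h1, hβ3, map_zero_apply]
  have hβγ : ∀ᶠ x in 𝓝 p, A.pair β' γ x = 1 := by
    filter_upwards [hβ1, hγt] with x h1 h2
    rw [h1, h2]
  have hβα : ∀ᶠ x in 𝓝 p, ∀ i, A.pair (S.α i) β' x = 0 := by
    filter_upwards [hβ1, hαt] with x h1 h2 i
    rw [A.pair_comm, h1, h2]
  -- The value is `⟨γ,γ⟩ - 2q⟨γ,β'⟩ + q²⟨β',β'⟩` with `q = ½⟨γ,γ⟩`, `⟨γ,β'⟩ = 1` and `⟨β',β'⟩ = 0`.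
  have hα'α' : ∀ᶠ x in 𝓝 p, A.pair α' α' x = 0 := by
    filter_upwards [hββ, hβγ] with x h1 h2
    simp only [α', pair_sub_left, pair_sub_right, pair_smul_left, pair_smul_right, map_sub_apply,
      map_mul_apply, h1, h2, hq, A.pair_comm γ β']
    ring
  have hαα' : ∀ᶠ x in 𝓝 p, ∀ i, A.pair (S.α i) α' x = 0 := by
    filter_upwards [hγ2, hβα] with x h1 h2 i
    rw [pair_sub_right, pair_smul_right, map_sub_apply, map_mul_apply, A.pair_comm _ γ, (h1 i).1,
      h2, mul_zero, sub_zero]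
  have hαβ' : ∀ᶠ x in 𝓝 p, ∀ i, A.bracket (S.α i) β' x = 0 := by
    filter_upwards [hβα.eventually_nhds] with x h1 i
    have h := A.bracket_add_bracket_apply_eq_zero (h1.mono fun z hz ↦ hz i)
    rwa [hβ2, section_zero_apply, add_zero] at h
  -- The factor `q` is invariant because `γ` is, and `α i` commutes with `β'`.
  have hbαα' : ∀ᶠ x in 𝓝 p, ∀ i, A.bracket (S.α i) α' x = 0 := by
    filter_upwards [hγ1, hαβ'] with x h1 h2 i
    have h3 : A.der (S.α i) q x = 0 := by
      rw [der_mul, map_add_apply, map_mul_apply, map_mul_apply,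
        A.der_eq_zero_of_eventually_const (f := c) (Eventually.of_forall fun _ ↦ rfl), mul_zero, add_zero,
        der_pair, map_add_apply, pair_apply, pair_apply, h1, map_zero, map_zero,
        LinearMap.zero_apply, add_zero, mul_zero]
    rw [map_sub, bracket_smul_right, section_sub_apply, section_add_apply, section_smul_apply,
      section_smul_apply, h1, h2, h3, smul_zero, zero_smul, add_zero, sub_zero]
  have hbα'α : ∀ᶠ x in 𝓝 p, ∀ i, A.bracket α' (S.α i) x = 0 := by
    filter_upwards [hαα'.eventually_nhds, hbαα'] with x h1 h2 i
    have h := A.bracket_add_bracket_apply_eq_zero (h1.mono fun z hz ↦ hz i)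
    rwa [h2, zero_add] at h
  have hbα'α' : ∀ᶠ x in 𝓝 p, A.bracket α' α' x = 0 := by
    filter_upwards [hα'α'.eventually_nhds] with x h1
    have h := A.bracket_add_bracket_apply_eq_zero h1
    rwa [← two_smul ℝ, smul_eq_zero_iff_right two_ne_zero] at h
  refine ⟨m', ⟨{
    α := Fin.cons α' S.α
    β := Fin.cons β' S.β
    t := Fin.cons t' S.t
    y := fun l ↦ compMap (z l) (hz l) S.y
    card := ?_
    der_t := ?_
    der_y := ?_
    pair_α := ?_
    bracket_α := ?_
    pair_β := ?_
    bracket_β := ?_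
    der_β := ?_
    inj := ?_
    exists_invariant := ?_ }⟩⟩
  · have := S.card
    rw [Module.finrank_fin_fun] at hm'
    lia
  · filter_upwards [S.der_t, S.pair_β, hγ2, hγt, hαt] with x h1 h2 h3 h4 h5
    refine Fin.forall_fin_succ.2 ⟨Fin.forall_fin_succ.2 ⟨?_, fun j ↦ ?_⟩,
      fun i ↦ Fin.forall_fin_succ.2 ⟨?_, fun j ↦ ?_⟩⟩
    · simp only [Fin.cons_zero, hderα', h4, if_true]
    · simp only [Fin.cons_zero, Fin.cons_succ, hderα', ← h2, A.pair_comm _ γ, (h3 _).2,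
        (Fin.succ_ne_zero j).symm, if_false]
    · simp only [Fin.cons_zero, Fin.cons_succ, Fin.succ_ne_zero, if_false]
      exact h5 i
    · simp only [Fin.cons_succ, h1, Fin.succ_inj]
  · filter_upwards [hγz, hαz] with x h1 h2
    refine Fin.forall_fin_succ.2 ⟨fun j ↦ ?_, fun i j ↦ ?_⟩
    · simp only [Fin.cons_zero, hderα', h1]
    · simp only [Fin.cons_succ, h2]
  · filter_upwards [S.pair_α, hα'α', hαα'] with x h1 h2 h3
    refine Fin.forall_fin_succ.2 ⟨Fin.forall_fin_succ.2 ⟨?_, fun j ↦ ?_⟩,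
      fun i ↦ Fin.forall_fin_succ.2 ⟨?_, fun j ↦ ?_⟩⟩
    · simp only [Fin.cons_zero, h2]
    · simp only [Fin.cons_zero, Fin.cons_succ, A.pair_comm α', h3]
    · simp only [Fin.cons_zero, Fin.cons_succ, h3]
    · simp only [Fin.cons_succ, h1]
  · filter_upwards [S.bracket_α, hbαα', hbα'α, hbα'α'] with x h1 h2 h3 h4
    refine Fin.forall_fin_succ.2 ⟨Fin.forall_fin_succ.2 ⟨?_, fun j ↦ ?_⟩,
      fun i ↦ Fin.forall_fin_succ.2 ⟨?_, fun j ↦ ?_⟩⟩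
    · simp only [Fin.cons_zero, h4]
    · simp only [Fin.cons_zero, Fin.cons_succ, h3]
    · simp only [Fin.cons_zero, Fin.cons_succ, h2]
    · simp only [Fin.cons_succ, h1]
  · filter_upwards [S.pair_β, hβ1] with x h1 h2
    exact Fin.forall_fin_succ.2 ⟨h2, h1⟩
  · exact Fin.forall_fin_succ.2 ⟨hβ2, S.bracket_β⟩
  · exact Fin.forall_fin_succ.2 ⟨hβ3, S.der_β⟩
  · intro v hv1 hv2
    obtain ⟨h1, h2⟩ := Fin.forall_fin_succ.1 hv1
    refine S.inj v h2 fun l ↦ ?_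
    have hcomp (h : (Fin m → ℝ) → ℝ) (hh : ContDiff ℝ ∞ h) :
        mvfderiv 𝓘(ℝ, V) (compMap h hh S.y) p v
          = fderiv ℝ h (fun j ↦ S.y j p) fun j ↦ mvfderiv 𝓘(ℝ, V) (S.y j) p v :=
      mvfderiv_eq_fderiv S.y (hh.contDiffAt.differentiableAt (by simp))
        (Eventually.of_forall fun _ ↦ rfl) v
    have h3 := hinj (fun j ↦ mvfderiv 𝓘(ℝ, V) (S.y j) p v) ((hcomp s hs).symm.trans h1)
      fun l ↦ (hcomp _ (hz l)).symm.trans (hv2 l)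
    exact congrFun h3 l
  · intro v
    obtain ⟨δ, h1, h2, h3⟩ := S.exists_invariant_of_bracket hbαα' hη (by simpa only [hderα'] using hηy)
      hη0 v
    refine ⟨δ, h1, ?_⟩
    filter_upwards [h2, h3] with x h4 h5
    exact Fin.forall_fin_succ.2 ⟨h5, h4⟩

end CourantAlgebroid.Splitting

/-- The anchors of `k` sections span at most `k` dimensions, so below the rank some anchor escapes
their span and the induction step applies. -/
theorem CourantAlgebroid.exists_splitting [ContMDiffVectorBundle ∞ F E 𝓘(ℝ, V)]
    (A : CourantAlgebroid 𝓘(ℝ, V) F E) (p : M) {k : ℕ}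
    (hk : k ≤ Module.finrank ℝ (LinearMap.range (A.anchor p))) :
    ∃ m, Nonempty (A.Splitting p k m) := by
  induction k with
  | zero => exact ⟨_, A.nonempty_splitting_zero p⟩
  | succ k ih =>
    obtain ⟨m, ⟨S⟩⟩ := ih (by lia)
    have : ∃ e, A.anchor p e ∉ Submodule.span ℝ (range fun i ↦ A.anchor p (S.α i p)) := by
      by_contra! h
      have h1 : LinearMap.range (A.anchor p)
          ≤ Submodule.span ℝ (range fun i ↦ A.anchor p (S.α i p)) := by
        rintro _ ⟨e, rfl⟩
        exact h e
      have : FiniteDimensional ℝ (Submodule.span ℝ (range fun i ↦ A.anchor p (S.α i p))) :=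
        FiniteDimensional.span_of_finite ℝ (finite_range _)
      have h2 := Submodule.finrank_mono h1
      have h3 := finrank_range_le_card (R := ℝ) fun i ↦ A.anchor p (S.α i p)
      rw [Set.finrank, Fintype.card_fin] at h3
      lia
    obtain ⟨e, he⟩ := this
    exact S.exists_succ he

end Induction

/-! ### Descent of Courant algebroids along a split map. -/

section Descent

variable {V H M : Type*} [NormedAddCommGroup V] [NormedSpace ℝ V]
  [TopologicalSpace H] {I : ModelWithCorners ℝ V H} [TopologicalSpace M] [ChartedSpace H M]
  [IsManifold I ∞ M] {F : Type*} [NormedAddCommGroup F] [NormedSpace ℝ F]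
  {E : M → Type*} [TopologicalSpace (TotalSpace F E)]
  [∀ x, AddCommGroup (E x)] [∀ x, Module ℝ (E x)] [∀ x, TopologicalSpace (E x)]
  [FiberBundle F E] [VectorBundle ℝ F E]
  {V' H' M' : Type*} [NormedAddCommGroup V'] [NormedSpace ℝ V']
  [TopologicalSpace H'] {I' : ModelWithCorners ℝ V' H'} [TopologicalSpace M'] [ChartedSpace H' M']
  [IsManifold I' ∞ M'] {F' : Type*} [NormedAddCommGroup F'] [NormedSpace ℝ F']
  {E' : M' → Type*} [TopologicalSpace (TotalSpace F' E')]
  [∀ x, AddCommGroup (E' x)] [∀ x, Module ℝ (E' x)] [∀ x, TopologicalSpace (E' x)]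
  [FiberBundle F' E'] [VectorBundle ℝ F' E']

/-- A Courant algebroid descends along a split map `q : M → M'` to a bundle `E'` whose pullback is
embedded in `E`, provided pairing and anchor descend and the pulled back sections are closed under
the bracket. -/
theorem CourantAlgebroid.exists_descent (A : CourantAlgebroid I F E)
    (q : C^∞⟮I, M; I', M'⟯) (s : C^∞⟮I', M'; I, M⟯) (hs : ∀ y, q (s y) = y)
    (j : ∀ x, E' (q x) →ₗ[ℝ] E x) (hj : ∀ x, Function.Injective (j x))
    (J : Cₛ^∞⟮I'; F', E'⟯ → Cₛ^∞⟮I; F, E⟯) (hJ : ∀ σ x, J σ x = j x (σ (q x)))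
    (P : ∀ y, E' y →ₗ[ℝ] E' y →ₗ[ℝ] ℝ)
    (hP : ∀ x v w, A.pairing x (j x v) (j x w) = P (q x) v w)
    (hP0 : ∀ y v, (∀ w, P y v w = 0) → v = 0)
    (a : ∀ y, E' y →ₗ[ℝ] TangentSpace I' y)
    (ha : ∀ x v, mfderiv I I' q x (A.anchor x (j x v)) = a (q x) v)
    (ha' : ContMDiff (I'.prod 𝓘(ℝ, F')) I'.tangent ∞
      fun v : TotalSpace F' E' ↦ (⟨v.proj, a v.proj v.snd⟩ : TangentBundle I' M'))
    (hb : ∀ σ τ, ∃ υ, A.bracket (J σ) (J τ) = J υ) :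
    ∃ B : CourantAlgebroid I' F' E', B.pairing = P ∧ B.anchor = a ∧
      ∀ σ τ, J (B.bracket σ τ) = A.bracket (J σ) (J τ) := by
  have hsurj (y : M') : ∃ x, q x = y := ⟨s y, hs y⟩
  have hJinj : Function.Injective J := fun σ τ h ↦ ContMDiffSection.ext fun y ↦ by
    obtain ⟨x, rfl⟩ := hsurj y
    apply hj x
    rw [← hJ, ← hJ, h]
  have hJadd (σ τ) : J (σ + τ) = J σ + J τ := ContMDiffSection.ext fun x ↦ by
    rw [section_add_apply, hJ, hJ, hJ, section_add_apply, map_add]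
  have hJsmul (c : ℝ) (σ) : J (c • σ) = c • J σ := ContMDiffSection.ext fun x ↦ by
    rw [hJ]
    exact ((j x).map_smul c (σ (q x))).trans (congrArg (c • ·) (hJ σ x).symm)
  have hder (f : C^∞⟮I', M'; ℝ⟯) (x : M) (v : E' (q x)) :
      mvfderiv I (f ∘ q) x (A.anchor x (j x v)) = mvfderiv I' f (q x) (a (q x) v) := by
    rw [← ha]
    exact mvfderiv_comp_apply x (mdiffAt_map f (q x)) (q.contMDiff.mdifferentiableAt (by simp)) _
  have hpair (σ τ) : (fun x ↦ A.pairing x (J σ x) (J τ x))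
      = (fun y ↦ P y (σ y) (τ y)) ∘ q := funext fun x ↦ by
    rw [hJ, hJ, hP]
    rfl
  -- The section `s` turns smoothness over `M` of the pulled back pairing into smoothness over `M'`.
  have hPs (σ τ : Cₛ^∞⟮I'; F', E'⟯) : ContMDiff I' 𝓘(ℝ, ℝ) ∞ fun y ↦ P y (σ y) (τ y) := by
    refine ((A.pairing_smooth (J σ) (J τ)).comp s.contMDiff).congr fun y ↦ ?_
    rw [hpair]
    exact (congrArg (fun y ↦ P y (σ y) (τ y)) (hs y)).symm
  choose b hb using hb
  refine ⟨{
    pairing := P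
    pairing_smooth := hPs
    pairing_symm := fun y v w ↦ ?_
    pairing_nondegenerate := hP0
    anchor := a
    anchor_smooth := ha'
    bracket := LinearMap.mk₂ ℝ b ?_ ?_ ?_ ?_
    leibniz := ?_
    jacobi := ?_
    invariance := ?_
    symmetrization := ?_ }, rfl, rfl, fun σ τ ↦ (hb σ τ).symm⟩
  -- Each axiom is checked upstairs: an identity of sections after applying the injective `J`, a
  -- pointwise identity at a preimage `x` of the point.
  · obtain ⟨x, rfl⟩ := hsurj y
    rw [← hP, ← hP, A.pairing_symm]
  · intro σ σ' τ
    apply hJinj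
    rw [← hb, hJadd, hJadd, ← hb, ← hb, map_add, LinearMap.add_apply]
  · intro c σ τ
    apply hJinj
    rw [← hb, hJsmul, hJsmul, ← hb, map_smul, LinearMap.smul_apply]
  · intro σ τ τ'
    apply hJinj
    rw [← hb, hJadd, hJadd, ← hb, ← hb, map_add]
  · intro c σ τ
    apply hJinj
    rw [← hb, hJsmul, hJsmul, ← hb, map_smul]
  · intro σ τ f y
    obtain ⟨x, rfl⟩ := hsurj y
    apply hj x
    have h1 : J (smulSection f τ) = smulSection (f.comp q) (J τ) :=
      ContMDiffSection.ext fun z ↦ by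
        rw [hJ]
        exact ((j z).map_smul (f (q z)) (τ (q z))).trans
          (congrArg (f (q z) • ·) (hJ τ z).symm)
    have h2 := A.leibniz (J σ) (J τ) (f.comp q) x
    rw [← h1, hb, hb, hJ, hJ, hJ σ, hJ τ] at h2
    have h3 := hder f x (σ (q x))
    rw [map_add, map_smul, map_smul, ← h3]
    exact h2
  · intro α β γ
    apply hJinj
    have h := A.jacobi (J α) (J β) (J γ)
    simp only [hb] at h
    rw [hJadd]
    exact h
  · intro α β γ y
    obtain ⟨x, rfl⟩ := hsurj y
    have h := A.invariance (J α) (J β) (J γ) x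
    rw [hpair, hb, hb] at h
    simp only [hJ, hP] at h
    exact (hder ⟨_, hPs β γ⟩ x (α (q x))).symm.trans h
  · intro α β y e
    obtain ⟨x, rfl⟩ := hsurj y
    have h := A.symmetrization (J α) (J β) x (j x e)
    rw [hpair, hb, hb] at h
    simp only [hJ] at h
    rw [← map_add, hP] at h
    exact h.trans (hder ⟨_, hPs α β⟩ x e)

end Descent

/-! ### Recognising a direct product by descent to both factors. -/

section Factors

variable {V₁ H₁ M₁ : Type*} [NormedAddCommGroup V₁] [NormedSpace ℝ V₁] [TopologicalSpace H₁]
  {I₁ : ModelWithCorners ℝ V₁ H₁} [TopologicalSpace M₁] [ChartedSpace H₁ M₁]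
  [IsManifold I₁ ∞ M₁]
  {F₁ : Type*} [NormedAddCommGroup F₁] [NormedSpace ℝ F₁]
  {E₁ : M₁ → Type*} [TopologicalSpace (TotalSpace F₁ E₁)]
  [∀ x, AddCommGroup (E₁ x)] [∀ x, Module ℝ (E₁ x)] [∀ x, TopologicalSpace (E₁ x)]
  [FiberBundle F₁ E₁] [VectorBundle ℝ F₁ E₁]
  {V₂ H₂ M₂ : Type*} [NormedAddCommGroup V₂] [NormedSpace ℝ V₂] [TopologicalSpace H₂]
  {I₂ : ModelWithCorners ℝ V₂ H₂} [TopologicalSpace M₂] [ChartedSpace H₂ M₂]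
  [IsManifold I₂ ∞ M₂]
  {F₂ : Type*} [NormedAddCommGroup F₂] [NormedSpace ℝ F₂]
  {E₂ : M₂ → Type*} [TopologicalSpace (TotalSpace F₂ E₂)]
  [∀ x, AddCommGroup (E₂ x)] [∀ x, Module ℝ (E₂ x)] [∀ x, TopologicalSpace (E₂ x)]
  [FiberBundle F₂ E₂] [VectorBundle ℝ F₂ E₂]

theorem contMDiff_totalSpace_inl (n₀ : M₂) :
    ContMDiff (I₁.prod 𝓘(ℝ, F₁)) ((I₁.prod I₂).prod 𝓘(ℝ, F₁ × F₂)) ∞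
      fun v : TotalSpace F₁ E₁ ↦ (⟨(v.proj, n₀), (v.snd, 0)⟩ :
        TotalSpace (F₁ × F₂) (prodBundle I₁ E₁ I₂ E₂)) := by
  intro v₀
  rw [Bundle.contMDiffAt_totalSpace]
  have h1 := (Bundle.contMDiffAt_totalSpace (IM := I₁.prod 𝓘(ℝ, F₁)) (IB := I₁) (n := ∞) (x₀ := v₀)).1
    (contMDiffAt_id : ContMDiffAt (I₁.prod 𝓘(ℝ, F₁)) (I₁.prod 𝓘(ℝ, F₁)) ∞
      (id : TotalSpace F₁ E₁ → TotalSpace F₁ E₁) v₀)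
  refine ⟨h1.1.prodMk contMDiffAt_const, ?_⟩
  exact h1.2.prodMk_space (contMDiffAt_const
    (c := (trivializationAt F₂ E₂ n₀ ⟨n₀, (0 : E₂ n₀)⟩).2))

theorem contMDiff_totalSpace_inr (l₀ : M₁) :
    ContMDiff (I₂.prod 𝓘(ℝ, F₂)) ((I₁.prod I₂).prod 𝓘(ℝ, F₁ × F₂)) ∞
      fun v : TotalSpace F₂ E₂ ↦ (⟨(l₀, v.proj), (0, v.snd)⟩ :
        TotalSpace (F₁ × F₂) (prodBundle I₁ E₁ I₂ E₂)) := by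
  intro v₀
  rw [Bundle.contMDiffAt_totalSpace]
  have h1 := (Bundle.contMDiffAt_totalSpace (IM := I₂.prod 𝓘(ℝ, F₂)) (IB := I₂) (n := ∞) (x₀ := v₀)).1
    (contMDiffAt_id : ContMDiffAt (I₂.prod 𝓘(ℝ, F₂)) (I₂.prod 𝓘(ℝ, F₂)) ∞
      (id : TotalSpace F₂ E₂ → TotalSpace F₂ E₂) v₀)
  refine ⟨contMDiffAt_const.prodMk h1.1, ?_⟩
  exact (contMDiffAt_const
    (c := (trivializationAt F₁ E₁ l₀ ⟨l₀, (0 : E₁ l₀)⟩).2)).prodMk_space h1.2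

variable (I₁ E₁ I₂ E₂) in
/-- The inclusion of the fibre of the first factor. -/
def prodInl (z : M₁ × M₂) : E₁ z.1 →ₗ[ℝ] prodBundle I₁ E₁ I₂ E₂ z :=
  LinearMap.inl ℝ (E₁ z.1) (E₂ z.2)

variable (I₁ E₁ I₂ E₂) in
/-- The inclusion of the fibre of the second factor. -/
def prodInr (z : M₁ × M₂) : E₂ z.2 →ₗ[ℝ] prodBundle I₁ E₁ I₂ E₂ z :=
  LinearMap.inr ℝ (E₁ z.1) (E₂ z.2)

variable (I₁ E₁ I₂ E₂) in
/-- The projection to the fibre of the first factor. -/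
def prodFst (z : M₁ × M₂) : prodBundle I₁ E₁ I₂ E₂ z →ₗ[ℝ] E₁ z.1 :=
  LinearMap.fst ℝ (E₁ z.1) (E₂ z.2)

variable (I₁ E₁ I₂ E₂) in
/-- The projection to the fibre of the second factor. -/
def prodSnd (z : M₁ × M₂) : prodBundle I₁ E₁ I₂ E₂ z →ₗ[ℝ] E₂ z.2 :=
  LinearMap.snd ℝ (E₁ z.1) (E₂ z.2)

theorem prodInl_add_prodInr (z : M₁ × M₂) (v : prodBundle I₁ E₁ I₂ E₂ z) :
    prodInl I₁ E₁ I₂ E₂ z (prodFst I₁ E₁ I₂ E₂ z v)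
      + prodInr I₁ E₁ I₂ E₂ z (prodSnd I₁ E₁ I₂ E₂ z v) = v :=
  Prod.ext (add_zero v.1) (zero_add v.2)

theorem prodInl_injective (z : M₁ × M₂) : Function.Injective (prodInl I₁ E₁ I₂ E₂ z) :=
  LinearMap.inl_injective

theorem prodInr_injective (z : M₁ × M₂) : Function.Injective (prodInr I₁ E₁ I₂ E₂ z) :=
  LinearMap.inr_injective

/-- A Courant algebroid on a product bundle is a direct product if pairing and anchor split and
sections of the two factors are closed under the bracket and commute with each other. -/
theorem CourantAlgebroid.exists_isDirectProduct
    (C : CourantAlgebroid (I₁.prod I₂) (F₁ × F₂) (prodBundle I₁ E₁ I₂ E₂)) (l₀ : M₁) (n₀ : M₂)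
    (hp₁ : ∀ (l : M₁) (n : M₂) (v w : E₁ l),
      C.pairing (l, n) (prodInl I₁ E₁ I₂ E₂ (l, n) v) (prodInl I₁ E₁ I₂ E₂ (l, n) w)
        = C.pairing (l, n₀) (prodInl I₁ E₁ I₂ E₂ (l, n₀) v) (prodInl I₁ E₁ I₂ E₂ (l, n₀) w))
    (hp₂ : ∀ (l : M₁) (n : M₂) (v w : E₂ n),
      C.pairing (l, n) (prodInr I₁ E₁ I₂ E₂ (l, n) v) (prodInr I₁ E₁ I₂ E₂ (l, n) w)
        = C.pairing (l₀, n) (prodInr I₁ E₁ I₂ E₂ (l₀, n) v) (prodInr I₁ E₁ I₂ E₂ (l₀, n) w))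
    (hp₁₂ : ∀ z v w, C.pairing z (prodInl I₁ E₁ I₂ E₂ z v) (prodInr I₁ E₁ I₂ E₂ z w) = 0)
    (ha₁ : ∀ (l : M₁) (n : M₂) (v : E₁ l),
      mfderiv (I₁.prod I₂) I₁ Prod.fst (l, n) (C.anchor (l, n) (prodInl I₁ E₁ I₂ E₂ (l, n) v))
        = mfderiv (I₁.prod I₂) I₁ Prod.fst (l, n₀)
          (C.anchor (l, n₀) (prodInl I₁ E₁ I₂ E₂ (l, n₀) v)))
    (ha₁' : ∀ (z : M₁ × M₂) (v : E₁ z.1),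
      mfderiv (I₁.prod I₂) I₂ Prod.snd z (C.anchor z (prodInl I₁ E₁ I₂ E₂ z v)) = 0)
    (ha₂ : ∀ (l : M₁) (n : M₂) (v : E₂ n),
      mfderiv (I₁.prod I₂) I₂ Prod.snd (l, n) (C.anchor (l, n) (prodInr I₁ E₁ I₂ E₂ (l, n) v))
        = mfderiv (I₁.prod I₂) I₂ Prod.snd (l₀, n)
          (C.anchor (l₀, n) (prodInr I₁ E₁ I₂ E₂ (l₀, n) v)))
    (ha₂' : ∀ (z : M₁ × M₂) (v : E₂ z.2),
      mfderiv (I₁.prod I₂) I₁ Prod.fst z (C.anchor z (prodInr I₁ E₁ I₂ E₂ z v)) = 0)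
    (hb₁ : ∀ σ τ : Cₛ^∞⟮I₁; F₁, E₁⟯, ∃ υ,
      C.bracket (inlSection I₂ F₂ E₂ σ) (inlSection I₂ F₂ E₂ τ) = inlSection I₂ F₂ E₂ υ)
    (hb₂ : ∀ σ τ : Cₛ^∞⟮I₂; F₂, E₂⟯, ∃ υ,
      C.bracket (inrSection I₁ F₁ E₁ σ) (inrSection I₁ F₁ E₁ τ) = inrSection I₁ F₁ E₁ υ)
    (hb₁₂ : ∀ (σ : Cₛ^∞⟮I₁; F₁, E₁⟯) (τ : Cₛ^∞⟮I₂; F₂, E₂⟯),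
      C.bracket (inlSection I₂ F₂ E₂ σ) (inrSection I₁ F₁ E₁ τ) = 0)
    (hb₂₁ : ∀ (σ : Cₛ^∞⟮I₁; F₁, E₁⟯) (τ : Cₛ^∞⟮I₂; F₂, E₂⟯),
      C.bracket (inrSection I₁ F₁ E₁ τ) (inlSection I₂ F₂ E₂ σ) = 0) :
    ∃ (A₁ : CourantAlgebroid I₁ F₁ E₁) (A₂ : CourantAlgebroid I₂ F₂ E₂),
      IsDirectProduct A₁ A₂ C := by
  have hp (z) (v w : prodBundle I₁ E₁ I₂ E₂ z) : C.pairing z v w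
      = C.pairing z (prodInl I₁ E₁ I₂ E₂ z (prodFst I₁ E₁ I₂ E₂ z v))
          (prodInl I₁ E₁ I₂ E₂ z (prodFst I₁ E₁ I₂ E₂ z w))
        + C.pairing z (prodInr I₁ E₁ I₂ E₂ z (prodSnd I₁ E₁ I₂ E₂ z v))
          (prodInr I₁ E₁ I₂ E₂ z (prodSnd I₁ E₁ I₂ E₂ z w)) := by
    conv_lhs => rw [← prodInl_add_prodInr z v, ← prodInl_add_prodInr z w]
    rw [(C.pairing z).map_add, LinearMap.add_apply, map_add, map_add, hp₁₂,
      C.pairing_symm z (prodInr I₁ E₁ I₂ E₂ z _) (prodInl I₁ E₁ I₂ E₂ z _), hp₁₂, zero_add,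
      add_zero]
  -- The structure on `E₁` is read off over the slice through `n₀`; `hp₁` and `ha₁` make the choice
  -- of slice irrelevant. Nondegeneracy is inherited because the other summand is orthogonal.
  obtain ⟨A₁, hA₁p, hA₁a, hA₁b⟩ := C.exists_descent (E' := E₁) (F' := F₁) (I' := I₁)
    ContMDiffMap.fst ⟨fun l ↦ (l, n₀), contMDiff_id.prodMk contMDiff_const⟩ (fun _ ↦ rfl)
    (prodInl I₁ E₁ I₂ E₂) prodInl_injective (inlSection I₂ F₂ E₂) (fun σ z ↦ rfl)
    (fun l ↦ (C.pairing (l, n₀)).compl₁₂ (prodInl I₁ E₁ I₂ E₂ (l, n₀))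
      (prodInl I₁ E₁ I₂ E₂ (l, n₀)))
    (fun z v w ↦ hp₁ z.1 z.2 v w)
    (fun l v hv ↦ by
      refine prodInl_injective (I₁ := I₁) (I₂ := I₂) (E₂ := E₂) (l, n₀) ?_
      rw [map_zero]
      refine C.pairing_nondegenerate _ _ fun w ↦ ?_
      rw [← prodInl_add_prodInr (l, n₀) w, map_add, hp₁₂, add_zero]
      exact hv _)
    (fun l ↦ (mfderiv (I₁.prod I₂) I₁ Prod.fst (l, n₀)).toLinearMap ∘ₗ
      C.anchor (l, n₀) ∘ₗ prodInl I₁ E₁ I₂ E₂ (l, n₀))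
    (fun z v ↦ ha₁ z.1 z.2 v)
    (((contMDiff_fst (I := I₁) (J := I₂) (n := ∞)).contMDiff_tangentMap (m := ∞) (by simp)).comp
      (C.anchor_smooth.comp (contMDiff_totalSpace_inl n₀))) hb₁
  obtain ⟨A₂, hA₂p, hA₂a, hA₂b⟩ := C.exists_descent (E' := E₂) (F' := F₂) (I' := I₂)
    ContMDiffMap.snd ⟨fun n ↦ (l₀, n), contMDiff_const.prodMk contMDiff_id⟩ (fun _ ↦ rfl)
    (prodInr I₁ E₁ I₂ E₂) prodInr_injective (inrSection I₁ F₁ E₁) (fun σ z ↦ rfl)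
    (fun n ↦ (C.pairing (l₀, n)).compl₁₂ (prodInr I₁ E₁ I₂ E₂ (l₀, n))
      (prodInr I₁ E₁ I₂ E₂ (l₀, n)))
    (fun z v w ↦ hp₂ z.1 z.2 v w)
    (fun n v hv ↦ by
      refine prodInr_injective (I₁ := I₁) (I₂ := I₂) (E₁ := E₁) (l₀, n) ?_
      rw [map_zero]
      refine C.pairing_nondegenerate _ _ fun w ↦ ?_
      rw [← prodInl_add_prodInr (l₀, n) w, map_add, C.pairing_symm, hp₁₂, zero_add]
      exact hv _)
    (fun n ↦ (mfderiv (I₁.prod I₂) I₂ Prod.snd (l₀, n)).toLinearMap ∘ₗ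
      C.anchor (l₀, n) ∘ₗ prodInr I₁ E₁ I₂ E₂ (l₀, n))
    (fun z v ↦ ha₂ z.1 z.2 v)
    (((contMDiff_snd (I := I₁) (J := I₂) (n := ∞)).contMDiff_tangentMap (m := ∞) (by simp)).comp
      (C.anchor_smooth.comp (contMDiff_totalSpace_inr l₀))) hb₂
  refine ⟨A₁, A₂, ⟨fun z v w ↦ ?_, fun z v ↦ ?_, fun z v ↦ ?_, fun σ τ ↦ (hA₁b σ τ).symm,
    fun σ τ ↦ (hA₂b σ τ).symm, hb₁₂, hb₂₁⟩⟩
  · rw [hA₁p, hA₂p, hp]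
    exact congrArg₂ (· + ·) (hp₁ z.1 z.2 _ _) (hp₂ z.1 z.2 _ _)
  · rw [hA₁a]
    conv_lhs => rw [← prodInl_add_prodInr z v, map_add, map_add, ha₂', add_zero]
    exact ha₁ z.1 z.2 _
  · rw [hA₂a]
    conv_lhs => rw [← prodInl_add_prodInr z v, map_add, map_add, ha₁', zero_add]
    exact ha₂ z.1 z.2 _

end Factors

/-! ### Restriction of a Courant algebroid to an open subset. -/

section RestrictionConstruction

variable {V H M : Type*} [NormedAddCommGroup V] [NormedSpace ℝ V] [FiniteDimensional ℝ V]
  [TopologicalSpace H] {I : ModelWithCorners ℝ V H} [TopologicalSpace M] [ChartedSpace H M]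
  {F : Type*} [NormedAddCommGroup F] [NormedSpace ℝ F]
  {E : M → Type*} [TopologicalSpace (TotalSpace F E)]
  [∀ x, AddCommGroup (E x)] [∀ x, Module ℝ (E x)] [∀ x, TopologicalSpace (E x)]
  [FiberBundle F E] [VectorBundle ℝ F E]

open Classical in
/-- A left inverse of the inclusion of a nonempty open set. -/
def openRetr (U : Opens M) (x₀ : U) (z : M) : U := if h : z ∈ U then ⟨z, h⟩ else x₀

theorem openRetr_coe (U : Opens M) (x₀ x : U) : openRetr U x₀ x = x := dif_pos x.2

variable (I) in
theorem contMDiffAt_openRetr (U : Opens M) (x₀ x : U) : ContMDiffAt I I ∞ (openRetr U x₀) (x : M) := by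
  rw [← contMDiffAt_subtype_iff]
  refine contMDiffAt_id.congr_of_eventuallyEq (Eventually.of_forall fun y ↦ openRetr_coe U x₀ y)

theorem eventually_coe {U : Opens M} {x : U} {P : M → Prop} :
    (∀ᶠ y : U in 𝓝 x, P y) ↔ ∀ᶠ z in 𝓝 (x : M), P z := by
  rw [← U.isOpen.isOpenEmbedding_subtypeVal.map_nhds_eq x, eventually_map]
  rfl

variable [IsManifold I ∞ M]

theorem mfderiv_openRetr_openIncl (U : Opens M) (x₀ x : U) (v : TangentSpace I x) :
    (mfderiv I I (openRetr U x₀) (x : M) (mfderiv I I (openIncl I U) x v) : V) = v := by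
  have h1 := ((contMDiffAt_openRetr I U x₀ x).mdifferentiableAt (by simp)).hasMFDerivAt
  have h2 := ((openIncl I U).contMDiff.mdifferentiableAt (x := x) (by simp)).hasMFDerivAt
  have h3 := (h1.comp x h2).congr_of_eventuallyEq (f₁ := id)
    (Eventually.of_forall fun y ↦ (openRetr_coe U x₀ y).symm)
  exact congrArg (fun L : V →L[ℝ] V ↦ L v) (hasMFDerivAt_unique h3 (hasMFDerivAt_id x))

theorem mfderiv_openIncl_openRetr (U : Opens M) (x₀ x : U) (v : TangentSpace I (x : M)) :
    mfderiv I I (openIncl I U) x (mfderiv I I (openRetr U x₀) (x : M) v : V) = v := by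
  have h1 := ((contMDiffAt_openRetr I U x₀ x).mdifferentiableAt (by simp)).hasMFDerivAt
  have h2 := ((openIncl I U).contMDiff.mdifferentiableAt (x := openRetr U x₀ x)
    (by simp)).hasMFDerivAt
  have h3 := (h2.comp (x : M) h1).congr_of_eventuallyEq (f₁ := id) (by
    filter_upwards [U.isOpen.mem_nhds x.2] with z hz
    exact (congrArg Subtype.val (openRetr_coe U x₀ ⟨z, hz⟩)).symm)
  have h4 := congrArg (fun L : V →L[ℝ] V ↦ L v) (hasMFDerivAt_unique h3 (hasMFDerivAt_id (x : M)))
  rw [openRetr_coe] at h4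
  exact h4

variable (I) in
/-- The derivative of the inclusion of an open set is invertible. -/
def openInclDeriv (U : Opens M) (x : U) : TangentSpace I x ≃ₗ[ℝ] TangentSpace I (x : M) where
  toLinearMap := (mfderiv I I (openIncl I U) x).toLinearMap
  invFun v := (mfderiv I I (openRetr U x) (x : M) v : V)
  left_inv v := mfderiv_openRetr_openIncl U x x v
  right_inv v := mfderiv_openIncl_openRetr U x x v

theorem openInclDeriv_symm (U : Opens M) (x₀ x : U) (v : TangentSpace I (x : M)) :
    (openInclDeriv I U x).symm v = (mfderiv I I (openRetr U x₀) (x : M) v : V) :=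
  (LinearEquiv.symm_apply_eq _).2 (mfderiv_openIncl_openRetr U x₀ x v).symm

theorem mvfderiv_restrict {U : Opens M} {x : U} {g : U → ℝ} {f : C^∞⟮I, M; ℝ⟯}
    (h : ∀ᶠ y : U in 𝓝 x, g y = f y) (v : TangentSpace I (x : M)) :
    mvfderiv I g x ((openInclDeriv I U x).symm v) = mvfderiv I f (x : M) v := by
  have h1 := ((openIncl I U).contMDiff.mdifferentiableAt (x := x) (by simp)).hasMFDerivAt
  have h2 : HasMFDerivAt I 𝓘(ℝ, ℝ) g x _ :=
    ((mdiffAt_map f (x : M)).hasMFDerivAt.comp x h1).congr_of_eventuallyEq h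
  have h3 := congrArg (fun L : TangentSpace I x →L[ℝ] ℝ ↦ L ((openInclDeriv I U x).symm v))
    h2.mfderiv
  refine h3.trans ?_
  exact congrArg (mvfderiv I f (x : M)) ((openInclDeriv I U x).apply_symm_apply v)

theorem contMDiff_totalSpace_restrict (U : Opens M) :
    ContMDiff (I.prod 𝓘(ℝ, F)) (I.prod 𝓘(ℝ, F)) ∞
      fun v : TotalSpace F (restrictBundle I E U) ↦ (⟨v.proj, v.snd⟩ : TotalSpace F E) := by
  intro v₀
  rw [Bundle.contMDiffAt_totalSpace]
  have h1 := (Bundle.contMDiffAt_totalSpace (IM := I.prod 𝓘(ℝ, F)) (IB := I) (n := ∞) (x₀ := v₀)).1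
    (contMDiffAt_id : ContMDiffAt (I.prod 𝓘(ℝ, F)) (I.prod 𝓘(ℝ, F)) ∞
      (id : TotalSpace F (restrictBundle I E U) → TotalSpace F (restrictBundle I E U)) v₀)
  exact ⟨(openIncl I U).contMDiff.contMDiffAt.comp v₀ h1.1, h1.2⟩

theorem exists_section_extension [T2Space M] {U : Opens M}
    (σ : Cₛ^∞⟮I; F, restrictBundle I E U⟯) (x : U) :
    ∃ τ : Cₛ^∞⟮I; F, E⟯, ∀ᶠ y : U in 𝓝 x, σ y = τ y := by
  classical
  let s (z : M) : E z := if h : z ∈ U then σ ⟨z, h⟩ else 0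
  have hs (y : U) : s y = σ y := dif_pos y.2
  have h1 : ContMDiffOn I (I.prod 𝓘(ℝ, F)) ∞ (fun z ↦ TotalSpace.mk' F z (s z)) U := by
    intro z hz
    refine ContMDiffAt.contMDiffWithinAt ?_
    refine (contMDiffAt_subtype_iff (U := U) (x := ⟨z, hz⟩)).1 ?_
    refine ((contMDiff_totalSpace_restrict U).comp σ.contMDiff).contMDiffAt.congr_of_eventuallyEq
      (Eventually.of_forall fun y ↦ ?_)
    exact congrArg (TotalSpace.mk' F (y : M)) (hs y)
  obtain ⟨τ, hτ, -⟩ := exists_section_eventuallyEq U.isOpen x.2 h1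
  exact ⟨τ, (eventually_coe.2 hτ).mono fun y hy ↦ (hs y).symm.trans hy.symm⟩

theorem exists_map_extension [T2Space M] {U : Opens M} (f : C^∞⟮I, U; ℝ⟯) (x : U) :
    ∃ g : C^∞⟮I, M; ℝ⟯, ∀ᶠ y : U in 𝓝 x, f y = g y := by
  obtain ⟨g, hg⟩ := exists_contMDiffMap_eventuallyEq (f := fun z ↦ f (openRetr U x z)) U.isOpen x.2
    (fun z hz ↦ (f.contMDiff.contMDiffAt.comp z
      (contMDiffAt_openRetr I U x ⟨z, hz⟩)).contMDiffWithinAt)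
  refine ⟨g, (eventually_coe.2 hg).mono fun y hy ↦ ?_⟩
  rw [hy, openRetr_coe]

namespace CourantAlgebroid

variable [T2Space M] [ContMDiffVectorBundle ∞ F E I] (A : CourantAlgebroid I F E) (U : Opens M)

/-- Brackets are local, so the value at a point does not depend on how the sections are extended.
The result is smooth because one pair of extensions computes it in a whole neighbourhood. -/
theorem exists_restrict_bracket (σ τ : Cₛ^∞⟮I; F, restrictBundle I E U⟯) :
    ∃ υ : Cₛ^∞⟮I; F, restrictBundle I E U⟯, ∀ (x : U) (σ' τ' : Cₛ^∞⟮I; F, E⟯),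
      (∀ᶠ y : U in 𝓝 x, σ y = σ' y) → (∀ᶠ y : U in 𝓝 x, τ y = τ' y) →
      υ x = A.bracket σ' τ' x := by
  choose s hs using exists_section_extension σ
  choose t ht using exists_section_extension τ
  have key (x : U) (σ' τ' : Cₛ^∞⟮I; F, E⟯) (h1 : ∀ᶠ y : U in 𝓝 x, σ y = σ' y)
      (h2 : ∀ᶠ y : U in 𝓝 x, τ y = τ' y) : A.bracket (s x) (t x) x = A.bracket σ' τ' x := by
    refine A.bracket_congr (eventually_coe.1 ?_) (eventually_coe.1 ?_)
    · filter_upwards [hs x, h1] with y h3 h4 using h3.symm.trans h4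
    · filter_upwards [ht x, h2] with y h3 h4 using h3.symm.trans h4
  refine ⟨⟨fun x ↦ A.bracket (s x) (t x) x, fun x ↦ ?_⟩, key⟩
  refine (pullbackSection (openIncl I U) (A.bracket (s x) (t x))).contMDiff.contMDiffAt.congr_of_eventuallyEq ?_
  filter_upwards [(hs x).eventually_nhds, (ht x).eventually_nhds] with y h1 h2
  exact congrArg (TotalSpace.mk' F y) (key y (s x) (t x) h1 h2)

/-- The inverse of the derivative of the inclusion is the derivative of `openRetr`, whose tangent
map is smooth over `U`. -/
theorem contMDiff_anchor_restrict : ContMDiff (I.prod 𝓘(ℝ, F)) I.tangent ∞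
    fun v : TotalSpace F (restrictBundle I E U) ↦
      (⟨v.proj, (openInclDeriv I U v.proj).symm (A.anchor v.proj v.snd)⟩ : TangentBundle I U) := by
  intro v₀
  let x₀ : U := v₀.proj
  have h1 : ContMDiffOn I.tangent I.tangent ∞ (tangentMapWithin I I (openRetr U x₀) U)
      (Bundle.TotalSpace.proj ⁻¹' (U : Set M)) :=
    ContMDiffOn.contMDiffOn_tangentMapWithin
      (fun z hz ↦ (contMDiffAt_openRetr I U x₀ ⟨z, hz⟩).contMDiffWithinAt) (m := ∞) (by simp)
      U.isOpen.uniqueMDiffOn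
  have h2 := h1.comp_contMDiff (A.anchor_smooth.comp (contMDiff_totalSpace_restrict U))
    fun v ↦ v.proj.2
  refine (h2 v₀).congr_of_eventuallyEq (Eventually.of_forall fun v ↦ ?_)
  have h3 : mfderivWithin I I (openRetr U x₀) U (v.proj : M)
      = mfderiv I I (openRetr U x₀) (v.proj : M) := mfderivWithin_of_isOpen U.isOpen v.proj.2
  have h4 := openInclDeriv_symm U x₀ v.proj (A.anchor v.proj v.snd)
  let w : V := mfderiv I I (openRetr U x₀) (v.proj : M) (A.anchor v.proj v.snd)
  have h5 : (⟨v.proj, (openInclDeriv I U v.proj).symm (A.anchor v.proj v.snd)⟩ : TangentBundle I U)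
      = ⟨v.proj, w⟩ := congrArg (fun u : V ↦ (⟨v.proj, u⟩ : TangentBundle I U)) h4
  have h6 : (⟨v.proj, w⟩ : TangentBundle I U) = ⟨openRetr U x₀ v.proj, w⟩ :=
    congrArg (fun z : U ↦ (⟨z, w⟩ : TangentBundle I U)) (openRetr_coe U x₀ v.proj).symm
  refine h5.trans (h6.trans ?_)
  exact congrArg (fun L : V →L[ℝ] V ↦
    (⟨openRetr U x₀ v.proj, L (A.anchor v.proj v.snd)⟩ : TangentBundle I U)) h3.symm

-- Each axiom at a point of `U` is the axiom of `A` for global sections and functions that agree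
-- with the given ones near that point.
set_option maxHeartbeats 2000000 in
theorem exists_isRestriction : ∃ B : CourantAlgebroid I F (restrictBundle I E U),
    IsRestriction A U B := by
  choose b hb using A.exists_restrict_bracket U
  have hbx (σ τ) (x : U) (s t : Cₛ^∞⟮I; F, E⟯) (hs : ∀ᶠ y : U in 𝓝 x, σ y = s y)
      (ht : ∀ᶠ y : U in 𝓝 x, τ y = t y) : ∀ᶠ y : U in 𝓝 x, b σ τ y = A.bracket s t y := by
    filter_upwards [hs.eventually_nhds, ht.eventually_nhds] with y h1 h2 using hb σ τ y s t h1 h2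
  have hadd (σ τ : Cₛ^∞⟮I; F, restrictBundle I E U⟯) (x : U) (s t : Cₛ^∞⟮I; F, E⟯)
      (hs : ∀ᶠ y : U in 𝓝 x, σ y = s y) (ht : ∀ᶠ y : U in 𝓝 x, τ y = t y) :
      ∀ᶠ y : U in 𝓝 x, (σ + τ) y = (s + t) y := by
    filter_upwards [hs, ht] with y h1 h2
    exact congrArg₂ (fun v w : E y ↦ v + w) h1 h2
  have hsmul (c : ℝ) (σ : Cₛ^∞⟮I; F, restrictBundle I E U⟯) (x : U) (s : Cₛ^∞⟮I; F, E⟯)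
      (hs : ∀ᶠ y : U in 𝓝 x, σ y = s y) : ∀ᶠ y : U in 𝓝 x, (c • σ) y = (c • s) y := by
    filter_upwards [hs] with y h1
    exact congrArg (fun v : E y ↦ c • v) h1
  have hpair (σ τ : Cₛ^∞⟮I; F, restrictBundle I E U⟯) (x : U) (s t : Cₛ^∞⟮I; F, E⟯)
      (hs : ∀ᶠ y : U in 𝓝 x, σ y = s y) (ht : ∀ᶠ y : U in 𝓝 x, τ y = t y) :
      ∀ᶠ y : U in 𝓝 x, A.pairing y (σ y) (τ y) = A.pair s t y := by
    filter_upwards [hs, ht] with y h1 h2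
    exact congrArg₂ (fun v w : E y ↦ A.pairing y v w) h1 h2
  refine ⟨{
    pairing := fun x ↦ A.pairing x
    pairing_smooth := fun σ τ x ↦ ?_
    pairing_symm := fun x ↦ A.pairing_symm x
    pairing_nondegenerate := fun x ↦ A.pairing_nondegenerate x
    anchor := fun x ↦ (openInclDeriv I U x).symm.toLinearMap ∘ₗ A.anchor x
    anchor_smooth := fun v₀ ↦ ?_
    bracket := LinearMap.mk₂ ℝ b ?_ ?_ ?_ ?_
    leibniz := ?_
    jacobi := ?_
    invariance := ?_
    symmetrization := ?_ }, ⟨fun x v w ↦ rfl, fun x v ↦ ?_, fun α β ↦ ?_⟩⟩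
  · obtain ⟨s, hs⟩ := exists_section_extension σ x
    obtain ⟨t, ht⟩ := exists_section_extension τ x
    exact ((A.pair s t).contMDiff.comp (openIncl I U).contMDiff).contMDiffAt.congr_of_eventuallyEq
      (hpair σ τ x s t hs ht)
  · exact A.contMDiff_anchor_restrict U v₀
  · intro σ σ' τ
    refine ContMDiffSection.ext fun x ↦ ?_
    obtain ⟨s, hs⟩ := exists_section_extension σ x
    obtain ⟨s', hs'⟩ := exists_section_extension σ' x
    obtain ⟨t, ht⟩ := exists_section_extension τ x
    rw [hb _ _ x _ _ (hadd _ _ x _ _ hs hs') ht, section_add_apply, hb _ _ x _ _ hs ht,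
      hb _ _ x _ _ hs' ht, map_add]
    rfl
  · intro c σ τ
    refine ContMDiffSection.ext fun x ↦ ?_
    obtain ⟨s, hs⟩ := exists_section_extension σ x
    obtain ⟨t, ht⟩ := exists_section_extension τ x
    rw [hb _ _ x _ _ (hsmul c _ x _ hs) ht, map_smul]
    exact congrArg (fun v : E x ↦ c • v) (hb _ _ x _ _ hs ht).symm
  · intro τ σ σ'
    refine ContMDiffSection.ext fun x ↦ ?_
    obtain ⟨s, hs⟩ := exists_section_extension σ x
    obtain ⟨s', hs'⟩ := exists_section_extension σ' x
    obtain ⟨t, ht⟩ := exists_section_extension τ x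
    rw [hb _ _ x _ _ ht (hadd _ _ x _ _ hs hs'), section_add_apply, hb _ _ x _ _ ht hs,
      hb _ _ x _ _ ht hs', map_add]
    rfl
  · intro c σ τ
    refine ContMDiffSection.ext fun x ↦ ?_
    obtain ⟨s, hs⟩ := exists_section_extension σ x
    obtain ⟨t, ht⟩ := exists_section_extension τ x
    rw [hb _ _ x _ _ hs (hsmul c _ x _ ht), map_smul]
    exact congrArg (fun v : E x ↦ c • v) (hb _ _ x _ _ hs ht).symm
  · intro σ τ f x
    obtain ⟨s, hs⟩ := exists_section_extension σ x
    obtain ⟨t, ht⟩ := exists_section_extension τ x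
    obtain ⟨g, hg⟩ := exists_map_extension f x
    have h1 : ∀ᶠ y : U in 𝓝 x, smulSection f τ y = (g • t) y := by
      filter_upwards [hg, ht] with y h1 h2
      exact congrArg₂ (fun (c : ℝ) (v : E y) ↦ c • v) h1 h2
    have h2 := A.leibniz s t g x
    have h3 : b σ (smulSection f τ) x = A.bracket s (g • t) x := hb _ _ x _ _ hs h1
    have h4 := mvfderiv_restrict hg (A.anchor x (σ x))
    have h5 : σ x = s x := hs.self_of_nhds
    have h6 : τ x = t x := ht.self_of_nhds
    refine h3.trans (h2.trans ?_)
    refine congrArg₂ (fun v w : E x ↦ v + w) (congrArg₂ (fun (c : ℝ) (v : E x) ↦ c • v)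
      hg.self_of_nhds.symm (hb _ _ x _ _ hs ht).symm)
      (congrArg₂ (fun (c : ℝ) (v : E x) ↦ c • v) (Eq.trans ?_ h4.symm) h6.symm)
    rw [h5]
  · intro α β γ
    refine ContMDiffSection.ext fun x ↦ ?_
    obtain ⟨s, hs⟩ := exists_section_extension α x
    obtain ⟨t, ht⟩ := exists_section_extension β x
    obtain ⟨u, hu⟩ := exists_section_extension γ x
    have h := congrArg (fun σ : Cₛ^∞⟮I; F, E⟯ ↦ σ x) (A.jacobi s t u)
    refine Eq.trans ?_ (h.trans (hb _ _ x _ _ hs (hbx _ _ x _ _ ht hu)).symm)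
    exact congrArg₂ (fun v w : E x ↦ v + w) (hb _ _ x _ _ (hbx _ _ x _ _ hs ht) hu)
      (hb _ _ x _ _ ht (hbx _ _ x _ _ hs hu))
  · intro α β γ x
    obtain ⟨s, hs⟩ := exists_section_extension α x
    obtain ⟨t, ht⟩ := exists_section_extension β x
    obtain ⟨u, hu⟩ := exists_section_extension γ x
    refine (mvfderiv_restrict (hpair _ _ x _ _ ht hu) (A.anchor x (α x))).trans ?_
    have h1 : α x = s x := hs.self_of_nhds
    have h2 : β x = t x := ht.self_of_nhds
    have h3 : γ x = u x := hu.self_of_nhds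
    have h := A.invariance s t u x
    rw [← h1, ← h2, ← h3, ← hb _ _ x _ _ hs ht, ← hb _ _ x _ _ hs hu] at h
    exact h
  · intro α β x e
    obtain ⟨s, hs⟩ := exists_section_extension α x
    obtain ⟨t, ht⟩ := exists_section_extension β x
    refine Eq.trans ?_ (mvfderiv_restrict (hpair _ _ x _ _ hs ht) (A.anchor x e)).symm
    have h := A.symmetrization s t x e
    rw [← hb _ _ x _ _ hs ht, ← hb _ _ x _ _ ht hs] at h
    exact h
  · exact (openInclDeriv I U x).apply_symm_apply _
  · exact ContMDiffSection.ext fun x ↦ hb _ _ x _ _ (Eventually.of_forall fun _ ↦ rfl)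
      (Eventually.of_forall fun _ ↦ rfl)

end CourantAlgebroid

end RestrictionConstruction

/-! ### Smoothness of linear combinations of a frame and of coefficients. -/

section GlobalFrames

variable {V H M : Type*} [NormedAddCommGroup V] [NormedSpace ℝ V]
  [TopologicalSpace H] {I : ModelWithCorners ℝ V H} [TopologicalSpace M] [ChartedSpace H M]
  {F : Type*} [NormedAddCommGroup F] [NormedSpace ℝ F]
  {E : M → Type*} [TopologicalSpace (TotalSpace F E)]
  [∀ x, AddCommGroup (E x)] [∀ x, Module ℝ (E x)] [∀ x, TopologicalSpace (E x)]
  [FiberBundle F E] [VectorBundle ℝ F E]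
  {V' H' M' : Type*} [NormedAddCommGroup V'] [NormedSpace ℝ V'] [TopologicalSpace H']
  {I' : ModelWithCorners ℝ V' H'} [TopologicalSpace M'] [ChartedSpace H' M']
  {ι : Type*} [Fintype ι] (s : ι → Cₛ^∞⟮I; F, E⟯)

theorem contMDiff_sum_smul {g : M' → M} (hg : ContMDiff I' I ∞ g) {c : M' → ι → ℝ}
    (hc : ContMDiff I' 𝓘(ℝ, ι → ℝ) ∞ c) :
    ContMDiff I' (I.prod 𝓘(ℝ, F)) ∞
      fun n ↦ (⟨g n, ∑ i, c n i • s i (g n)⟩ : TotalSpace F E) := by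
  intro n₀
  rw [Bundle.contMDiffAt_totalSpace]
  refine ⟨hg n₀, ?_⟩
  let e := trivializationAt F E (g n₀)
  have h1 (i : ι) : ContMDiffAt I' 𝓘(ℝ, F) ∞ (fun n ↦ (e ⟨g n, s i (g n)⟩).2) n₀ :=
    ((contMDiffAt_section (g n₀)).1 ((s i).contMDiff (g n₀))).comp n₀ (hg n₀)
  have h2 : ContMDiffAt I' 𝓘(ℝ, F) ∞ (fun n ↦ ∑ i, c n i • (e ⟨g n, s i (g n)⟩).2) n₀ :=
    ContMDiffAt.sum fun i _ ↦ ((contMDiff_pi_space.1 hc i) n₀).smul (h1 i)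
  refine h2.congr_of_eventuallyEq ?_
  filter_upwards [hg.continuous.continuousAt.eventually
    (e.open_baseSet.mem_nhds (mem_baseSet_trivializationAt F E (g n₀)))] with n hn
  have h3 (v : E (g n)) : (e ⟨g n, v⟩).2 = e.linearMapAt ℝ (g n) v := by
    rw [e.coe_linearMapAt_of_mem hn]
  simp only [h3]
  change (e ⟨g n, ∑ i, c n i • s i (g n)⟩).2 = _
  rw [h3, map_sum]
  exact Finset.sum_congr rfl fun i _ ↦ map_smul _ _ _

variable {s} in
/-- The coefficients with respect to a smooth frame are smooth on the total space. -/
theorem contMDiff_coeff {b : ∀ x, Module.Basis ι ℝ (E x)} (hb : ∀ i x, b x i = s i x) :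
    ContMDiff (I.prod 𝓘(ℝ, F)) 𝓘(ℝ, ι → ℝ) ∞
      fun v : TotalSpace F E ↦ (b v.proj).equivFun v.snd := by
  intro v₀
  let x₀ := v₀.proj
  let e := trivializationAt F E x₀
  -- `T x` is the matrix of the frame in the trivialization. It is smooth and invertible near `x₀`,
  -- and the coefficients arise by applying its inverse.
  let T : M → (ι → ℝ) →L[ℝ] F := fun x ↦
    ∑ i, (ContinuousLinearMap.proj (R := ℝ) (φ := fun _ : ι ↦ ℝ) i).smulRight (e ⟨x, s i x⟩).2
  have hT : ContMDiffAt I 𝓘(ℝ, (ι → ℝ) →L[ℝ] F) ∞ T x₀ := by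
    refine ContMDiffAt.sum fun i _ ↦ ?_
    exact (ContinuousLinearMap.smulRightL ℝ (ι → ℝ) F
      (ContinuousLinearMap.proj (R := ℝ) (φ := fun _ : ι ↦ ℝ) i)).contMDiff.contMDiffAt.comp x₀
      ((contMDiffAt_section x₀).1 ((s i).contMDiff x₀))
  have hx₀ : x₀ ∈ e.baseSet := mem_baseSet_trivializationAt F E x₀
  let φ (x : M) (hx : x ∈ e.baseSet) : (ι → ℝ) ≃ₗ[ℝ] F :=
    (b x).equivFun.symm ≪≫ₗ e.linearEquivAt ℝ x hx
  have hφT (x : M) (hx : x ∈ e.baseSet) (c : ι → ℝ) : φ x hx c = T x c := by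
    have h1 : φ x hx c = ∑ i, c i • (e.linearEquivAt ℝ x hx) (s i x) := by
      change e.linearEquivAt ℝ x hx ((b x).equivFun.symm c) = _
      rw [Module.Basis.equivFun_symm_apply, map_sum]
      exact Finset.sum_congr rfl fun i _ ↦ by rw [map_smul, hb]
    rw [h1]
    simp [T]
  let Φ (x : M) (hx : x ∈ e.baseSet) : (ι → ℝ) ≃L[ℝ] F :=
    { φ x hx with
      continuous_toFun := by
        change Continuous fun c ↦ φ x hx c
        simp only [hφT]
        exact (T x).continuous
      continuous_invFun := by
        have : FiniteDimensional ℝ F := (φ x hx).finiteDimensional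
        exact (φ x hx).symm.toLinearMap.continuous_of_finiteDimensional }
  have hΦ (x : M) (hx : x ∈ e.baseSet) : (Φ x hx : (ι → ℝ) →L[ℝ] F) = T x :=
    ContinuousLinearMap.ext fun c ↦ hφT x hx c
  have hTi : ContMDiffAt I 𝓘(ℝ, F →L[ℝ] (ι → ℝ)) ∞ (fun x ↦ (T x).inverse) x₀ := by
    have h1 : ContDiffAt ℝ ∞ ContinuousLinearMap.inverse (T x₀) := by
      rw [← hΦ x₀ hx₀]
      exact contDiffAt_map_inverse _
    exact h1.contMDiffAt.comp x₀ hT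
  have h1 := (Bundle.contMDiffAt_totalSpace (IM := I.prod 𝓘(ℝ, F)) (IB := I) (n := ∞) (x₀ := v₀)).1
    (contMDiffAt_id : ContMDiffAt (I.prod 𝓘(ℝ, F)) (I.prod 𝓘(ℝ, F)) ∞
      (id : TotalSpace F E → TotalSpace F E) v₀)
  have h2 : ContMDiffAt (I.prod 𝓘(ℝ, F)) 𝓘(ℝ, ι → ℝ) ∞
      (fun v : TotalSpace F E ↦ (T v.proj).inverse (e v).2) v₀ :=
    (hTi.comp v₀ h1.1).clm_apply h1.2
  refine h2.congr_of_eventuallyEq ?_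
  filter_upwards [h1.1.continuousAt.eventually (e.open_baseSet.mem_nhds hx₀)] with v hv
  have hv : v.proj ∈ e.baseSet := hv
  rw [← hΦ _ hv, ContinuousLinearMap.inverse_equiv]
  refine ((Φ v.proj hv).symm_apply_eq.2 ?_).symm
  change _ = e.linearEquivAt ℝ v.proj hv ((b v.proj).equivFun.symm ((b v.proj).equivFun v.snd))
  rw [LinearEquiv.symm_apply_apply]
  rfl

end GlobalFrames

/-! ### Transport of a Courant algebroid along a bijection of frames. -/

section Transport

variable {V₁ H₁ M₁ : Type*} [NormedAddCommGroup V₁] [NormedSpace ℝ V₁] [TopologicalSpace H₁]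
  {I₁ : ModelWithCorners ℝ V₁ H₁} [TopologicalSpace M₁] [ChartedSpace H₁ M₁]
  [IsManifold I₁ ∞ M₁]
  {F₁ : Type*} [NormedAddCommGroup F₁] [NormedSpace ℝ F₁]
  {E₁ : M₁ → Type*} [TopologicalSpace (TotalSpace F₁ E₁)]
  [∀ x, AddCommGroup (E₁ x)] [∀ x, Module ℝ (E₁ x)] [∀ x, TopologicalSpace (E₁ x)]
  [FiberBundle F₁ E₁] [VectorBundle ℝ F₁ E₁]
  {V₂ H₂ M₂ : Type*} [NormedAddCommGroup V₂] [NormedSpace ℝ V₂] [TopologicalSpace H₂]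
  {I₂ : ModelWithCorners ℝ V₂ H₂} [TopologicalSpace M₂] [ChartedSpace H₂ M₂]
  [IsManifold I₂ ∞ M₂]
  {F₂ : Type*} [NormedAddCommGroup F₂] [NormedSpace ℝ F₂]
  {E₂ : M₂ → Type*} [TopologicalSpace (TotalSpace F₂ E₂)]
  [∀ x, AddCommGroup (E₂ x)] [∀ x, Module ℝ (E₂ x)] [∀ x, TopologicalSpace (E₂ x)]
  [FiberBundle F₂ E₂] [VectorBundle ℝ F₂ E₂]
  {ι : Type*} [Fintype ι]

set_option maxHeartbeats 2000000 in
/-- A Courant algebroid can be transported along a diffeomorphism of the bases and a bijection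
between global frames. -/
theorem CourantAlgebroid.exists_courantIso (A : CourantAlgebroid I₁ F₁ E₁)
    (φ : M₁ ≃ₘ^∞⟮I₁, I₂⟯ M₂) (s₁ : ι → Cₛ^∞⟮I₁; F₁, E₁⟯) (s₂ : ι → Cₛ^∞⟮I₂; F₂, E₂⟯)
    (b₁ : ∀ x, Module.Basis ι ℝ (E₁ x)) (b₂ : ∀ x, Module.Basis ι ℝ (E₂ x))
    (hb₁ : ∀ i x, b₁ x i = s₁ i x) (hb₂ : ∀ i x, b₂ x i = s₂ i x) :
    ∃ (C : CourantAlgebroid I₂ F₂ E₂) (Φ : CourantIso A C), Φ.base = φ ∧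
      ∀ i x, Φ.fiber x (s₁ i x) = s₂ i (Φ.base x) := by
  let f (x : M₁) : E₁ x ≃ₗ[ℝ] E₂ (φ x) := (b₁ x).equivFun ≪≫ₗ (b₂ (φ x)).equivFun.symm
  -- The inverse of `f`, written over `φ.symm y` so that it is defined on `E₂ y` itself; this avoids
  -- a cast along `φ (φ.symm y) = y`. The two agree as points of the total space by `hkf`.
  let k (y : M₂) : E₂ y ≃ₗ[ℝ] E₁ (φ.symm y) := (b₂ y).equivFun ≪≫ₗ (b₁ (φ.symm y)).equivFun.symm
  have hf (x : M₁) (v : E₁ x) : f x v = ∑ i, (b₁ x).equivFun v i • s₂ i (φ x) := by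
    simp only [f, LinearEquiv.trans_apply, Module.Basis.equivFun_symm_apply, hb₂]
  have hfs (x : M₁) (v : E₂ (φ x)) : (f x).symm v = ∑ i, (b₂ (φ x)).equivFun v i • s₁ i x := by
    simp only [f, LinearEquiv.trans_symm, LinearEquiv.symm_symm, LinearEquiv.trans_apply,
      Module.Basis.equivFun_symm_apply, hb₁]
  have hk (y : M₂) (v : E₂ y) : k y v = ∑ i, (b₂ y).equivFun v i • s₁ i (φ.symm y) := by
    simp only [k, LinearEquiv.trans_apply, Module.Basis.equivFun_symm_apply, hb₁]
  have hkf (x : M₁) (v : E₂ (φ x)) :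
      (⟨φ.symm (φ x), k (φ x) v⟩ : TotalSpace F₁ E₁) = ⟨x, (f x).symm v⟩ := by
    rw [hk, hfs]
    exact congrArg (fun z ↦ (⟨z, ∑ i, (b₂ (φ x)).equivFun v i • s₁ i z⟩ : TotalSpace F₁ E₁))
      (φ.symm_apply_apply x)
  have hP (x : M₁) (v w : E₂ (φ x)) : A.pairing x ((f x).symm v) ((f x).symm w)
      = A.pairing (φ.symm (φ x)) (k (φ x) v) (k (φ x) w) := by
    rw [hk, hk, hfs, hfs]
    exact (congrArg (fun z ↦ A.pairing z (∑ i, (b₂ (φ x)).equivFun v i • s₁ i z)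
      (∑ i, (b₂ (φ x)).equivFun w i • s₁ i z)) (φ.symm_apply_apply x)).symm
  have ha (x : M₁) (v : E₂ (φ x)) : (mfderiv I₁ I₂ φ x (A.anchor x ((f x).symm v)) : V₂)
      = mfderiv I₁ I₂ φ (φ.symm (φ x)) (A.anchor (φ.symm (φ x)) (k (φ x) v)) :=
    (congrArg (fun t : TotalSpace F₁ E₁ ↦ (mfderiv I₁ I₂ φ t.proj (A.anchor t.proj t.snd) : V₂))
      (hkf x v)).symm
  have htot : ContMDiff (I₁.prod 𝓘(ℝ, F₁)) (I₂.prod 𝓘(ℝ, F₂)) ∞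
      fun v : TotalSpace F₁ E₁ ↦ (⟨φ v.proj, f v.proj v.snd⟩ : TotalSpace F₂ E₂) := by
    refine (contMDiff_sum_smul s₂ (φ.contMDiff.comp (Bundle.contMDiff_proj E₁))
      (contMDiff_coeff hb₁)).congr fun v ↦ ?_
    rw [hf]
    rfl
  have htoti : ContMDiff (I₂.prod 𝓘(ℝ, F₂)) (I₁.prod 𝓘(ℝ, F₁)) ∞
      fun v : TotalSpace F₂ E₂ ↦ (⟨φ.symm v.proj, k v.proj v.snd⟩ : TotalSpace F₁ E₁) := by
    refine (contMDiff_sum_smul s₁ (φ.symm.contMDiff.comp (Bundle.contMDiff_proj E₂))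
      (contMDiff_coeff hb₂)).congr fun v ↦ ?_
    rw [hk]
    rfl
  let J (σ : Cₛ^∞⟮I₂; F₂, E₂⟯) : Cₛ^∞⟮I₁; F₁, E₁⟯ := ⟨fun x ↦ (f x).symm (σ (φ x)), by
    refine (contMDiff_sum_smul s₁ contMDiff_id
      (((contMDiff_coeff hb₂).comp σ.contMDiff).comp φ.contMDiff)).congr fun x ↦ ?_
    rw [hfs]
    rfl⟩
  have hJsurj (τ : Cₛ^∞⟮I₁; F₁, E₁⟯) : ∃ σ, τ = J σ := by
    refine ⟨⟨fun y ↦ ∑ i, (b₁ (φ.symm y)).equivFun (τ (φ.symm y)) i • s₂ i y,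
      contMDiff_sum_smul s₂ contMDiff_id
      (((contMDiff_coeff hb₁).comp τ.contMDiff).comp φ.symm.contMDiff)⟩,
      ContMDiffSection.ext fun x ↦ ?_⟩
    refine ((f x).symm_apply_eq.2 ?_).symm
    rw [hf]
    exact congrArg (fun z ↦ ∑ i, (b₁ z).equivFun (τ z) i • s₂ i (φ x)) (φ.symm_apply_apply x)
  obtain ⟨C, hCp, hCa, hCb⟩ := A.exists_descent (E' := E₂) (F' := F₂) (I' := I₂)
    ⟨φ, φ.contMDiff⟩ ⟨φ.symm, φ.symm.contMDiff⟩ φ.apply_symm_apply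
    (fun x ↦ (f x).symm.toLinearMap) (fun x ↦ (f x).symm.injective) J (fun σ x ↦ rfl)
    (fun y ↦ (A.pairing (φ.symm y)).compl₁₂ (k y).toLinearMap (k y).toLinearMap)
    hP
    (fun y v hv ↦ by
      refine (k y).injective ?_
      rw [map_zero]
      refine A.pairing_nondegenerate _ _ fun w ↦ ?_
      obtain ⟨w, rfl⟩ := (k y).surjective w
      exact hv w)
    (fun y ↦ ((mfderiv I₁ I₂ φ (φ.symm y)).toLinearMap ∘ₗ A.anchor (φ.symm y) ∘ₗ
      (k y).toLinearMap : E₂ y →ₗ[ℝ] V₂))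
    ha
    (((φ.contMDiff.contMDiff_tangentMap (m := ∞) (by simp)).comp
      (A.anchor_smooth.comp htoti)).congr fun v ↦
        (congrArg (fun y ↦ (⟨y, (mfderiv I₁ I₂ φ (φ.symm v.proj)
          (A.anchor (φ.symm v.proj) (k v.proj v.snd)) : V₂)⟩ : TangentBundle I₂ M₂))
          (φ.apply_symm_apply v.proj)).symm)
    (fun σ τ ↦ hJsurj _)
  have hCpx (x : M₁) (v w : E₁ x) : C.pairing (φ x) (f x v) (f x w) = A.pairing x v w := by
    rw [hCp]
    refine (hP x (f x v) (f x w)).symm.trans ?_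
    rw [LinearEquiv.symm_apply_apply, LinearEquiv.symm_apply_apply]
  refine ⟨C, {
    base := φ
    fiber := f
    total := {
      toFun := fun v ↦ ⟨φ v.proj, f v.proj v.snd⟩
      invFun := fun v ↦ ⟨φ.symm v.proj, k v.proj v.snd⟩
      left_inv := fun v ↦ ?_
      right_inv := fun v ↦ ?_
      contMDiff_toFun := htot
      contMDiff_invFun := htoti }
    total_mk := fun x v ↦ rfl
    map_pairing := hCpx
    map_anchor := fun x v ↦ ?_
    map_bracket := fun α β α' β' hα hβ x ↦ ?_ }, rfl, fun i x ↦ ?_⟩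
  · refine (hkf v.proj (f v.proj v.snd)).trans ?_
    rw [LinearEquiv.symm_apply_apply]
  · change (⟨φ (φ.symm v.proj), f (φ.symm v.proj) (k v.proj v.snd)⟩ : TotalSpace F₂ E₂) = v
    have h1 : f (φ.symm v.proj) (k v.proj v.snd)
        = ∑ i, (b₂ v.proj).equivFun v.snd i • s₂ i (φ (φ.symm v.proj)) := by
      simp only [f, k, LinearEquiv.trans_apply]
      rw [LinearEquiv.apply_symm_apply, Module.Basis.equivFun_symm_apply]
      simp only [hb₂]
    rw [h1]
    refine (congrArg (fun y ↦ (⟨y, ∑ i, (b₂ v.proj).equivFun v.snd i • s₂ i y⟩ :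
      TotalSpace F₂ E₂)) (φ.apply_symm_apply v.proj)).trans ?_
    simp only [← hb₂]
    rw [Module.Basis.sum_equivFun]
  · rw [hCa]
    refine (ha x (f x v)).symm.trans ?_
    rw [LinearEquiv.symm_apply_apply]
  · have hα' : J α' = α := ContMDiffSection.ext fun x ↦ (f x).symm_apply_eq.2 (hα x)
    have hβ' : J β' = β := ContMDiffSection.ext fun x ↦ (f x).symm_apply_eq.2 (hβ x)
    have h := hCb α' β'
    rw [hα', hβ'] at h
    have h1 : (f x).symm (C.bracket α' β' (φ x)) = A.bracket α β x :=
      congrArg (fun σ : Cₛ^∞⟮I₁; F₁, E₁⟯ ↦ σ x) h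
    exact (f x).symm_apply_eq.1 h1
  · rw [← hb₁, ← hb₂]
    simp only [f, LinearEquiv.trans_apply]
    rw [LinearEquiv.symm_apply_eq]
    ext j
    simp

end Transport

/-! ### Vector fields and forms on open subsets of a vector space. -/

section OpenSubsets

variable {V : Type*} [NormedAddCommGroup V] [NormedSpace ℝ V] {U : Opens V}

/-- All points of `U` share one chart, so the coordinate change is trivial. This allows vector
fields on `U` to be handled as maps to `V`. -/
theorem trivializationAt_tangent_snd (x y : U) (v : V) :
    (trivializationAt V (TangentSpace 𝓘(ℝ, V)) x (⟨y, v⟩ : TangentBundle 𝓘(ℝ, V) U)).2 = v :=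
  tangentCoordChange_self (I := 𝓘(ℝ, V)) (x := x) (z := y) (by
    rw [extChartAt_source]
    exact mem_chart_source V y)

theorem trivializationAt_genTangent_snd (x y : U) (w : V × (V →L[ℝ] ℝ)) :
    (trivializationAt (V × (V →L[ℝ] ℝ)) (GenTangent 𝓘(ℝ, V) U) x ⟨y, w⟩).2 = w := by
  have hy : y ∈ (chartAt V x).source := mem_chart_source V y
  refine Prod.ext (trivializationAt_tangent_snd x y w.1) ?_
  change (trivializationAt (V →L[ℝ] ℝ) (fun x : U ↦ TangentSpace 𝓘(ℝ, V) x →L[ℝ] ℝ) x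
    ⟨y, w.2⟩).2 = w.2
  rw [hom_trivializationAt_apply]
  refine ContinuousLinearMap.ext fun v ↦ ?_
  have h1 : (trivializationAt V (TangentSpace 𝓘(ℝ, V)) x).symmL ℝ y v = v := by
    rw [TangentBundle.symmL_trivializationAt_eq_core hy]
    exact (tangentBundleCore 𝓘(ℝ, V) U).coordChange_self (achart V x) y hy v
  refine Eq.trans ?_ (congrArg w.2 h1)
  exact congrArg (fun L : ℝ →L[ℝ] ℝ ↦ L (w.2 ((trivializationAt V (TangentSpace 𝓘(ℝ, V)) x).symmL ℝ y v)))
    (Trivial.continuousLinearMapAt_trivialization ℝ U ℝ y)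

theorem contMDiff_tangent_coe (Z : Cₛ^∞⟮𝓘(ℝ, V); V, (TangentSpace 𝓘(ℝ, V) : U → Type _)⟯) :
    ContMDiff 𝓘(ℝ, V) 𝓘(ℝ, V) ∞ fun x ↦ (Z x : V) := fun x ↦
  ((contMDiffAt_section x).1 (Z.contMDiff x)).congr_of_eventuallyEq
    (Eventually.of_forall fun y ↦ (trivializationAt_tangent_snd x y (Z y)).symm)

theorem contMDiff_genTangent_coe
    (s : Cₛ^∞⟮𝓘(ℝ, V); V × (V →L[ℝ] ℝ), GenTangent 𝓘(ℝ, V) U⟯) :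
    ContMDiff 𝓘(ℝ, V) 𝓘(ℝ, V × (V →L[ℝ] ℝ)) ∞
      (fun x ↦ id (α := V × (V →L[ℝ] ℝ)) (s x)) := fun x ↦
  ((contMDiffAt_section x).1 (s.contMDiff x)).congr_of_eventuallyEq
    (Eventually.of_forall fun y ↦ (trivializationAt_genTangent_snd x y (s y)).symm)

/-- A smooth map to `V`, as a vector field. -/
def vectorField (X : U → V) (hX : ContMDiff 𝓘(ℝ, V) 𝓘(ℝ, V) ∞ X) :
    Cₛ^∞⟮𝓘(ℝ, V); V, (TangentSpace 𝓘(ℝ, V) : U → Type _)⟯ :=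
  ⟨X, fun x ↦ (contMDiffAt_section x).2 (hX.contMDiffAt.congr_of_eventuallyEq
    (Eventually.of_forall fun y ↦ trivializationAt_tangent_snd x y (X y)))⟩

/-- A smooth map to `V × V^*`, as a section of the generalized tangent bundle. -/
def genVectorField (w : U → V × (V →L[ℝ] ℝ))
    (hw : ContMDiff 𝓘(ℝ, V) 𝓘(ℝ, V × (V →L[ℝ] ℝ)) ∞ w) :
    Cₛ^∞⟮𝓘(ℝ, V); V × (V →L[ℝ] ℝ), GenTangent 𝓘(ℝ, V) U⟯ :=
  ⟨w, fun x ↦ (contMDiffAt_section x).2 (hw.contMDiffAt.congr_of_eventuallyEq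
    (Eventually.of_forall fun y ↦ trivializationAt_genTangent_snd x y (w y)))⟩

variable (U) in
/-- The section of the generalized tangent bundle with constant value. -/
def constSection (w : V × (V →L[ℝ] ℝ)) :
    Cₛ^∞⟮𝓘(ℝ, V); V × (V →L[ℝ] ℝ), GenTangent 𝓘(ℝ, V) U⟯ :=
  genVectorField (fun _ ↦ w) contMDiff_const

theorem mfderiv_openIncl (x : U) :
    (mfderiv 𝓘(ℝ, V) 𝓘(ℝ, V) (openIncl 𝓘(ℝ, V) U) x : V →L[ℝ] V)
      = ContinuousLinearMap.id ℝ V := by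
  have h : HasMFDerivAt 𝓘(ℝ, V) 𝓘(ℝ, V) (openIncl 𝓘(ℝ, V) U) x (ContinuousLinearMap.id ℝ V) := by
    refine ⟨(openIncl 𝓘(ℝ, V) U).contMDiff.continuous.continuousAt, ?_⟩
    refine (hasFDerivWithinAt_id _ _).congr_of_eventuallyEq ?_ ?_
    · refine mem_nhdsWithin_of_mem_nhds ?_
      filter_upwards [(chartAt V x).open_target.mem_nhds (mem_chart_target V x)] with z hz
      exact (chartAt V x).right_inv hz
    · exact (chartAt V x).right_inv (mem_chart_target V x)
  exact h.mfderiv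

/-- The restriction of a linear function. -/
def linearCoord (l : V →L[ℝ] ℝ) : C^∞⟮𝓘(ℝ, V), U; ℝ⟯ :=
  ⟨fun x ↦ l x, l.contMDiff.comp contMDiff_subtype_val⟩

theorem mvfderiv_comp_coe {G : Type*} [NormedAddCommGroup G] [NormedSpace ℝ G] {f : V → G} {x : U}
    (hf : DifferentiableAt ℝ f x) {g : U → G} (hg : ∀ᶠ y in 𝓝 x, g y = f y) (v : V) :
    (mfderiv 𝓘(ℝ, V) 𝓘(ℝ, G) g x : V →L[ℝ] G) v = fderiv ℝ f x v := by
  have h1 := ((openIncl 𝓘(ℝ, V) U).contMDiff.mdifferentiableAt (x := x) (by simp)).hasMFDerivAt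
  have h2 : HasMFDerivAt 𝓘(ℝ, V) 𝓘(ℝ, G) g x _ :=
    ((hf.hasFDerivAt.hasMFDerivAt.comp x h1).congr_of_eventuallyEq hg)
  refine (congrArg (fun L : V →L[ℝ] G ↦ L v) h2.mfderiv).trans ?_
  exact congrArg (fun L : V →L[ℝ] V ↦ fderiv ℝ f x (L v)) (mfderiv_openIncl x)

theorem mvfderiv_linearCoord (l : V →L[ℝ] ℝ) (x : U) (v : V) :
    mvfderiv 𝓘(ℝ, V) (linearCoord l : C^∞⟮𝓘(ℝ, V), U; ℝ⟯) x v = l v :=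
  (mvfderiv_comp_coe (f := l) l.differentiableAt (Eventually.of_forall fun _ ↦ rfl) v).trans
    (by rw [l.fderiv])

/-- The bracket on `U` is the pullback under the inclusion of the bracket of extensions to `V`, and
there it is the commutator formula `DY X - DX Y`. The extensions along `openRetr` need to be smooth
only at `x`. -/
theorem apply_mlieBracket [FiniteDimensional ℝ V] (l : V →L[ℝ] ℝ) {X Y : ∀ x : U, TangentSpace 𝓘(ℝ, V) x}
    (hX : ContMDiff 𝓘(ℝ, V) 𝓘(ℝ, V) ∞ fun x ↦ (X x : V))
    (hY : ContMDiff 𝓘(ℝ, V) 𝓘(ℝ, V) ∞ fun x ↦ (Y x : V)) (x : U) :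
    l (VectorField.mlieBracket 𝓘(ℝ, V) X Y x : V)
      = mvfderiv 𝓘(ℝ, V) (fun y ↦ l (Y y : V)) x (X x)
        - mvfderiv 𝓘(ℝ, V) (fun y ↦ l (X y : V)) x (Y x) := by
  let X' (z : V) : V := X (openRetr U x z)
  let Y' (z : V) : V := Y (openRetr U x z)
  have hX' : ContDiffAt ℝ ∞ X' (x : V) :=
    (hX.contMDiffAt.comp (x : V) (contMDiffAt_openRetr 𝓘(ℝ, V) U x x)).contDiffAt
  have hY' : ContDiffAt ℝ ∞ Y' (x : V) :=
    (hY.contMDiffAt.comp (x : V) (contMDiffAt_openRetr 𝓘(ℝ, V) U x x)).contDiffAt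
  have hXX (y : U) : X y = X' y := congrArg (fun z : U ↦ (X z : V)) (openRetr_coe U x y).symm
  have hYY (y : U) : Y y = Y' y := congrArg (fun z : U ↦ (Y z : V)) (openRetr_coe U x y).symm
  have hpull (Z : V → V) (y : U) :
      VectorField.mpullback 𝓘(ℝ, V) 𝓘(ℝ, V) (openIncl 𝓘(ℝ, V) U) Z y = Z y := by
    have h : (ContinuousLinearMap.inverse
        (mfderiv 𝓘(ℝ, V) 𝓘(ℝ, V) (openIncl 𝓘(ℝ, V) U) y : V →L[ℝ] V)) = .id ℝ V := by
      exact (congrArg (fun L : V →L[ℝ] V ↦ L.inverse) (mfderiv_openIncl y)).trans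
        ContinuousLinearMap.inverse_id
    exact (VectorField.mpullback_apply ..).trans (congrArg (fun L : V →L[ℝ] V ↦ L (Z y)) h)
  have h1 := VectorField.mpullback_mlieBracket (I := 𝓘(ℝ, V)) (I' := 𝓘(ℝ, V)) (n := ∞)
    (f := openIncl 𝓘(ℝ, V) U) (V := X') (W := Y') (x₀ := x)
    ((contMDiffAt_vectorSpace_iff_contDiffAt.2 hX').mdifferentiableAt (by simp))
    ((contMDiffAt_vectorSpace_iff_contDiffAt.2 hY').mdifferentiableAt (by simp))
    (openIncl 𝓘(ℝ, V) U).contMDiff.contMDiffAt (by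
      simp only [minSmoothness_of_isRCLikeNormedField]
      exact WithTop.coe_le_coe.2 (le_top : (2 : ℕ∞) ≤ ⊤))
  have h2 : VectorField.mpullback 𝓘(ℝ, V) 𝓘(ℝ, V) (openIncl 𝓘(ℝ, V) U) X' = X :=
    funext fun y ↦ (hpull X' y).trans (hXX y).symm
  have h3 : VectorField.mpullback 𝓘(ℝ, V) 𝓘(ℝ, V) (openIncl 𝓘(ℝ, V) U) Y' = Y :=
    funext fun y ↦ (hpull Y' y).trans (hYY y).symm
  rw [h2, h3] at h1
  have h4 : VectorField.mlieBracket 𝓘(ℝ, V) X Y x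
      = fderiv ℝ Y' x (X' x) - fderiv ℝ X' x (Y' x) := by
    refine h1.symm.trans ((hpull _ x).trans ?_)
    refine (congrFun VectorField.mlieBracketWithin_univ _).symm.trans ?_
    refine (congrFun VectorField.mlieBracketWithin_eq_lieBracketWithin _).trans ?_
    exact congrFun (VectorField.lieBracketWithin_univ (𝕜 := ℝ) (E := V) (V := X') (W := Y')) _
  have h5 (Z' : V → V) (hZ : ContDiffAt ℝ ∞ Z' (x : V)) {Z : U → V} (hZZ : ∀ y, Z y = Z' y) (v : V) :
      mvfderiv 𝓘(ℝ, V) (fun y ↦ l (Z y)) x v = l (fderiv ℝ Z' x v) := by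
    have hd := hZ.differentiableAt (by simp)
    refine (mvfderiv_comp_coe (f := fun z ↦ l (Z' z)) (l.differentiableAt.comp _ hd)
      (Eventually.of_forall fun y ↦ congrArg l (hZZ y)) v).trans ?_
    exact congrArg (fun L : V →L[ℝ] ℝ ↦ L v) (l.hasFDerivAt.comp (x : V) hd.hasFDerivAt).fderiv
  refine (congrArg l h4).trans ((map_sub l _ _).trans ?_)
  exact congrArg₂ (· - ·) ((congrArg (fun v ↦ l (fderiv ℝ Y' x v)) (hXX x).symm).trans
    (h5 Y' hY' hYY (X x)).symm)
    ((congrArg (fun v ↦ l (fderiv ℝ X' x v)) (hYY x).symm).trans (h5 X' hX' hXX (Y x)).symm)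

end OpenSubsets

/-! ### Isotropic commuting families. -/

section IsotropicFrame

variable {V H M : Type*} [NormedAddCommGroup V] [NormedSpace ℝ V]
  [TopologicalSpace H] {I : ModelWithCorners ℝ V H} [TopologicalSpace M] [ChartedSpace H M]
  {F : Type*} [NormedAddCommGroup F] [NormedSpace ℝ F]
  {E : M → Type*} [TopologicalSpace (TotalSpace F E)]
  [∀ x, AddCommGroup (E x)] [∀ x, Module ℝ (E x)] [∀ x, TopologicalSpace (E x)]
  [FiberBundle F E] [VectorBundle ℝ F E] [IsManifold I ∞ M]

/-- Sections with vanishing pairings and brackets span an isotropic subbundle that is closed under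
the bracket up to sections orthogonal to it. -/
theorem CourantAlgebroid.pair_bracket_sum_eq_zero (A : CourantAlgebroid I F E) {ι : Type*}
    (s : Finset ι) {c : ι → Cₛ^∞⟮I; F, E⟯} (h : ∀ i j, A.pair (c i) (c j) = 0)
    (hb : ∀ i j, A.bracket (c i) (c j) = 0) (f g k : ι → C^∞⟮I, M; ℝ⟯) :
    A.pair (A.bracket (∑ i ∈ s, f i • c i) (∑ i ∈ s, g i • c i)) (∑ i ∈ s, k i • c i) = 0 := by
  rw [map_sum, A.pair_sum_left]
  refine Finset.sum_eq_zero fun j _ ↦ ?_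
  rw [map_sum, LinearMap.sum_apply, A.pair_sum_left]
  refine Finset.sum_eq_zero fun i _ ↦ ?_
  rw [A.pair_sum_right]
  refine Finset.sum_eq_zero fun l _ ↦ ?_
  -- After expansion every term contains a bracket `[c i, c j]` or a pairing of two of the `c i`.
  rw [A.bracket_smul_right, A.pair_add_left, A.pair_smul_left, A.pair_smul_left,
    A.pair_bracket_smul_left, hb]
  simp only [A.pair_smul_right, h, A.pair_zero_left, mul_zero, zero_mul, sub_zero, add_zero]

end IsotropicFrame

/-! ### Characterisation of the standard Courant algebroid. -/

section Standard

variable {V : Type*} [NormedAddCommGroup V] [NormedSpace ℝ V] [FiniteDimensional ℝ V]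
  {U : Opens V}

/-- The vector field underlying a section of the generalized tangent bundle. -/
def GenTangent.fst (s : Cₛ^∞⟮𝓘(ℝ, V); V × (V →L[ℝ] ℝ), GenTangent 𝓘(ℝ, V) U⟯) :
    Cₛ^∞⟮𝓘(ℝ, V); V, (TangentSpace 𝓘(ℝ, V) : U → Type _)⟯ :=
  vectorField (fun x ↦ (id (α := V × (V →L[ℝ] ℝ)) (s x)).1)
    ((ContinuousLinearMap.fst ℝ V (V →L[ℝ] ℝ)).contMDiff.comp (contMDiff_genTangent_coe s))

/-- The one-form underlying a section of the generalized tangent bundle. -/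
def GenTangent.snd (s : Cₛ^∞⟮𝓘(ℝ, V); V × (V →L[ℝ] ℝ), GenTangent 𝓘(ℝ, V) U⟯) :
    Cₛ^∞⟮𝓘(ℝ, V); V × (V →L[ℝ] ℝ), GenTangent 𝓘(ℝ, V) U⟯ :=
  genVectorField (fun x ↦ (0, (id (α := V × (V →L[ℝ] ℝ)) (s x)).2))
    (contMDiff_const.prodMk_space ((ContinuousLinearMap.snd ℝ V (V →L[ℝ] ℝ)).contMDiff.comp
      (contMDiff_genTangent_coe s)))

/-- A vector field, as a section of the generalized tangent bundle. -/
def GenTangent.inl (Z : Cₛ^∞⟮𝓘(ℝ, V); V, (TangentSpace 𝓘(ℝ, V) : U → Type _)⟯) :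
    Cₛ^∞⟮𝓘(ℝ, V); V × (V →L[ℝ] ℝ), GenTangent 𝓘(ℝ, V) U⟯ :=
  genVectorField (fun x ↦ (Z x, 0)) ((contMDiff_tangent_coe Z).prodMk_space contMDiff_const)

theorem GenTangent.inl_fst_add_snd
    (s : Cₛ^∞⟮𝓘(ℝ, V); V × (V →L[ℝ] ℝ), GenTangent 𝓘(ℝ, V) U⟯) :
    GenTangent.inl (GenTangent.fst s) + GenTangent.snd s = s :=
  ContMDiffSection.ext fun x ↦ Prod.ext (add_zero (M := V) (s x).1) (zero_add (M := V →L[ℝ] ℝ) (s x).2)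

theorem GenTangent.inl_eq_sum {ι : Type*} [Fintype ι] (b : Module.Basis ι ℝ V)
    (Z : Cₛ^∞⟮𝓘(ℝ, V); V, (TangentSpace 𝓘(ℝ, V) : U → Type _)⟯) :
    ∃ f : ι → C^∞⟮𝓘(ℝ, V), U; ℝ⟯,
      GenTangent.inl Z = ∑ i, f i • constSection U (b i, 0) := by
  refine ⟨fun i ↦ ⟨fun x ↦ b.coord i (Z x),
    (b.coord i).toContinuousLinearMap.contMDiff.comp (contMDiff_tangent_coe Z)⟩,
    ContMDiffSection.ext fun x ↦ ?_⟩
  rw [section_sum_apply]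
  change ((Z x, 0) : V × (V →L[ℝ] ℝ)) = ∑ i, (b.coord i (Z x)) • ((b i, 0) : V × (V →L[ℝ] ℝ))
  refine Prod.ext ?_ ?_
  · rw [Prod.fst_sum]
    exact (b.sum_repr (Z x)).symm
  · simp [Prod.snd_sum]

variable {T : CourantAlgebroid 𝓘(ℝ, V) (V × (V →L[ℝ] ℝ)) (GenTangent 𝓘(ℝ, V) U)}

/-- The anchor is compatible with brackets by `der_bracket`; testing this on linear functions, which
separate vectors, identifies the vector part. -/
theorem genTangent_bracket_fst
    (ha : ∀ (x : U) (v : GenTangent 𝓘(ℝ, V) U x), T.anchor x v = v.1)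
    (s t : Cₛ^∞⟮𝓘(ℝ, V); V × (V →L[ℝ] ℝ), GenTangent 𝓘(ℝ, V) U⟯) (x : U) :
    (T.bracket s t x).1
      = VectorField.mlieBracket 𝓘(ℝ, V) (fun y ↦ (s y).1) (fun y ↦ (t y).1) x := by
  have hder (s f) (x : U) : T.der s f x = mvfderiv 𝓘(ℝ, V) f x (s x).1 := by
    rw [T.der_apply, ha]
  refine (SeparatingDual.eq_iff_forall_dual_eq (R := ℝ) (V := V)).2 fun l ↦ ?_
  have h1 := congrArg (fun f : C^∞⟮𝓘(ℝ, V), U; ℝ⟯ ↦ f x) (T.der_bracket s t (linearCoord l))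
  have h2 (u : Cₛ^∞⟮𝓘(ℝ, V); V × (V →L[ℝ] ℝ), GenTangent 𝓘(ℝ, V) U⟯) (y : U) :
      T.der u (linearCoord l) y = l (u y).1 :=
    (hder u _ y).trans (mvfderiv_linearCoord l y (u y).1)
  have h3 := apply_mlieBracket l (contMDiff_tangent_coe (GenTangent.fst s))
    (contMDiff_tangent_coe (GenTangent.fst t)) x
  refine Eq.trans ?_ h3.symm
  have h4 (u : Cₛ^∞⟮𝓘(ℝ, V); V × (V →L[ℝ] ℝ), GenTangent 𝓘(ℝ, V) U⟯) :
      ⇑(T.der u (linearCoord l)) = fun y ↦ l (GenTangent.fst u y : V) := funext (h2 u)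
  rw [h2, map_sub_apply, hder, hder, h4, h4] at h1
  exact h1

/-- With the standard pairing and anchor, the only freedom left in the bracket is the three-form
`⟨[X, Y], Z⟩`. It vanishes because the constant fields are isotropic and commute. -/
theorem genTangent_pair_bracket_inl {ι : Type*} [Fintype ι] (b : Module.Basis ι ℝ V)
    (hp : ∀ (x : U) (v w : GenTangent 𝓘(ℝ, V) U x), T.pairing x v w = w.2 v.1 + v.2 w.1)
    (hb : ∀ i j, T.bracket (constSection U (b i, 0)) (constSection U (b j, 0)) = 0)
    (X Y Z : Cₛ^∞⟮𝓘(ℝ, V); V, (TangentSpace 𝓘(ℝ, V) : U → Type _)⟯) :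
    T.pair (T.bracket (GenTangent.inl X) (GenTangent.inl Y))
    (GenTangent.inl Z) = 0 := by
  obtain ⟨f, hf⟩ := GenTangent.inl_eq_sum b X
  obtain ⟨g, hg⟩ := GenTangent.inl_eq_sum b Y
  obtain ⟨k, hk⟩ := GenTangent.inl_eq_sum b Z
  have h (i j : ι) : T.pair (constSection U (b i, 0)) (constSection U (b j, 0)) = 0 :=
    ContMDiffMap.ext fun x ↦ (hp x _ _).trans (add_zero (0 : ℝ))
  rw [hf, hg, hk]
  exact T.pair_bracket_sum_eq_zero _ h hb f g k

set_option maxHeartbeats 1600000 in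
/-- A Courant algebroid structure on the generalized tangent bundle of an open subset of `V` with
the standard pairing and anchor is the standard one if the constant vector fields commute. -/
theorem isStandard_of_constSection {ι : Type*} [Fintype ι] (b : Module.Basis ι ℝ V)
    (hp : ∀ (x : U) (v w : GenTangent 𝓘(ℝ, V) U x), T.pairing x v w = w.2 v.1 + v.2 w.1)
    (ha : ∀ (x : U) (v : GenTangent 𝓘(ℝ, V) U x), T.anchor x v = v.1)
    (hb : ∀ i j, T.bracket (constSection U (b i, 0)) (constSection U (b j, 0)) = 0) :
    IsStandard T := by
  have hder (s f) (x : U) : T.der s f x = mvfderiv 𝓘(ℝ, V) f x (s x).1 := by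
    rw [T.der_apply, ha]
  have hfst := genTangent_bracket_fst ha
  have hpz (s Z) (x : U) : T.pair s (GenTangent.inl Z) x = (s x).2 (Z x) := by
    rw [T.pair_apply, hp]
    exact zero_add _
  have hiso := genTangent_pair_bracket_inl b hp hb
  refine ⟨hp, ha, hfst, fun s t Z x ↦ ?_⟩
  let X := GenTangent.fst s
  let Y := GenTangent.fst t
  let α := GenTangent.snd s
  have h1 := congrArg (fun f : C^∞⟮𝓘(ℝ, V), U; ℝ⟯ ↦ f x) (T.der_pair s t (GenTangent.inl Z))
  -- The vector part of `s` drops out by `hiso`. Symmetrization and invariance along `Z` turn the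
  -- rest into `dα(Y, Z)`. Invariance of the pairing in `h1` then gives the one-form part of `[s,
  -- t]`.
  have h2 : T.pair (T.bracket s (GenTangent.inl Z)) (GenTangent.inl Y)
      = T.der (GenTangent.inl Y) (T.pair α (GenTangent.inl Z))
        - T.der (GenTangent.inl Z) (T.pair α (GenTangent.inl Y))
        + T.pair α (T.bracket (GenTangent.inl Z) (GenTangent.inl Y)) := by
    have h3 : T.bracket s (GenTangent.inl Z) = T.bracket (GenTangent.inl X) (GenTangent.inl Z)
        + T.bracket α (GenTangent.inl Z) :=
      (congrArg (fun u ↦ T.bracket u (GenTangent.inl Z)) (GenTangent.inl_fst_add_snd s)).symm.trans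
        (T.bracket.map_add₂ _ _ _)
    rw [h3, T.pair_add_left, hiso, zero_add, T.pair_bracket_eq, T.der_pair (GenTangent.inl Z)]
    abel
  have h2x := congrArg (fun f : C^∞⟮𝓘(ℝ, V), U; ℝ⟯ ↦ f x) h2
  have h4 : T.pair t (T.bracket s (GenTangent.inl Z)) x
      = T.pair (T.bracket s (GenTangent.inl Z)) (GenTangent.inl Y) x
        + (t x).2 (T.bracket s (GenTangent.inl Z) x).1 := by
    rw [T.pair_apply, hp, hpz]
    rfl
  have h5 : T.pair α (T.bracket (GenTangent.inl Z) (GenTangent.inl Y)) x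
      = (s x).2 (T.bracket (GenTangent.inl Z) (GenTangent.inl Y) x).1 := by
    rw [T.pair_apply, hp]
    refine (congrArg₂ (· + ·) (map_zero _) rfl).trans (zero_add _)
  have h6 : (T.bracket (GenTangent.inl Z) (GenTangent.inl Y) x).1
      = -VectorField.mlieBracket 𝓘(ℝ, V) (fun y ↦ (t y).1) Z x :=
    (hfst _ _ x).trans VectorField.mlieBracket_swap_apply
  have h7 : (T.bracket s (GenTangent.inl Z) x).1
      = VectorField.mlieBracket 𝓘(ℝ, V) (fun y ↦ (s y).1) Z x := hfst _ _ x
  have h8 (u Z) : ⇑(T.pair u (GenTangent.inl Z)) = fun y ↦ (u y).2 (Z y) := funext (hpz u Z)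
  rw [map_add_apply, h4, h2x, map_add_apply, map_sub_apply, h5, h6, h7, hder, hder, hder,
    hpz (T.bracket s t), h8 t Z, h8 α Z, h8 α Y, map_neg] at h1
  rw [lieDerivForm, extDerivForm]
  have h9 : ∀ a b c d e f g : ℝ, a = b + (c - d + -e + f) → b = a - f - (c - d - e) := by
    intros; linarith
  exact h9 _ _ _ _ _ _ 0 h1

end Standard

/-! ### Sections and functions pulled back from the factors of a product. -/

section Factors

variable {V₁ H₁ M₁ : Type*} [NormedAddCommGroup V₁] [NormedSpace ℝ V₁] [TopologicalSpace H₁]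
  {I₁ : ModelWithCorners ℝ V₁ H₁} [TopologicalSpace M₁] [ChartedSpace H₁ M₁]
  {F₁ : Type*} [NormedAddCommGroup F₁] [NormedSpace ℝ F₁]
  {E₁ : M₁ → Type*} [TopologicalSpace (TotalSpace F₁ E₁)]
  [∀ x, AddCommGroup (E₁ x)] [∀ x, Module ℝ (E₁ x)] [∀ x, TopologicalSpace (E₁ x)]
  [FiberBundle F₁ E₁] [VectorBundle ℝ F₁ E₁]
  {V₂ H₂ M₂ : Type*} [NormedAddCommGroup V₂] [NormedSpace ℝ V₂] [TopologicalSpace H₂]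
  {I₂ : ModelWithCorners ℝ V₂ H₂} [TopologicalSpace M₂] [ChartedSpace H₂ M₂]
  {F₂ : Type*} [NormedAddCommGroup F₂] [NormedSpace ℝ F₂]
  {E₂ : M₂ → Type*} [TopologicalSpace (TotalSpace F₂ E₂)]
  [∀ x, AddCommGroup (E₂ x)] [∀ x, Module ℝ (E₂ x)] [∀ x, TopologicalSpace (E₂ x)]
  [FiberBundle F₂ E₂] [VectorBundle ℝ F₂ E₂]

theorem mvfderiv_comp_map (q : C^∞⟮I₁, M₁; I₂, M₂⟯) (f : C^∞⟮I₂, M₂; ℝ⟯) (x : M₁)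
    (v : TangentSpace I₁ x) :
    mvfderiv I₁ (f.comp q) x v = mvfderiv I₂ f (q x) (mfderiv I₁ I₂ q x v) := by
  have h1 := (q.contMDiff.mdifferentiableAt (x := x) (by simp)).hasMFDerivAt
  have h2 := ((mdiffAt_map f (q x)).hasMFDerivAt.comp x h1).mfderiv
  exact congrArg (fun L : TangentSpace I₁ x →L[ℝ] ℝ ↦ L v) h2

variable (I₂ M₂) in
/-- A function on the first factor, as a function on the product. -/
def compFst (f : C^∞⟮I₁, M₁; ℝ⟯) : C^∞⟮I₁.prod I₂, M₁ × M₂; ℝ⟯ := f.comp ContMDiffMap.fst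

variable (I₁ M₁) in
/-- A function on the second factor, as a function on the product. -/
def compSnd (f : C^∞⟮I₂, M₂; ℝ⟯) : C^∞⟮I₁.prod I₂, M₁ × M₂; ℝ⟯ := f.comp ContMDiffMap.snd

theorem contMDiff_prodFst (Q : Cₛ^∞⟮I₁.prod I₂; F₁ × F₂, prodBundle I₁ E₁ I₂ E₂⟯) :
    ContMDiff (I₁.prod I₂) (I₁.prod 𝓘(ℝ, F₁)) ∞
      fun z ↦ (⟨z.1, prodFst I₁ E₁ I₂ E₂ z (Q z)⟩ : TotalSpace F₁ E₁) := by
  intro z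
  rw [Bundle.contMDiffAt_totalSpace]
  exact ⟨contMDiffAt_fst, ((ContinuousLinearMap.fst ℝ F₁ F₂).contMDiff.contMDiffAt).comp z
    ((contMDiffAt_section z).1 (Q.contMDiff z))⟩

theorem contMDiff_prodSnd (Q : Cₛ^∞⟮I₁.prod I₂; F₁ × F₂, prodBundle I₁ E₁ I₂ E₂⟯) :
    ContMDiff (I₁.prod I₂) (I₂.prod 𝓘(ℝ, F₂)) ∞
      fun z ↦ (⟨z.2, prodSnd I₁ E₁ I₂ E₂ z (Q z)⟩ : TotalSpace F₂ E₂) := by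
  intro z
  rw [Bundle.contMDiffAt_totalSpace]
  exact ⟨contMDiffAt_snd, ((ContinuousLinearMap.snd ℝ F₁ F₂).contMDiff.contMDiffAt).comp z
    ((contMDiffAt_section z).1 (Q.contMDiff z))⟩

theorem exists_section_prodFst (Q : Cₛ^∞⟮I₁.prod I₂; F₁ × F₂, prodBundle I₁ E₁ I₂ E₂⟯) (n : M₂) :
    ∃ υ : Cₛ^∞⟮I₁; F₁, E₁⟯, ∀ l, υ l = prodFst I₁ E₁ I₂ E₂ (l, n) (Q (l, n)) :=
  ⟨⟨fun l ↦ prodFst I₁ E₁ I₂ E₂ (l, n) (Q (l, n)),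
    (contMDiff_prodFst Q).comp (contMDiff_id.prodMk contMDiff_const)⟩, fun _ ↦ rfl⟩

theorem exists_section_prodSnd (Q : Cₛ^∞⟮I₁.prod I₂; F₁ × F₂, prodBundle I₁ E₁ I₂ E₂⟯) (l : M₁) :
    ∃ υ : Cₛ^∞⟮I₂; F₂, E₂⟯, ∀ n, υ n = prodSnd I₁ E₁ I₂ E₂ (l, n) (Q (l, n)) :=
  ⟨⟨fun n ↦ prodSnd I₁ E₁ I₂ E₂ (l, n) (Q (l, n)),
    (contMDiff_prodSnd Q).comp (contMDiff_const.prodMk contMDiff_id)⟩, fun _ ↦ rfl⟩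

theorem exists_eq_sum_smul {ι : Type*} [Fintype ι] {s : ι → Cₛ^∞⟮I₁; F₁, E₁⟯}
    {b : ∀ x, Module.Basis ι ℝ (E₁ x)} (hb : ∀ i x, b x i = s i x) (σ : Cₛ^∞⟮I₁; F₁, E₁⟯) :
    ∃ f : ι → C^∞⟮I₁, M₁; ℝ⟯, σ = ∑ i, f i • s i := by
  refine ⟨fun i ↦ ⟨fun x ↦ (b x).equivFun (σ x) i,
    contMDiff_pi_space.1 ((contMDiff_coeff hb).comp σ.contMDiff) i⟩,
    ContMDiffSection.ext fun x ↦ ?_⟩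
  rw [section_sum_apply]
  refine ((b x).sum_equivFun (σ x)).symm.trans (Finset.sum_congr rfl fun i _ ↦ ?_)
  rw [hb]
  rfl

theorem inlSection_sum_smul {ι : Type*} [Fintype ι] (s : ι → Cₛ^∞⟮I₁; F₁, E₁⟯)
    (f : ι → C^∞⟮I₁, M₁; ℝ⟯) : inlSection I₂ F₂ E₂ (∑ i, f i • s i)
      = ∑ i, compFst M₂ I₂ (f i) • inlSection I₂ F₂ E₂ (s i) := by
  refine ContMDiffSection.ext fun z ↦ ?_
  rw [section_sum_apply]
  refine (congrArg (prodInl I₁ E₁ I₂ E₂ z) (section_sum_apply _ _ z.1)).trans ((map_sum _ _ _).trans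
    (Finset.sum_congr rfl fun i _ ↦ ?_))
  exact (prodInl I₁ E₁ I₂ E₂ z).map_smul (f i z.1) (s i z.1)

theorem inrSection_sum_smul {ι : Type*} [Fintype ι] (s : ι → Cₛ^∞⟮I₂; F₂, E₂⟯)
    (f : ι → C^∞⟮I₂, M₂; ℝ⟯) : inrSection I₁ F₁ E₁ (∑ i, f i • s i)
      = ∑ i, compSnd M₁ I₁ (f i) • inrSection I₁ F₁ E₁ (s i) := by
  refine ContMDiffSection.ext fun z ↦ ?_
  rw [section_sum_apply]
  refine (congrArg (prodInr I₁ E₁ I₂ E₂ z) (section_sum_apply _ _ z.2)).trans ((map_sum _ _ _).trans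
    (Finset.sum_congr rfl fun i _ ↦ ?_))
  exact (prodInr I₁ E₁ I₂ E₂ z).map_smul (f i z.2) (s i z.2)

end Factors

/-! ### Brackets with commuting sections. -/

section Commuting

variable {V H M : Type*} [NormedAddCommGroup V] [NormedSpace ℝ V] [FiniteDimensional ℝ V]
  [TopologicalSpace H] {I : ModelWithCorners ℝ V H} [TopologicalSpace M] [ChartedSpace H M]
  {F : Type*} [NormedAddCommGroup F] [NormedSpace ℝ F]
  {E : M → Type*} [TopologicalSpace (TotalSpace F E)]
  [∀ x, AddCommGroup (E x)] [∀ x, Module ℝ (E x)] [∀ x, TopologicalSpace (E x)]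
  [FiberBundle F E] [VectorBundle ℝ F E] [IsManifold I ∞ M] [T2Space M]
  [ContMDiffVectorBundle ∞ F E I]

theorem CourantAlgebroid.bracket_comm_eq_zero (A : CourantAlgebroid I F E) {α β : Cₛ^∞⟮I; F, E⟯}
    {c : ℝ} (hp : ∀ x, A.pair α β x = c) (h : A.bracket α β = 0) : A.bracket β α = 0 := by
  refine ContMDiffSection.ext fun x ↦ ?_
  have h1 := A.bracket_add_bracket_apply_eq_zero (x := x) (Eventually.of_forall hp)
  rw [h] at h1
  exact (zero_add _).symm.trans h1

theorem CourantAlgebroid.bracket_sum_smul (A : CourantAlgebroid I F E) {ι : Type*} (s : Finset ι)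
    (f : ι → C^∞⟮I, M; ℝ⟯) (α : Cₛ^∞⟮I; F, E⟯) {β : ι → Cₛ^∞⟮I; F, E⟯}
    (h : ∀ i, A.bracket α (β i) = 0) :
    A.bracket α (∑ i ∈ s, f i • β i) = ∑ i ∈ s, A.der α (f i) • β i := by
  rw [map_sum]
  refine Finset.sum_congr rfl fun i _ ↦ ?_
  rw [A.bracket_smul_right, h, smul_zero, zero_add]

end Commuting

/-! ### Direct products from commuting frames. -/

section FactorsOfFrames

variable {V₁ H₁ M₁ : Type*} [NormedAddCommGroup V₁] [NormedSpace ℝ V₁] [FiniteDimensional ℝ V₁]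
  [TopologicalSpace H₁] {I₁ : ModelWithCorners ℝ V₁ H₁} [TopologicalSpace M₁] [ChartedSpace H₁ M₁]
  [IsManifold I₁ ∞ M₁] [T2Space M₁]
  {F₁ : Type*} [NormedAddCommGroup F₁] [NormedSpace ℝ F₁]
  {E₁ : M₁ → Type*} [TopologicalSpace (TotalSpace F₁ E₁)]
  [∀ x, AddCommGroup (E₁ x)] [∀ x, Module ℝ (E₁ x)] [∀ x, TopologicalSpace (E₁ x)]
  [FiberBundle F₁ E₁] [VectorBundle ℝ F₁ E₁] [ContMDiffVectorBundle ∞ F₁ E₁ I₁]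
  {V₂ H₂ M₂ : Type*} [NormedAddCommGroup V₂] [NormedSpace ℝ V₂] [FiniteDimensional ℝ V₂]
  [TopologicalSpace H₂] {I₂ : ModelWithCorners ℝ V₂ H₂} [TopologicalSpace M₂] [ChartedSpace H₂ M₂]
  [IsManifold I₂ ∞ M₂] [T2Space M₂]
  {F₂ : Type*} [NormedAddCommGroup F₂] [NormedSpace ℝ F₂]
  {E₂ : M₂ → Type*} [TopologicalSpace (TotalSpace F₂ E₂)]
  [∀ x, AddCommGroup (E₂ x)] [∀ x, Module ℝ (E₂ x)] [∀ x, TopologicalSpace (E₂ x)]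
  [FiberBundle F₂ E₂] [VectorBundle ℝ F₂ E₂] [ContMDiffVectorBundle ∞ F₂ E₂ I₂]

set_option maxHeartbeats 3000000 in
/-- A Courant algebroid on a product bundle is a direct product if the two factors are orthogonal
and have commuting global frames, the one of the first factor consisting of commuting sections. -/
theorem CourantAlgebroid.exists_isDirectProduct_of_frames
    (C : CourantAlgebroid (I₁.prod I₂) (F₁ × F₂) (prodBundle I₁ E₁ I₂ E₂)) (l₀ : M₁) (n₀ : M₂)
    {κ μ : Type*} [Fintype κ] [Fintype μ]
    {c : κ → Cₛ^∞⟮I₁; F₁, E₁⟯} {b₁ : ∀ x, Module.Basis κ ℝ (E₁ x)} (hc : ∀ i x, b₁ x i = c i x)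
    {e : μ → Cₛ^∞⟮I₂; F₂, E₂⟯} {b₂ : ∀ x, Module.Basis μ ℝ (E₂ x)} (he : ∀ i x, b₂ x i = e i x)
    (hp₁ : ∀ (l : M₁) (n n' : M₂) (v w : E₁ l),
      C.pairing (l, n) (prodInl I₁ E₁ I₂ E₂ (l, n) v) (prodInl I₁ E₁ I₂ E₂ (l, n) w)
        = C.pairing (l, n') (prodInl I₁ E₁ I₂ E₂ (l, n') v) (prodInl I₁ E₁ I₂ E₂ (l, n') w))
    (hp₁₂ : ∀ z v w, C.pairing z (prodInl I₁ E₁ I₂ E₂ z v) (prodInr I₁ E₁ I₂ E₂ z w) = 0)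
    (ha₁ : ∀ (l : M₁) (n n' : M₂) (v : E₁ l),
      mfderiv (I₁.prod I₂) I₁ Prod.fst (l, n) (C.anchor (l, n) (prodInl I₁ E₁ I₂ E₂ (l, n) v))
        = mfderiv (I₁.prod I₂) I₁ Prod.fst (l, n')
          (C.anchor (l, n') (prodInl I₁ E₁ I₂ E₂ (l, n') v)))
    (ha₁' : ∀ (z : M₁ × M₂) (v : E₁ z.1),
      mfderiv (I₁.prod I₂) I₂ Prod.snd z (C.anchor z (prodInl I₁ E₁ I₂ E₂ z v)) = 0)
    (ha₂' : ∀ (z : M₁ × M₂) (v : E₂ z.2),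
      mfderiv (I₁.prod I₂) I₁ Prod.fst z (C.anchor z (prodInr I₁ E₁ I₂ E₂ z v)) = 0)
    (hconst : ∀ f, (∀ i, C.der (inlSection I₂ F₂ E₂ (c i)) f = 0) →
      ∀ l l' n, f (l, n) = f (l', n))
    (hcc : ∀ i j, C.bracket (inlSection I₂ F₂ E₂ (c i)) (inlSection I₂ F₂ E₂ (c j)) = 0)
    (hce : ∀ i a, C.bracket (inlSection I₂ F₂ E₂ (c i)) (inrSection I₁ F₁ E₁ (e a)) = 0) :
    ∃ (A₁ : CourantAlgebroid I₁ F₁ E₁) (A₂ : CourantAlgebroid I₂ F₂ E₂),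
      IsDirectProduct A₁ A₂ C := by
  let ι₁ := inlSection (I₁ := I₁) (F₁ := F₁) (E₁ := E₁) I₂ F₂ E₂
  let ι₂ := inrSection (I₂ := I₂) (F₂ := F₂) (E₂ := E₂) I₁ F₁ E₁
  have dfst (τ) (f : C^∞⟮I₁, M₁; ℝ⟯) : C.der (ι₂ τ) (compFst M₂ I₂ f) = 0 :=
    ContMDiffMap.ext fun z ↦ (mvfderiv_comp_map _ f z _).trans
      ((congrArg (mvfderiv I₁ f z.1) (ha₂' z (τ z.2))).trans (map_zero _))
  have dsnd (σ) (f : C^∞⟮I₂, M₂; ℝ⟯) : C.der (ι₁ σ) (compSnd M₁ I₁ f) = 0 :=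
    ContMDiffMap.ext fun z ↦ (mvfderiv_comp_map _ f z _).trans
      ((congrArg (mvfderiv I₂ f z.2) (ha₁' z (σ z.1))).trans (map_zero _))
  have p12 (σ τ) : C.pair (ι₁ σ) (ι₂ τ) = 0 := ContMDiffMap.ext fun z ↦ hp₁₂ z (σ z.1) (τ z.2)
  have p21 (σ τ) : C.pair (ι₂ τ) (ι₁ σ) = 0 := by rw [C.pair_comm, p12]
  have hc2 (i τ) : C.bracket (ι₁ (c i)) (ι₂ τ) = 0 := by
    obtain ⟨f, rfl⟩ := exists_eq_sum_smul he τ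
    simp only [ι₂]
    rw [inrSection_sum_smul, C.bracket_sum_smul _ _ _ (hce i)]
    exact Finset.sum_eq_zero fun a _ ↦ by rw [dsnd, zero_smul]
  have h2c (i τ) : C.bracket (ι₂ τ) (ι₁ (c i)) = 0 :=
    C.bracket_comm_eq_zero (c := 0) (fun z ↦ by rw [p12]; rfl) (hc2 i τ)
  -- Functions on the first factor are killed by anchors of the second summand, so vanishing passes
  -- from the frame `c` to all its combinations. The opposite order follows from orthogonality.
  have h21 (σ τ) : C.bracket (ι₂ τ) (ι₁ σ) = 0 := by
    obtain ⟨f, rfl⟩ := exists_eq_sum_smul hc σ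
    simp only [ι₁]
    rw [inlSection_sum_smul, C.bracket_sum_smul _ _ _ fun i ↦ h2c i τ]
    exact Finset.sum_eq_zero fun a _ ↦ by rw [dfst, zero_smul]
  have h12 (σ τ) : C.bracket (ι₁ σ) (ι₂ τ) = 0 :=
    C.bracket_comm_eq_zero (c := 0) (fun z ↦ by rw [p21]; rfl) (h21 σ τ)
  -- These pairings are annihilated by every `c i`, so `hconst` makes them independent of the first
  -- factor. The argument for the anchors in `ha₂` is the same.
  have hp₂ (l l' n) (v w : E₂ n) :
      C.pairing (l, n) (prodInr I₁ E₁ I₂ E₂ (l, n) v) (prodInr I₁ E₁ I₂ E₂ (l, n) w)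
        = C.pairing (l', n) (prodInr I₁ E₁ I₂ E₂ (l', n) v) (prodInr I₁ E₁ I₂ E₂ (l', n) w) := by
    obtain ⟨σ, rfl⟩ := exists_section_apply_eq I₂ F₂ E₂ n v
    obtain ⟨τ, rfl⟩ := exists_section_apply_eq I₂ F₂ E₂ n w
    refine hconst (C.pair (ι₂ σ) (ι₂ τ)) (fun i ↦ ?_) l l' n
    rw [C.der_pair, hc2, hc2, C.pair_zero_left, C.pair_zero_right, add_zero]
  have ha₂ (l l' n) (v : E₂ n) :
      mfderiv (I₁.prod I₂) I₂ Prod.snd (l, n) (C.anchor (l, n) (prodInr I₁ E₁ I₂ E₂ (l, n) v))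
        = mfderiv (I₁.prod I₂) I₂ Prod.snd (l', n)
          (C.anchor (l', n) (prodInr I₁ E₁ I₂ E₂ (l', n) v)) := by
    obtain ⟨τ, rfl⟩ := exists_section_apply_eq I₂ F₂ E₂ n v
    refine sub_eq_zero.1 (tangentVector_eq_zero (I := I₂) n _ fun f ↦ ?_)
    rw [map_sub, sub_eq_zero]
    have h := hconst (C.der (ι₂ τ) (compSnd M₁ I₁ f)) (fun i ↦ by
      have h1 := C.der_bracket (ι₁ (c i)) (ι₂ τ) (compSnd M₁ I₁ f)
      rw [hc2, dsnd, C.der_zero, C.der_zero_left, sub_zero] at h1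
      exact h1.symm) l l' n
    exact (mvfderiv_comp_map ContMDiffMap.snd f (l, n) _).symm.trans
      (h.trans (mvfderiv_comp_map ContMDiffMap.snd f (l', n) _))
  refine C.exists_isDirectProduct l₀ n₀ (fun l n ↦ hp₁ l n n₀) (fun l n ↦ hp₂ l l₀ n) hp₁₂
    (fun l n ↦ ha₁ l n n₀) ha₁' (fun l n ↦ ha₂ l l₀ n) ha₂' (fun σ τ ↦ ?_) (fun σ τ ↦ ?_) h12 h21
  · let Q := C.bracket (ι₁ σ) (ι₁ τ)
    -- Invariance of the pairing: `τ` is orthogonal to the second summand and `σ` commutes with it,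
    -- so `[σ, τ]` is orthogonal to it and lies in the first.
    have hQ2 (υ) : C.pair Q (ι₂ υ) = 0 := by
      have h := C.der_pair (ι₁ σ) (ι₁ τ) (ι₂ υ)
      rw [p12, h12, C.der_zero, C.pair_zero_right, add_zero] at h
      exact h.symm
    have hQ0 (z) : prodSnd I₁ E₁ I₂ E₂ z (Q z) = 0 := by
      refine prodInr_injective (I₁ := I₁) (I₂ := I₂) (E₁ := E₁) z ?_
      rw [map_zero]
      refine C.pairing_nondegenerate z _ fun w ↦ ?_
      obtain ⟨υ, hυ⟩ := exists_section_apply_eq I₂ F₂ E₂ z.2 (prodSnd I₁ E₁ I₂ E₂ z w)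
      have h := congrArg (fun f : C^∞⟮I₁.prod I₂, M₁ × M₂; ℝ⟯ ↦ f z) (hQ2 υ)
      have h' : C.pairing z (Q z) (prodInr I₁ E₁ I₂ E₂ z (υ z.2)) = 0 := h
      rw [← prodInl_add_prodInr z (Q z), hυ, map_add, LinearMap.add_apply, hp₁₂, zero_add] at h'
      rw [← prodInl_add_prodInr z w, map_add, C.pairing_symm, hp₁₂, zero_add]
      exact h'
    have kder (σ) {f : C^∞⟮I₁.prod I₂, M₁ × M₂; ℝ⟯} (hf : ∀ l n n', f (l, n) = f (l, n'))
        (l n n') : C.der (ι₁ σ) f (l, n) = C.der (ι₁ σ) f (l, n') := by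
      let g : C^∞⟮I₁, M₁; ℝ⟯ :=
        ⟨fun l ↦ f (l, n₀), f.contMDiff.comp (contMDiff_id.prodMk contMDiff_const)⟩
      have hg : f = compFst M₂ I₂ g := ContMDiffMap.ext fun z ↦ hf z.1 z.2 n₀
      rw [hg]
      refine (mvfderiv_comp_map ContMDiffMap.fst g (l, n) _).trans
        (Eq.trans ?_ (mvfderiv_comp_map ContMDiffMap.fst g (l, n') _).symm)
      exact congrArg (mvfderiv I₁ g l) (ha₁ l n n' (σ l))
    have kpair (σ τ l n n') : C.pair (ι₁ σ) (ι₁ τ) (l, n) = C.pair (ι₁ σ) (ι₁ τ) (l, n') :=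
      hp₁ l n n' (σ l) (τ l)
    -- Symmetrization expresses `⟨[σ, τ], c j⟩` by pairings and derivatives from the first factor
    -- alone, because the `c i` commute. None of these depends on the point of `M₂`.
    have kQ (j l n n') : C.pair Q (ι₁ (c j)) (l, n) = C.pair Q (ι₁ (c j)) (l, n') := by
      obtain ⟨f, hf⟩ := exists_eq_sum_smul hc σ
      have h1 := C.der_pair (ι₁ σ) (ι₁ τ) (ι₁ (c j))
      have h2 := C.pair_bracket_eq (ι₁ σ) (ι₁ (c j)) (ι₁ τ)
      have h3 : C.bracket (ι₁ (c j)) (ι₁ σ)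
          = ∑ i, C.der (ι₁ (c j)) (compFst M₂ I₂ (f i)) • ι₁ (c i) := by
        conv_lhs => rw [hf]
        simp only [ι₁]
        rw [inlSection_sum_smul, C.bracket_sum_smul _ _ _ (hcc j)]
      have h4 : C.pair Q (ι₁ (c j)) = C.der (ι₁ σ) (C.pair (ι₁ τ) (ι₁ (c j)))
          - (C.der (ι₁ τ) (C.pair (ι₁ σ) (ι₁ (c j)))
            - ∑ i, C.der (ι₁ (c j)) (compFst M₂ I₂ (f i)) * C.pair (ι₁ (c i)) (ι₁ τ)) := by
        rw [eq_sub_iff_add_eq, h1, C.pair_comm (ι₁ τ) (C.bracket _ _), h2, h3, C.pair_sum_left]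
        simp only [C.pair_smul_left]
        rfl
      rw [h4]
      simp only [map_sub_apply, map_sum_apply, map_mul_apply]
      rw [kder σ (kpair τ (c j)) l n n', kder τ (kpair σ (c j)) l n n']
      refine congrArg₂ (· - ·) rfl (congrArg₂ (· - ·) rfl (Finset.sum_congr rfl fun i _ ↦ ?_))
      exact congrArg₂ (· * ·) (kder (c j) (fun _ _ _ ↦ rfl) l n n') (kpair (c i) τ l n n')
    obtain ⟨υ, hυ⟩ := exists_section_prodFst Q n₀
    refine ⟨υ, ContMDiffSection.ext fun z ↦ ?_⟩
    obtain ⟨l, n⟩ := z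
    refine (prodInl_add_prodInr (l, n) (Q (l, n))).symm.trans ?_
    rw [hQ0, map_zero, add_zero]
    refine sub_eq_zero.1 (C.pairing_nondegenerate (l, n) _ fun w ↦ ?_)
    have h5 : prodInl I₁ E₁ I₂ E₂ (l, n) (prodFst I₁ E₁ I₂ E₂ (l, n) (Q (l, n)))
        - inlSection I₂ F₂ E₂ υ (l, n) = prodInl I₁ E₁ I₂ E₂ (l, n)
          (prodFst I₁ E₁ I₂ E₂ (l, n) (Q (l, n)) - υ l) := (map_sub _ _ _).symm
    have h6 (n') (w : E₁ l) : C.pairing (l, n') (prodInl I₁ E₁ I₂ E₂ (l, n')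
        (prodFst I₁ E₁ I₂ E₂ (l, n') (Q (l, n')))) (prodInl I₁ E₁ I₂ E₂ (l, n') w)
        = ∑ j, (b₁ l).equivFun w j * C.pair Q (ι₁ (c j)) (l, n') := by
      have h7 : prodInl I₁ E₁ I₂ E₂ (l, n') (prodFst I₁ E₁ I₂ E₂ (l, n') (Q (l, n')))
          = Q (l, n') := by
        have h8 := prodInl_add_prodInr (l, n') (Q (l, n'))
        rwa [hQ0, map_zero, add_zero] at h8
      rw [h7]
      conv_lhs => rw [← (b₁ l).sum_equivFun w]
      rw [map_sum, map_sum]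
      refine Finset.sum_congr rfl fun j _ ↦ ?_
      rw [map_smul, map_smul, hc]
      rfl
    rw [h5, ← prodInl_add_prodInr (l, n) w, map_add, hp₁₂, add_zero, map_sub, map_sub,
      LinearMap.sub_apply, hυ, h6, hp₁ l n n₀, h6, sub_eq_zero]
    exact Finset.sum_congr rfl fun j _ ↦ congrArg _ (kQ j l n n₀)
  · let Q := C.bracket (ι₂ σ) (ι₂ τ)
    have hQ1 (υ) : C.pair Q (ι₁ υ) = 0 := by
      have h := C.der_pair (ι₂ σ) (ι₂ τ) (ι₁ υ)
      rw [p21, h21, C.der_zero, C.pair_zero_right, add_zero] at h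
      exact h.symm
    have hQ0 (z) : prodFst I₁ E₁ I₂ E₂ z (Q z) = 0 := by
      refine prodInl_injective (I₁ := I₁) (I₂ := I₂) (E₂ := E₂) z ?_
      rw [map_zero]
      refine C.pairing_nondegenerate z _ fun w ↦ ?_
      obtain ⟨υ, hυ⟩ := exists_section_apply_eq I₁ F₁ E₁ z.1 (prodFst I₁ E₁ I₂ E₂ z w)
      have h := congrArg (fun f : C^∞⟮I₁.prod I₂, M₁ × M₂; ℝ⟯ ↦ f z) (hQ1 υ)
      have h' : C.pairing z (Q z) (prodInl I₁ E₁ I₂ E₂ z (υ z.1)) = 0 := h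
      rw [← prodInl_add_prodInr z (Q z), hυ, map_add, LinearMap.add_apply,
        C.pairing_symm z (prodInr I₁ E₁ I₂ E₂ z _), hp₁₂, add_zero] at h'
      rw [← prodInl_add_prodInr z w, map_add, hp₁₂, add_zero]
      exact h'
    -- By Jacobi `Q` commutes with the `c i`, so its coefficients in the frame `e` are annihilated
    -- by them and constant along the first factor.
    have hcQ (i) : C.bracket (ι₁ (c i)) Q = 0 := by
      have h := C.jacobi (ι₁ (c i)) (ι₂ σ) (ι₂ τ)
      rw [hc2, hc2, map_zero, map_zero, LinearMap.zero_apply, add_zero] at h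
      exact h.symm
    let g (a : μ) : C^∞⟮I₁.prod I₂, M₁ × M₂; ℝ⟯ :=
      ⟨fun z ↦ (b₂ z.2).equivFun (prodSnd I₁ E₁ I₂ E₂ z (Q z)) a,
        contMDiff_pi_space.1 ((contMDiff_coeff he).comp (contMDiff_prodSnd Q)) a⟩
    have hQ : Q = ∑ a, g a • ι₂ (e a) := by
      refine ContMDiffSection.ext fun z ↦ ?_
      rw [section_sum_apply]
      refine (prodInl_add_prodInr z (Q z)).symm.trans ?_
      rw [hQ0, map_zero, zero_add]
      conv_lhs => rw [← (b₂ z.2).sum_equivFun (prodSnd I₁ E₁ I₂ E₂ z (Q z))]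
      rw [map_sum]
      refine Finset.sum_congr rfl fun a _ ↦ ?_
      rw [map_smul, he]
      rfl
    have hg (i a) : C.der (ι₁ (c i)) (g a) = 0 := by
      have h := hcQ i
      rw [hQ, C.bracket_sum_smul _ _ _ (hce i)] at h
      refine ContMDiffMap.ext fun z ↦ ?_
      have h1 : ∑ a, C.der (ι₁ (c i)) (g a) z • b₂ z.2 a = 0 := by
        refine prodInr_injective (I₁ := I₁) (I₂ := I₂) (E₁ := E₁) z ?_
        rw [map_zero, map_sum]
        have h2 := congrArg (fun s : Cₛ^∞⟮I₁.prod I₂; F₁ × F₂, prodBundle I₁ E₁ I₂ E₂⟯ ↦ s z) h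
        simp only [section_sum_apply] at h2
        refine Eq.trans (Finset.sum_congr rfl fun a _ ↦ ?_) h2
        rw [map_smul, he]
        rfl
      exact Fintype.linearIndependent_iff.1 (b₂ z.2).linearIndependent _ h1 a
    obtain ⟨υ, hυ⟩ := exists_section_prodSnd Q l₀
    refine ⟨υ, ContMDiffSection.ext fun z ↦ ?_⟩
    obtain ⟨l, n⟩ := z
    refine (prodInl_add_prodInr (l, n) (Q (l, n))).symm.trans ?_
    rw [hQ0, map_zero, zero_add]
    refine congrArg (prodInr I₁ E₁ I₂ E₂ (l, n)) ?_
    refine Eq.trans ?_ (hυ n).symm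
    refine (b₂ n).equivFun.injective (funext fun a ↦ ?_)
    exact hconst (g a) (fun i ↦ hg i a) l l₀ n

end FactorsOfFrames

/-! ### Products with a standard first factor. -/

section StandardFactor

variable {V₁ : Type*} [NormedAddCommGroup V₁] [NormedSpace ℝ V₁] [FiniteDimensional ℝ V₁]
  {L : Opens V₁}
  {V₂ H₂ M₂ : Type*} [NormedAddCommGroup V₂] [NormedSpace ℝ V₂] [FiniteDimensional ℝ V₂]
  [TopologicalSpace H₂] {I₂ : ModelWithCorners ℝ V₂ H₂} [TopologicalSpace M₂] [ChartedSpace H₂ M₂]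
  [IsManifold I₂ ∞ M₂] [T2Space M₂]
  {F₂ : Type*} [NormedAddCommGroup F₂] [NormedSpace ℝ F₂]
  {E₂ : M₂ → Type*} [TopologicalSpace (TotalSpace F₂ E₂)]
  [∀ x, AddCommGroup (E₂ x)] [∀ x, Module ℝ (E₂ x)] [∀ x, TopologicalSpace (E₂ x)]
  [FiberBundle F₂ E₂] [VectorBundle ℝ F₂ E₂] [ContMDiffVectorBundle ∞ F₂ E₂ I₂]

variable (V₁) in
/-- The standard pairing on `V × V^*`. -/
def stdPairing : (V₁ × (V₁ →L[ℝ] ℝ)) →ₗ[ℝ] (V₁ × (V₁ →L[ℝ] ℝ)) →ₗ[ℝ] ℝ :=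
  LinearMap.mk₂ ℝ (fun v w ↦ w.2 v.1 + v.2 w.1)
    (by intro v v' w; simp; ring) (by intro a v w; simp; ring) (by intro v w w'; simp; ring)
    (by intro a v w; simp; ring)

/-- A function on `L × M₂`, with `L` connected, that is constant along `L` infinitesimally. -/
theorem eq_of_mvfderiv_inl_eq_zero (hL : IsPreconnected (L : Set V₁))
    {f : C^∞⟮𝓘(ℝ, V₁).prod I₂, L × M₂; ℝ⟯}
    (hf : ∀ (l : L) (n : M₂) (v : V₁),
      mvfderiv (𝓘(ℝ, V₁).prod I₂) f (l, n) ((v, 0) : V₁ × V₂) = 0)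
    (l l' : L) (n : M₂) : f (l, n) = f (l', n) := by
  let q : C^∞⟮𝓘(ℝ, V₁), L; 𝓘(ℝ, V₁).prod I₂, L × M₂⟯ :=
    ⟨fun l ↦ (l, n), contMDiff_id.prodMk contMDiff_const⟩
  let g (z : V₁) : ℝ := f (q (openRetr L l z))
  have hg (x : L) : ContDiffAt ℝ ∞ g (x : V₁) :=
    ((f.comp q).contMDiff.contMDiffAt.comp (x : V₁)
      (contMDiffAt_openRetr 𝓘(ℝ, V₁) L l x)).contDiffAt
  have hgx (x : L) : g x = f (x, n) := congrArg (f.comp q) (openRetr_coe L l x)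
  have h := L.isOpen.is_const_of_fderiv_eq_zero (𝕜 := ℝ) hL (f := g) (fun x hx ↦
    ((hg ⟨x, hx⟩).differentiableAt (by simp)).differentiableWithinAt) (fun x hx ↦ by
      refine ContinuousLinearMap.ext fun v ↦ ?_
      have h1 := mvfderiv_comp_coe (U := L) (x := ⟨x, hx⟩) (g := f.comp q)
        ((hg ⟨x, hx⟩).differentiableAt (by simp)) (Eventually.of_forall fun y ↦ (hgx y).symm) v
      refine h1.symm.trans ((mvfderiv_comp_map q f ⟨x, hx⟩ v).trans ?_)
      have h2 : mfderiv 𝓘(ℝ, V₁) (𝓘(ℝ, V₁).prod I₂) q ⟨x, hx⟩ v = ((v, 0) : V₁ × V₂) := by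
        have h3 := mfderiv_prod_left (I := 𝓘(ℝ, V₁)) (I' := I₂) (x₀ := (⟨x, hx⟩ : L)) (y₀ := n)
        exact congrArg (fun A : V₁ →L[ℝ] V₁ × V₂ ↦ A v) h3
      exact (congrArg (mvfderiv (𝓘(ℝ, V₁).prod I₂) f (⟨x, hx⟩, n)) h2).trans
        (hf ⟨x, hx⟩ n v)) l.2 l'.2
  rw [← hgx, ← hgx, h]

set_option maxHeartbeats 3000000 in
/-- A Courant algebroid on the product of the generalized tangent bundle of a connected open set `L`
with a bundle `E₂` is the direct product of the standard Courant algebroid with one on `E₂` if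
the constant sections commute with each other and with a frame of `E₂`. -/
theorem CourantAlgebroid.exists_isDirectProduct_isStandard
    (hL : IsPreconnected (L : Set V₁)) (l₀ : L) (n₀ : M₂)
    (C : CourantAlgebroid (𝓘(ℝ, V₁).prod I₂) ((V₁ × (V₁ →L[ℝ] ℝ)) × F₂)
      (prodBundle 𝓘(ℝ, V₁) (GenTangent 𝓘(ℝ, V₁) L) I₂ E₂))
    {κ ι μ : Type*} [Fintype κ] [Fintype ι] [Fintype μ] (b : Module.Basis κ ℝ V₁)
    (c : Module.Basis ι ℝ (V₁ × (V₁ →L[ℝ] ℝ))) {k : κ → ι} (hk : ∀ i, c (k i) = (b i, 0))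
    {e : μ → Cₛ^∞⟮I₂; F₂, E₂⟯} {b₂ : ∀ x, Module.Basis μ ℝ (E₂ x)} (he : ∀ i x, b₂ x i = e i x)
    (hp : ∀ z i j, C.pair (inlSection I₂ F₂ E₂ (constSection L (c i)))
      (inlSection I₂ F₂ E₂ (constSection L (c j))) z = (c j).2 (c i).1 + (c i).2 (c j).1)
    (hp₁₂ : ∀ z i a, C.pair (inlSection I₂ F₂ E₂ (constSection L (c i)))
      (inrSection 𝓘(ℝ, V₁) (V₁ × (V₁ →L[ℝ] ℝ)) (GenTangent 𝓘(ℝ, V₁) L) (e a)) z = 0)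
    (ha : ∀ (z : L × M₂) i, mfderiv (𝓘(ℝ, V₁).prod I₂) 𝓘(ℝ, V₁) Prod.fst z
      (C.anchor z (inlSection I₂ F₂ E₂ (constSection L (c i)) z)) = (c i).1)
    (ha' : ∀ (z : L × M₂) i, mfderiv (𝓘(ℝ, V₁).prod I₂) I₂ Prod.snd z
      (C.anchor z (inlSection I₂ F₂ E₂ (constSection L (c i)) z)) = 0)
    (ha₂ : ∀ (z : L × M₂) a, mfderiv (𝓘(ℝ, V₁).prod I₂) 𝓘(ℝ, V₁) Prod.fst z
      (C.anchor z (inrSection 𝓘(ℝ, V₁) (V₁ × (V₁ →L[ℝ] ℝ)) (GenTangent 𝓘(ℝ, V₁) L) (e a) z)) = 0)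
    (hcc : ∀ i j, C.bracket (inlSection I₂ F₂ E₂ (constSection L (c i)))
      (inlSection I₂ F₂ E₂ (constSection L (c j))) = 0)
    (hce : ∀ i a, C.bracket (inlSection I₂ F₂ E₂ (constSection L (c i)))
      (inrSection 𝓘(ℝ, V₁) (V₁ × (V₁ →L[ℝ] ℝ)) (GenTangent 𝓘(ℝ, V₁) L) (e a)) = 0) :
    ∃ (T : CourantAlgebroid 𝓘(ℝ, V₁) (V₁ × (V₁ →L[ℝ] ℝ)) (GenTangent 𝓘(ℝ, V₁) L))
      (A₂ : CourantAlgebroid I₂ F₂ E₂), IsStandard T ∧ IsDirectProduct T A₂ C := by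
  let W := V₁ × (V₁ →L[ℝ] ℝ)
  let inl (z : L × M₂) : W →ₗ[ℝ] _ := prodInl 𝓘(ℝ, V₁) (GenTangent 𝓘(ℝ, V₁) L) I₂ E₂ z
  let inr (z : L × M₂) : E₂ z.2 →ₗ[ℝ] _ := prodInr 𝓘(ℝ, V₁) (GenTangent 𝓘(ℝ, V₁) L) I₂ E₂ z
  let dfst (z : L × M₂) : TangentSpace (𝓘(ℝ, V₁).prod I₂) z →ₗ[ℝ] V₁ :=
    (mfderiv (𝓘(ℝ, V₁).prod I₂) 𝓘(ℝ, V₁) Prod.fst z).toLinearMap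
  let dsnd (z : L × M₂) : TangentSpace (𝓘(ℝ, V₁).prod I₂) z →ₗ[ℝ] TangentSpace I₂ z.2 :=
    (mfderiv (𝓘(ℝ, V₁).prod I₂) I₂ Prod.snd z).toLinearMap
  have Hp (z) (v w : W) : C.pairing z (inl z v) (inl z w) = w.2 v.1 + v.2 w.1 := by
    have h : (C.pairing z).compl₁₂ (inl z) (inl z) = stdPairing V₁ :=
      c.ext fun i ↦ c.ext fun j ↦ hp z i j
    exact congrArg (fun B : W →ₗ[ℝ] W →ₗ[ℝ] ℝ ↦ B v w) h
  have Hp₁₂ (z) (v : W) (w : E₂ z.2) : C.pairing z (inl z v) (inr z w) = 0 := by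
    have h : (C.pairing z).compl₁₂ (inl z) (inr z) = 0 :=
      c.ext fun i ↦ (b₂ z.2).ext fun j ↦
        (congrArg (fun u ↦ C.pairing z (inl z (c i)) (inr z u)) (he j z.2)).trans (hp₁₂ z i j)
    exact congrArg (fun B : W →ₗ[ℝ] E₂ z.2 →ₗ[ℝ] ℝ ↦ B v w) h
  have Ha (z) (v : W) : dfst z (C.anchor z (inl z v)) = v.1 := by
    have h : dfst z ∘ₗ C.anchor z ∘ₗ inl z = LinearMap.fst ℝ V₁ (V₁ →L[ℝ] ℝ) :=
      c.ext fun i ↦ ha z i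
    exact congrArg (fun B : W →ₗ[ℝ] V₁ ↦ B v) h
  have Ha' (z) (v : W) : dsnd z (C.anchor z (inl z v)) = 0 := by
    have h : dsnd z ∘ₗ C.anchor z ∘ₗ inl z = 0 := c.ext fun i ↦ ha' z i
    exact congrArg (fun B : W →ₗ[ℝ] TangentSpace I₂ z.2 ↦ B v) h
  have Ha₂ (z) (v : E₂ z.2) : dfst z (C.anchor z (inr z v)) = 0 := by
    have h : dfst z ∘ₗ C.anchor z ∘ₗ inr z = 0 := (b₂ z.2).ext fun j ↦
      (congrArg (fun u ↦ dfst z (C.anchor z (inr z u))) (he j z.2)).trans (ha₂ z j)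
    exact congrArg (fun B : E₂ z.2 →ₗ[ℝ] V₁ ↦ B v) h
  have hanchor (z : L × M₂) (v : W) : C.anchor z (inl z v) = ((v.1, 0) : V₁ × V₂) := by
    refine Prod.ext ((Eq.symm ?_).trans (Ha z v)) ((Eq.symm ?_).trans (Ha' z v))
    · exact congrArg (fun B : V₁ × V₂ →L[ℝ] V₁ ↦ B (C.anchor z (inl z v))) (mfderiv_fst (x := z))
    · exact congrArg (fun B : V₁ × V₂ →L[ℝ] V₂ ↦ B (C.anchor z (inl z v))) (mfderiv_snd (x := z))
  -- A function killed by all constant sections has zero derivative along `L`, since the anchor of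
  -- `(v, 0)` is `v`. As `L` is connected, the function is constant along `L`.
  obtain ⟨T, A₂, h⟩ := C.exists_isDirectProduct_of_frames l₀ n₀ (c := fun i ↦ constSection L (c i))
    (b₁ := fun _ ↦ c) (fun i x ↦ rfl) he (fun l n n' v w ↦ (Hp (l, n) v w).trans (Hp (l, n') v w).symm)
    Hp₁₂ (fun l n n' v ↦ (Ha (l, n) v).trans (Ha (l, n') v).symm) Ha' Ha₂ (fun f hf ↦ by
      refine eq_of_mvfderiv_inl_eq_zero hL fun l n v ↦ ?_
      have h1 : (mvfderiv (𝓘(ℝ, V₁).prod I₂) f (l, n)).toLinearMap ∘ₗ C.anchor (l, n) ∘ₗ inl (l, n)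
          = 0 := c.ext fun i ↦
        congrArg (fun g : C^∞⟮𝓘(ℝ, V₁).prod I₂, L × M₂; ℝ⟯ ↦ g (l, n)) (hf i)
      refine Eq.trans ?_ (congrArg (fun B : W →ₗ[ℝ] ℝ ↦ B (v, 0)) h1)
      exact congrArg (mvfderiv (𝓘(ℝ, V₁).prod I₂) f (l, n)) (hanchor (l, n) (v, 0)).symm)
    hcc hce
  refine ⟨T, A₂, isStandard_of_constSection b (fun x v w ↦ ?_) (fun x v ↦ ?_) (fun i j ↦ ?_), h⟩
  · have h1 := h.pairing (x, n₀) (inl (x, n₀) v) (inl (x, n₀) w)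
    refine Eq.trans ?_ (h1.symm.trans (Hp (x, n₀) v w))
    exact (add_zero _).symm.trans (congrArg₂ (· + ·) rfl (map_zero _).symm)
  · exact (h.anchor_fst (x, n₀) (inl (x, n₀) v)).symm.trans (Ha (x, n₀) v)
  · have h1 := h.bracket_inl_inl (constSection L (c (k i))) (constSection L (c (k j)))
    rw [hcc] at h1
    rw [← hk, ← hk]
    refine ContMDiffSection.ext fun x ↦ ?_
    have h2 := congrArg (fun s : Cₛ^∞⟮𝓘(ℝ, V₁).prod I₂; (V₁ × (V₁ →L[ℝ] ℝ)) × F₂,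
      prodBundle 𝓘(ℝ, V₁) (GenTangent 𝓘(ℝ, V₁) L) I₂ E₂⟯ ↦ s (x, n₀)) h1
    exact prodInl_injective (I₁ := 𝓘(ℝ, V₁)) (I₂ := I₂) (E₁ := GenTangent 𝓘(ℝ, V₁) L) (E₂ := E₂)
      (x, n₀) (h2.symm.trans (map_zero _).symm)

end StandardFactor

/-! ### From an adapted frame to an isomorphism with a product. -/

section TransportToProduct

variable {V₁ : Type*} [NormedAddCommGroup V₁] [NormedSpace ℝ V₁] [FiniteDimensional ℝ V₁]
  {L : Opens V₁}
  {V₂ H₂ M₂ : Type*} [NormedAddCommGroup V₂] [NormedSpace ℝ V₂] [FiniteDimensional ℝ V₂]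
  [TopologicalSpace H₂] {I₂ : ModelWithCorners ℝ V₂ H₂} [TopologicalSpace M₂] [ChartedSpace H₂ M₂]
  [IsManifold I₂ ∞ M₂] [T2Space M₂]
  {V H M : Type*} [NormedAddCommGroup V] [NormedSpace ℝ V]
  [TopologicalSpace H] {I : ModelWithCorners ℝ V H} [TopologicalSpace M] [ChartedSpace H M]
  [IsManifold I ∞ M] {F : Type*} [NormedAddCommGroup F] [NormedSpace ℝ F]
  {E : M → Type*} [TopologicalSpace (TotalSpace F E)]
  [∀ x, AddCommGroup (E x)] [∀ x, Module ℝ (E x)] [∀ x, TopologicalSpace (E x)]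
  [FiberBundle F E] [VectorBundle ℝ F E]

variable (I₂ M₂) in
/-- A constant section of a trivial bundle. -/
def trivialSection {F₂ : Type*} [NormedAddCommGroup F₂] [NormedSpace ℝ F₂] (w : F₂) :
    Cₛ^∞⟮I₂; F₂, Bundle.Trivial M₂ F₂⟯ :=
  ⟨fun _ ↦ w, fun x ↦ (contMDiffAt_section x).2 contMDiffAt_const⟩

set_option maxHeartbeats 3000000 in
/-- A Courant algebroid over a manifold diffeomorphic to `L × M₂` with a global frame whose
pairings, anchors and brackets are those of the direct product of the standard Courant algebroid on
`L` with a Courant algebroid over `M₂` is isomorphic to such a product. -/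
theorem CourantAlgebroid.exists_courantIso_prod (hL : IsPreconnected (L : Set V₁))
    (A : CourantAlgebroid I F E) (φ : M ≃ₘ^∞⟮I, 𝓘(ℝ, V₁).prod I₂⟯ (L × M₂)) (p : M)
    {κ ι μ : Type*} [Fintype κ] [Fintype ι] [Fintype μ] (b : Module.Basis κ ℝ V₁)
    (c : Module.Basis ι ℝ (V₁ × (V₁ →L[ℝ] ℝ))) {k : κ → ι} (hk : ∀ i, c (k i) = (b i, 0))
    {s : ι ⊕ μ → Cₛ^∞⟮I; F, E⟯} {bs : ∀ x, Module.Basis (ι ⊕ μ) ℝ (E x)}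
    (hbs : ∀ i x, bs x i = s i x)
    (hp : ∀ x i j, A.pair (s (.inl i)) (s (.inl j)) x = (c j).2 (c i).1 + (c i).2 (c j).1)
    (hp₁₂ : ∀ x i a, A.pair (s (.inl i)) (s (.inr a)) x = 0)
    (ha : ∀ x i, mfderiv I (𝓘(ℝ, V₁).prod I₂) φ x (A.anchor x (s (.inl i) x))
      = (((c i).1, 0) : V₁ × V₂))
    (ha₂ : ∀ x a, (mfderiv I (𝓘(ℝ, V₁).prod I₂) φ x (A.anchor x (s (.inr a) x)) : V₁ × V₂).1 = 0)
    (hcc : ∀ i j, A.bracket (s (.inl i)) (s (.inl j)) = 0)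
    (hce : ∀ i a, A.bracket (s (.inl i)) (s (.inr a)) = 0) :
    ∃ (T : CourantAlgebroid 𝓘(ℝ, V₁) (V₁ × (V₁ →L[ℝ] ℝ)) (GenTangent 𝓘(ℝ, V₁) L))
      (A₂ : CourantAlgebroid I₂ (μ → ℝ) (Bundle.Trivial M₂ (μ → ℝ)))
      (C : CourantAlgebroid (𝓘(ℝ, V₁).prod I₂) ((V₁ × (V₁ →L[ℝ] ℝ)) × (μ → ℝ))
        (prodBundle 𝓘(ℝ, V₁) (GenTangent 𝓘(ℝ, V₁) L) I₂ (Bundle.Trivial M₂ (μ → ℝ))))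
      (Φ : CourantIso A C), IsStandard T ∧ IsDirectProduct T A₂ C ∧ Φ.base = φ := by
  classical
  let e (a : μ) := trivialSection M₂ I₂ (Pi.basisFun ℝ μ a)
  let s₁ (i : ι) := inlSection I₂ (μ → ℝ) (Bundle.Trivial M₂ (μ → ℝ)) (constSection L (c i))
  let s₂ (a : μ) := inrSection 𝓘(ℝ, V₁) (V₁ × (V₁ →L[ℝ] ℝ)) (GenTangent 𝓘(ℝ, V₁) L) (e a)
  let bz (z : L × M₂) : Module.Basis (ι ⊕ μ) ℝ
      (prodBundle 𝓘(ℝ, V₁) (GenTangent 𝓘(ℝ, V₁) L) I₂ (Bundle.Trivial M₂ (μ → ℝ)) z) :=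
    c.prod (Pi.basisFun ℝ μ)
  have hbz (i z) : bz z i = Sum.elim s₁ s₂ i z := by
    cases i with
    | inl i => exact Prod.ext (c.prod_apply_inl_fst _ i) (c.prod_apply_inl_snd _ i)
    | inr a => exact Prod.ext (c.prod_apply_inr_fst _ a) (c.prod_apply_inr_snd _ a)
  -- The frame `s` is matched with the constant sections over `L` and the standard frame of a
  -- trivial bundle over `M₂`. All hypotheses on `s` then carry over along `Φ`.
  obtain ⟨C, Φ, hφ, hΦ⟩ := A.exists_courantIso φ s (Sum.elim s₁ s₂) bs bz hbs hbz
  have hz (z : L × M₂) : ∃ x, Φ.base x = z := Φ.base.surjective z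
  have hpair (i j x) : C.pair (Sum.elim s₁ s₂ i) (Sum.elim s₁ s₂ j) (Φ.base x)
      = A.pair (s i) (s j) x := by
    rw [C.pair_apply, A.pair_apply, ← hΦ, ← hΦ, Φ.map_pairing]
  have hanchor (i x) : C.anchor (Φ.base x) (Sum.elim s₁ s₂ i (Φ.base x))
      = mfderiv I (𝓘(ℝ, V₁).prod I₂) Φ.base x (A.anchor x (s i x)) := by
    rw [← hΦ, Φ.map_anchor]
  have hbracket (i j) (h : A.bracket (s i) (s j) = 0) :
      C.bracket (Sum.elim s₁ s₂ i) (Sum.elim s₁ s₂ j) = 0 := by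
    refine ContMDiffSection.ext fun z ↦ ?_
    obtain ⟨x, rfl⟩ := hz z
    rw [Φ.map_bracket (s i) (s j) _ _ (fun x ↦ (hΦ i x).symm) (fun x ↦ (hΦ j x).symm), h,
      section_zero_apply, map_zero, section_zero_apply]
  rw [← hφ] at ha ha₂
  have hfst (z : L × M₂) (u : V₁ × V₂) :
      (mfderiv (𝓘(ℝ, V₁).prod I₂) 𝓘(ℝ, V₁) Prod.fst z : V₁ × V₂ →L[ℝ] V₁) u = u.1 :=
    congrArg (fun B : V₁ × V₂ →L[ℝ] V₁ ↦ B u) (mfderiv_fst (x := z))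
  have hsnd (z : L × M₂) (u : V₁ × V₂) :
      (mfderiv (𝓘(ℝ, V₁).prod I₂) I₂ Prod.snd z : V₁ × V₂ →L[ℝ] V₂) u = u.2 :=
    congrArg (fun B : V₁ × V₂ →L[ℝ] V₂ ↦ B u) (mfderiv_snd (x := z))
  obtain ⟨T, A₂, hT, hA⟩ := C.exists_isDirectProduct_isStandard hL (φ p).1 (φ p).2 b c hk
    (e := e) (b₂ := fun _ ↦ Pi.basisFun ℝ μ) (fun a x ↦ rfl)
    (fun z i j ↦ by
      obtain ⟨x, rfl⟩ := hz z
      exact (hpair (.inl i) (.inl j) x).trans (hp x i j))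
    (fun z i a ↦ by
      obtain ⟨x, rfl⟩ := hz z
      exact (hpair (.inl i) (.inr a) x).trans (hp₁₂ x i a))
    (fun z i ↦ by
      obtain ⟨x, rfl⟩ := hz z
      exact (hfst _ _).trans (congrArg Prod.fst ((hanchor (.inl i) x).trans (ha x i))))
    (fun z i ↦ by
      obtain ⟨x, rfl⟩ := hz z
      exact (hsnd _ _).trans (congrArg Prod.snd ((hanchor (.inl i) x).trans (ha x i))))
    (fun z a ↦ by
      obtain ⟨x, rfl⟩ := hz z
      exact (hfst _ _).trans ((congrArg Prod.fst (hanchor (.inr a) x)).trans (ha₂ x a)))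
    (fun i j ↦ hbracket (.inl i) (.inl j) (hcc i j))
    (fun i a ↦ hbracket (.inl i) (.inr a) (hce i a))
  exact ⟨T, A₂, C, Φ, hT, hA, hφ⟩

end TransportToProduct

/-! ### Smooth local charts belong to the maximal atlas. -/

section MaximalAtlas

variable {V : Type*} [NormedAddCommGroup V] [NormedSpace ℝ V]
  {M : Type*} [TopologicalSpace M] [ChartedSpace V M] [IsManifold 𝓘(ℝ, V) ∞ M]

theorem mem_contDiffGroupoid_of_contDiffOn {f : OpenPartialHomeomorph V V}
    (h : ContDiffOn ℝ ∞ f f.source) (h' : ContDiffOn ℝ ∞ f.symm f.target) :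
    f ∈ contDiffGroupoid ∞ 𝓘(ℝ, V) := by
  rw [contDiffGroupoid, mem_groupoid_of_pregroupoid]
  refine ⟨?_, ?_⟩
  · simpa [contDiffPregroupoid] using h
  · simpa [contDiffPregroupoid] using h'

theorem mem_maximalAtlas_of_contMDiffOn {e : OpenPartialHomeomorph M V}
    (h : ContMDiffOn 𝓘(ℝ, V) 𝓘(ℝ, V) ∞ e e.source)
    (h' : ContMDiffOn 𝓘(ℝ, V) 𝓘(ℝ, V) ∞ e.symm e.target) :
    e ∈ IsManifold.maximalAtlas 𝓘(ℝ, V) ∞ M := by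
  refine mem_maximalAtlas_iff.2 fun e' he' ↦ ?_
  have h1 := contMDiffOn_of_mem_maximalAtlas (n := ∞)
    (IsManifold.subset_maximalAtlas (I := 𝓘(ℝ, V)) he')
  have h2 := contMDiffOn_symm_of_mem_maximalAtlas (n := ∞)
    (IsManifold.subset_maximalAtlas (I := 𝓘(ℝ, V)) he')
  have h3 : ContDiffOn ℝ ∞ (e.symm ≫ₕ e') (e.symm ≫ₕ e').source :=
    (h1.comp (h'.mono fun x hx ↦ hx.1) fun x hx ↦ hx.2).contDiffOn
  have h4 : ContDiffOn ℝ ∞ (e'.symm ≫ₕ e) (e'.symm ≫ₕ e).source :=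
    (h.comp (h2.mono fun x hx ↦ hx.1) fun x hx ↦ hx.2).contDiffOn
  exact ⟨mem_contDiffGroupoid_of_contDiffOn h3 (by simpa using h4),
    mem_contDiffGroupoid_of_contDiffOn h4 (by simpa using h3)⟩

end MaximalAtlas

/-! ### Smooth maps into open subsets. -/

section OpenCodomain

variable {V H M : Type*} [NormedAddCommGroup V] [NormedSpace ℝ V] [TopologicalSpace H]
  {I : ModelWithCorners ℝ V H} [TopologicalSpace M] [ChartedSpace H M]
  {V' H' M' : Type*} [NormedAddCommGroup V'] [NormedSpace ℝ V'] [TopologicalSpace H']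
  {I' : ModelWithCorners ℝ V' H'} [TopologicalSpace M'] [ChartedSpace H' M']

theorem contMDiff_of_coe [FiniteDimensional ℝ V] {U : Opens M} {f : M' → U}
    (h : ContMDiff I' I ∞ fun x ↦ (f x : M)) : ContMDiff I' I ∞ f := by
  intro x
  refine (ContMDiffAt.comp (f := fun x ↦ (f x : M)) x (contMDiffAt_openRetr I U (f x) (f x))
    (h x)).congr_of_eventuallyEq (Eventually.of_forall fun y ↦ (openRetr_coe U (f x) (f y)).symm)

end OpenCodomain

/-! ### Slices of a product chart as embedded submanifolds. -/

section Slice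

variable {V : Type*} [NormedAddCommGroup V] [NormedSpace ℝ V] [FiniteDimensional ℝ V]
  {M : Type*} [TopologicalSpace M] [ChartedSpace V M] [IsManifold 𝓘(ℝ, V) ∞ M]
  {V₁ : Type*} [NormedAddCommGroup V₁] [NormedSpace ℝ V₁] [FiniteDimensional ℝ V₁]
  {V₂ : Type*} [NormedAddCommGroup V₂] [NormedSpace ℝ V₂] [FiniteDimensional ℝ V₂]

/-- The domain of a chart whose target is a product is diffeomorphic to this product. -/
theorem exists_diffeomorph_source {ψ : OpenPartialHomeomorph M (V₁ × V₂)} {L : Opens V₁}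
    {O : Opens V₂} (htar : ψ.target = (L : Set V₁) ×ˢ (O : Set V₂))
    (hψ : ContMDiffOn 𝓘(ℝ, V) 𝓘(ℝ, V₁ × V₂) ∞ ψ ψ.source)
    (hψ' : ContMDiffOn 𝓘(ℝ, V₁ × V₂) 𝓘(ℝ, V) ∞ ψ.symm ψ.target) :
    ∃ D : (⟨ψ.source, ψ.open_source⟩ : Opens M) ≃ₘ^∞⟮𝓘(ℝ, V), 𝓘(ℝ, V₁).prod 𝓘(ℝ, V₂)⟯ (L × O),
      (∀ x, ((D x).1 : V₁) = (ψ x).1 ∧ ((D x).2 : V₂) = (ψ x).2) ∧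
      ∀ z, (D.symm z : M) = ψ.symm (z.1, z.2) := by
  have hm {x} (hx : x ∈ ψ.source) : (ψ x).1 ∈ L ∧ (ψ x).2 ∈ O := by
    have := ψ.map_source hx
    rwa [htar] at this
  have hm' (z : L × O) : ((z.1 : V₁), (z.2 : V₂)) ∈ ψ.target := by
    rw [htar]
    exact ⟨z.1.2, z.2.2⟩
  have hs : ContMDiff 𝓘(ℝ, V) 𝓘(ℝ, V₁ × V₂) ∞
      fun x : (⟨ψ.source, ψ.open_source⟩ : Opens M) ↦ ψ x :=
    hψ.comp_contMDiff contMDiff_subtype_val fun x ↦ x.2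
  have hs' : ContMDiff (𝓘(ℝ, V₁).prod 𝓘(ℝ, V₂)) 𝓘(ℝ, V) ∞ fun z : L × O ↦ ψ.symm (z.1, z.2) :=
    hψ'.comp_contMDiff ((contMDiff_subtype_val.comp contMDiff_fst).prodMk_space
      (contMDiff_subtype_val.comp contMDiff_snd)) hm'
  refine ⟨{
    toFun := fun x ↦ (⟨(ψ x).1, (hm x.2).1⟩, ⟨(ψ x).2, (hm x.2).2⟩)
    invFun := fun z ↦ ⟨ψ.symm (z.1, z.2), ψ.map_target (hm' z)⟩
    left_inv := fun x ↦ Subtype.ext (ψ.left_inv x.2)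
    right_inv := fun z ↦ ?_
    contMDiff_toFun := ?_
    contMDiff_invFun := contMDiff_of_coe hs' }, fun x ↦ ⟨rfl, rfl⟩, fun z ↦ rfl⟩
  · have h := ψ.right_inv (hm' z)
    exact Prod.ext (Subtype.ext (congrArg Prod.fst h)) (Subtype.ext (congrArg Prod.snd h))
  · exact (contMDiff_of_coe ((ContinuousLinearMap.fst ℝ V₁ V₂).contMDiff.comp hs)).prodMk
      (contMDiff_of_coe ((ContinuousLinearMap.snd ℝ V₁ V₂).contMDiff.comp hs))

/-- A space homeomorphic to a nonempty open subset of `V` is a manifold diffeomorphic to it. -/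
theorem exists_chartedSpace_diffeomorph {N : Type*} [TopologicalSpace N] [Nonempty N]
    {O : Opens V₂} (h : N ≃ₜ O) :
    ∃ (_ : ChartedSpace V₂ N) (_ : IsManifold 𝓘(ℝ, V₂) ∞ N)
      (Ψ : N ≃ₘ^∞⟮𝓘(ℝ, V₂), 𝓘(ℝ, V₂)⟯ O), (∀ n, Ψ n = h n) ∧
      ∀ n, ∃ e ∈ IsManifold.maximalAtlas 𝓘(ℝ, V₂) ∞ N, n ∈ e.source ∧ ∀ n ∈ e.source, e n = h n := by
  have hh : IsOpenEmbedding fun n ↦ (h n : V₂) :=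
    O.isOpen.isOpenEmbedding_subtypeVal.comp h.isOpenEmbedding
  let := hh.singletonChartedSpace
  have := hh.isManifold_singleton (I := 𝓘(ℝ, V₂)) (n := ∞)
  refine ⟨inferInstance, inferInstance, ⟨h.toEquiv, ?_, ?_⟩, fun n ↦ rfl, fun n ↦ ?_⟩
  · exact contMDiff_of_coe (contMDiff_isOpenEmbedding hh)
  · refine ContMDiff.of_comp_isOpenEmbedding hh ?_
    refine contMDiff_subtype_val.congr fun o ↦ ?_
    exact congrArg Subtype.val (h.apply_symm_apply o)
  · exact ⟨hh.toOpenPartialHomeomorph, IsManifold.subset_maximalAtlas rfl, mem_univ n,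
      fun n _ ↦ rfl⟩

-- The slice is the level set of the first component of `ψ` through `p`. Its manifold structure
-- comes from the second component, which maps it homeomorphically onto `O`.
set_option maxHeartbeats 1000000 in
theorem exists_slice {ψ : OpenPartialHomeomorph M (V₁ × V₂)} {L : Opens V₁}
    {O : Opens V₂} (htar : ψ.target = (L : Set V₁) ×ˢ (O : Set V₂))
    (hψ : ContMDiffOn 𝓘(ℝ, V) 𝓘(ℝ, V₁ × V₂) ∞ ψ ψ.source)
    (hψ' : ContMDiffOn 𝓘(ℝ, V₁ × V₂) 𝓘(ℝ, V) ∞ ψ.symm ψ.target)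
    (hrank : Module.finrank ℝ V = Module.finrank ℝ V₁ + Module.finrank ℝ V₂)
    {p : M} (hp : p ∈ ψ.source) {l₀ : L} (hl₀ : (ψ p).1 = l₀) :
    ∃ (N : Set M) (_ : ChartedSpace V₂ N) (_ : IsManifold 𝓘(ℝ, V₂) ∞ N), p ∈ N ∧
      IsSmoothEmbedding 𝓘(ℝ, V₂) 𝓘(ℝ, V) ∞ (Subtype.val : N → M) ∧
      ∃ (φ : (⟨ψ.source, ψ.open_source⟩ : Opens M)
          ≃ₘ^∞⟮𝓘(ℝ, V), 𝓘(ℝ, V₁).prod 𝓘(ℝ, V₂)⟯ (L × N))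
        (Ψ : N ≃ₘ^∞⟮𝓘(ℝ, V₂), 𝓘(ℝ, V₂)⟯ O),
        (∀ x, ((φ x).1 : V₁) = (ψ x).1 ∧ (Ψ (φ x).2 : V₂) = (ψ x).2) ∧
        ∀ x : N, ∃ hx : (x : M) ∈ ψ.source, φ ⟨x, hx⟩ = (l₀, x) := by
  obtain ⟨D, hD, hD'⟩ := exists_diffeomorph_source htar hψ hψ'
  let N : Set M := {x | x ∈ ψ.source ∧ (ψ x).1 = l₀}
  have hN (o : O) : ((l₀ : V₁), (o : V₂)) ∈ ψ.target := by
    rw [htar]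
    exact ⟨l₀.2, o.2⟩
  have hDN (x : N) : D ⟨x, x.2.1⟩ = (l₀, (D ⟨x, x.2.1⟩).2) :=
    Prod.ext (Subtype.ext ((hD _).1.trans x.2.2)) rfl
  let h : N ≃ₜ O := {
    toFun := fun x ↦ (D ⟨x, x.2.1⟩).2
    invFun := fun o ↦ ⟨D.symm (l₀, o), (D.symm (l₀, o)).2, by
      rw [hD', ψ.right_inv (hN o)]⟩
    left_inv := fun x ↦ Subtype.ext (by
      change ((D.symm (l₀, (D ⟨x, x.2.1⟩).2) : (⟨ψ.source, ψ.open_source⟩ : Opens M)) : M) = x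
      rw [← hDN, D.symm_apply_apply])
    right_inv := fun o ↦ congrArg Prod.snd (D.apply_symm_apply (l₀, o))
    continuous_toFun := continuous_snd.comp (D.continuous.comp
      (continuous_subtype_val.subtype_mk _))
    continuous_invFun := (continuous_subtype_val.comp (D.symm.continuous.comp
      (continuous_const.prodMk continuous_id))).subtype_mk _ }
  have hpN : p ∈ N := ⟨hp, hl₀⟩
  have : Nonempty N := ⟨⟨p, hpN⟩⟩
  obtain ⟨_, _, Ψ, hΨ, hchart⟩ := exists_chartedSpace_diffeomorph h
  refine ⟨N, inferInstance, inferInstance, hpN, ⟨?_, IsEmbedding.subtypeVal⟩,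
    D.trans ((Diffeomorph.refl 𝓘(ℝ, V₁) L ∞).prodCongr Ψ.symm), Ψ, fun x ↦ ?_, fun x ↦ ?_⟩
  · obtain ⟨eq⟩ : Nonempty ((V₂ × V₁) ≃L[ℝ] V) :=
      FiniteDimensional.nonempty_continuousLinearEquiv_of_finrank_eq (by
        rw [Module.finrank_prod, hrank, add_comm])
    -- Translating `l₀` to `0` and swapping the factors brings the inclusion into the normal form `w
    -- ↦ (w, 0)` of an immersion.
    let τ : (V₁ × V₂) ≃ₜ V :=
      ((Homeomorph.addRight ((-(l₀ : V₁), 0) : V₁ × V₂)).trans (Homeomorph.prodComm V₁ V₂)).trans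
        eq.toHomeomorph
    have hτ : ContDiff ℝ ∞ τ := eq.contDiff.comp
      ((contDiff_snd.prodMk contDiff_fst).comp (contDiff_id.add contDiff_const))
    have hτ' : ContDiff ℝ ∞ τ.symm :=
      ((contDiff_snd.prodMk contDiff_fst).comp eq.symm.contDiff).add contDiff_const
    let χ : OpenPartialHomeomorph M V := ψ.transHomeomorph τ
    have hχ : χ ∈ IsManifold.maximalAtlas 𝓘(ℝ, V) ∞ M :=
      mem_maximalAtlas_of_contMDiffOn (hτ.contMDiff.comp_contMDiffOn hψ)
        (hψ'.comp hτ'.contMDiff.contMDiffOn fun x hx ↦ hx)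
    have himm : IsImmersionOfComplement V₁ 𝓘(ℝ, V₂) 𝓘(ℝ, V) ∞ (Subtype.val : N → M) := fun n ↦ by
      obtain ⟨e, he, hn, heh⟩ := hchart n
      refine IsImmersionAtOfComplement.mk_of_continuousAt continuous_subtype_val.continuousAt eq
        e χ hn n.2.1 he hχ fun w hw ↦ ?_
      have hw : w ∈ e.target := by simpa using hw
      have h1 : e (e.symm w) = w := e.right_inv hw
      rw [heh _ (e.map_target hw)] at h1
      have h2 : ψ (e.symm w) = ((l₀ : V₁), w) :=
        Prod.ext (e.symm w).2.2 ((hD _).2.symm.trans h1)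
      change eq _ = eq _
      refine congrArg eq ?_
      have h3 : ψ (e.symm w) + (-(l₀ : V₁), 0) = (0, w) := by
        rw [h2]
        simp
      exact congrArg Prod.swap h3
    exact himm.isImmersion
  · refine ⟨(hD x).1, ?_⟩
    change ((Ψ (Ψ.symm (D x).2) : O) : V₂) = _
    rw [Ψ.apply_symm_apply]
    exact (hD x).2
  · refine ⟨x.2.1, ?_⟩
    change ((D ⟨x, x.2.1⟩).1, Ψ.symm (D ⟨x, x.2.1⟩).2) = _
    refine Prod.ext (Subtype.ext ((hD _).1.trans x.2.2)) ?_
    exact Ψ.injective ((Ψ.apply_symm_apply _).trans (hΨ x).symm)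

end Slice

/-! ### A local frame adapted to a splitting. -/

section SplittingFrame

variable {V M : Type*} [NormedAddCommGroup V] [NormedSpace ℝ V] [FiniteDimensional ℝ V]
  [TopologicalSpace M] [T2Space M] [ChartedSpace V M] [IsManifold 𝓘(ℝ, V) ∞ M]
  {F : Type*} [NormedAddCommGroup F] [NormedSpace ℝ F] [FiniteDimensional ℝ F]
  {E : M → Type*} [TopologicalSpace (TotalSpace F E)]
  [∀ x, AddCommGroup (E x)] [∀ x, Module ℝ (E x)] [∀ x, TopologicalSpace (E x)]
  [FiberBundle F E] [VectorBundle ℝ F E] [ContMDiffVectorBundle ∞ F E 𝓘(ℝ, V)]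
  {A : CourantAlgebroid 𝓘(ℝ, V) F E} {p : M} {k m : ℕ}

namespace CourantAlgebroid.Splitting

/-- The sections `α i`, `β i` complete to a local frame by invariant sections orthogonal to them. -/
theorem exists_frame (S : A.Splitting p k m) :
    ∃ (q : ℕ) (γ : Fin q → Cₛ^∞⟮𝓘(ℝ, V); F, E⟯),
      Fintype.card ((Fin k ⊕ Fin k) ⊕ Fin q) = Module.finrank ℝ F ∧
      (∀ᶠ x in 𝓝 p, LinearIndependent ℝ fun i ↦ Sum.elim (Sum.elim S.α S.β) γ i x) ∧
      (∀ᶠ x in 𝓝 p, ∀ a i, A.pair (γ a) (S.α i) x = 0 ∧ A.pair (γ a) (S.β i) x = 0) ∧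
      ∀ᶠ x in 𝓝 p, ∀ a i, A.bracket (S.α i) (γ a) x = 0 := by
  have := finiteDimensional_fiber F E p
  -- The orthogonal complement at `p` of all `α i`, `β i`; a basis of it is extended to invariant
  -- sections.
  let W : Submodule ℝ (E p) := ⨅ i, (LinearMap.ker (A.pairing p (S.α i p))
    ⊓ LinearMap.ker (A.pairing p (S.β i p)))
  have hW (v : E p) : v ∈ W ↔ ∀ i, A.pairing p (S.α i p) v = 0 ∧ A.pairing p (S.β i p) v = 0 := by
    simp [W]
  let w := Module.finBasis ℝ W
  choose γ' hγ' hγ'' using fun a ↦ S.exists_invariant (w a)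
  have hαα := S.pair_α.self_of_nhds
  have hαβ := S.pair_α_β.self_of_nhds
  have hββ := S.pair_β_β.self_of_nhds
  simp only [pair_apply] at hαα hαβ hββ
  have hβα (i j) : A.pairing p (S.β i p) (S.α j p) = if j = i then 1 else 0 := by
    rw [A.pairing_symm, hαβ]
  -- Orthogonalization does not change the value at `p`, which is already in `W`.
  have hγp (a) : S.ortho (γ' a) p = w a := by
    have h := (hW _).1 (w a).2
    simp only [ortho, section_sub_apply, section_sum_apply, section_add_apply,
      section_smul_apply, pair_apply, hγ', A.pairing_symm p (w a : E p), h, zero_smul, add_zero,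
      Finset.sum_const_zero, sub_zero]
  let s (i : (Fin k ⊕ Fin k) ⊕ Fin (Module.finrank ℝ W)) : Cₛ^∞⟮𝓘(ℝ, V); F, E⟯ :=
    Sum.elim (Sum.elim S.α S.β) (fun a ↦ S.ortho (γ' a)) i
  have hw (c : Fin (Module.finrank ℝ W) → ℝ) :
      ∑ a, c a • s (.inr a) p = ((∑ a, c a • w a : W) : E p) := by
    rw [Submodule.coe_sum]
    exact Finset.sum_congr rfl fun a _ ↦ congrArg (c a • ·) (hγp a)
  -- Pairing with `β i` and with `α i` isolates the coefficients of `α i` and of `β i`.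
  have hli : LinearIndependent ℝ fun i ↦ s i p := by
    rw [Fintype.linearIndependent_iff]
    intro c hc
    rw [Fintype.sum_sum_type, Fintype.sum_sum_type, hw] at hc
    have h0 := (hW _).1 (∑ a, c (.inr a) • w a : W).2
    have h1 (i) : c (.inl (.inl i)) = 0 := by
      have h := congrArg (A.pairing p (S.β i p)) hc
      simp only [map_add, map_sum, map_smul, s, Sum.elim_inl, Sum.elim_inr, hβα, hββ] at h
      rw [(h0 i).2] at h
      simpa using h
    have h2 (i) : c (.inl (.inr i)) = 0 := by
      have h := congrArg (A.pairing p (S.α i p)) hc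
      simp only [map_add, map_sum, map_smul, s, Sum.elim_inl, Sum.elim_inr, hαα, hαβ] at h
      rw [(h0 i).1] at h
      simpa using h
    simp only [h1, h2, zero_smul, Finset.sum_const_zero, zero_add] at hc
    have h3 := Fintype.linearIndependent_iff.1 w.linearIndependent _ (Subtype.ext hc)
    rintro ((i | i) | a)
    exacts [h1 i, h2 i, h3 a]
  have hspan : ⊤ ≤ Submodule.span ℝ (range fun i ↦ s i p) := by
    intro v _
    let u := v - ∑ i, (A.pairing p (S.β i p) v • S.α i p + A.pairing p (S.α i p) v • S.β i p)
    have hu : u ∈ W := (hW u).2 fun i ↦ by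
      simp only [u, map_sub, map_sum, map_add, map_smul, hαα, hαβ, hβα, hββ]
      simp
    have hs (i) : s i p ∈ Submodule.span ℝ (range fun i ↦ s i p) :=
      Submodule.subset_span (mem_range_self i)
    have hv : v = u + ∑ i, (A.pairing p (S.β i p) v • S.α i p
        + A.pairing p (S.α i p) v • S.β i p) := (sub_add_cancel _ _).symm
    have hu' : u = ∑ a, w.repr ⟨u, hu⟩ a • s (.inr a) p := by
      rw [hw, w.sum_repr]
    rw [hv]
    refine Submodule.add_mem _ ?_ (Submodule.sum_mem _ fun i _ ↦ Submodule.add_mem _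
      (Submodule.smul_mem _ _ (hs (.inl (.inl i)))) (Submodule.smul_mem _ _ (hs (.inl (.inr i)))))
    rw [hu']
    exact Submodule.sum_mem _ fun a _ ↦ Submodule.smul_mem _ _ (hs (.inr a))
  have hcard : Fintype.card ((Fin k ⊕ Fin k) ⊕ Fin (Module.finrank ℝ W)) = Module.finrank ℝ F := by
    rw [← finrank_fiber F E p, Module.finrank_eq_card_basis (Module.Basis.mk hli hspan)]
  refine ⟨_, fun a ↦ S.ortho (γ' a), hcard, A.eventually_linearIndependent hcard hli, ?_, ?_⟩
  · exact eventually_all.2 fun a ↦ S.pair_ortho (γ' a)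
  · exact eventually_all.2 fun a ↦ S.bracket_ortho (hγ'' a)

end CourantAlgebroid.Splitting

end SplittingFrame

/-! ### Charts whose target is a product with an open box. -/

section BoxChart

variable {V M : Type*} [NormedAddCommGroup V] [NormedSpace ℝ V] [FiniteDimensional ℝ V]
  [TopologicalSpace M] [T2Space M] [ChartedSpace V M] [IsManifold 𝓘(ℝ, V) ∞ M]

theorem exists_openBox_subset {r : ℕ} {u : Set (EuclideanSpace ℝ (Fin r))}
    (hu : u ∈ 𝓝 (0 : EuclideanSpace ℝ (Fin r))) :
    ∃ ε > 0, (openBox (fun _ : Fin r ↦ -ε) (fun _ ↦ ε) : Set (EuclideanSpace ℝ (Fin r))) ⊆ u := by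
  have h : (WithLp.toLp 2) ⁻¹' u ∈ 𝓝 (0 : Fin r → ℝ) :=
    (PiLp.continuous_toLp 2 fun _ : Fin r ↦ ℝ).continuousAt.preimage_mem_nhds hu
  obtain ⟨ε, hε, h'⟩ := Metric.mem_nhds_iff.1 h
  refine ⟨ε, hε, fun x hx ↦ ?_⟩
  have hx' : WithLp.ofLp x ∈ Metric.ball (0 : Fin r → ℝ) ε := by
    rw [Metric.mem_ball, dist_pi_lt_iff hε]
    intro i
    rw [Pi.zero_apply, Real.dist_0_eq_abs, abs_lt]
    exact hx i
  exact h' hx'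

theorem isPreconnected_openBox {r : ℕ} (a b : Fin r → ℝ) :
    IsPreconnected (openBox a b : Set (EuclideanSpace ℝ (Fin r))) := by
  refine Convex.isPreconnected fun x hx y hy s t hs ht hst i ↦ ?_
  exact convex_Ioo (a i) (b i) (hx i) (hy i) hs ht hst

/-- Functions vanishing at `p` with jointly injective differentials are the components of a chart
whose target is a product with an open box. -/
theorem exists_boxChart {r m : ℕ} (t : Fin r → C^∞⟮𝓘(ℝ, V), M; ℝ⟯)
    (y : Fin m → C^∞⟮𝓘(ℝ, V), M; ℝ⟯) (p : M) (hcard : r + m = Module.finrank ℝ V)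
    (hinj : ∀ v : TangentSpace 𝓘(ℝ, V) p, (∀ i, mvfderiv 𝓘(ℝ, V) (t i) p v = 0) →
      (∀ i, mvfderiv 𝓘(ℝ, V) (y i) p v = 0) → v = 0)
    {G : Set M} (hG : G ∈ 𝓝 p) :
    ∃ (ε : ℝ) (O : Opens (EuclideanSpace ℝ (Fin m)))
      (ψ : OpenPartialHomeomorph M (EuclideanSpace ℝ (Fin r) × EuclideanSpace ℝ (Fin m))),
      0 < ε ∧ p ∈ ψ.source ∧ ψ.source ⊆ G ∧ ψ p = 0 ∧
      ψ.target = (openBox (fun _ : Fin r ↦ -ε) (fun _ ↦ ε) : Set (EuclideanSpace ℝ (Fin r)))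
        ×ˢ (O : Set (EuclideanSpace ℝ (Fin m))) ∧
      (∀ x ∈ ψ.source, (∀ i, (ψ x).1 i = t i x - t i p) ∧ ∀ j, (ψ x).2 j = y j x - y j p) ∧
      ContMDiffOn 𝓘(ℝ, V) 𝓘(ℝ, EuclideanSpace ℝ (Fin r) × EuclideanSpace ℝ (Fin m)) ∞
        ψ ψ.source ∧
      ContMDiffOn 𝓘(ℝ, EuclideanSpace ℝ (Fin r) × EuclideanSpace ℝ (Fin m)) 𝓘(ℝ, V) ∞
        ψ.symm ψ.target := by
  obtain ⟨e, hp, he, hes⟩ := exists_chart (Sum.elim t y) p (by simpa using hcard)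
    fun v hv ↦ hinj v (fun i ↦ hv (Sum.inl i)) fun i ↦ hv (Sum.inr i)
  let eq : (Fin r ⊕ Fin m → ℝ) ≃L[ℝ] EuclideanSpace ℝ (Fin r) × EuclideanSpace ℝ (Fin m) :=
    ((LinearEquiv.sumArrowLequivProdArrow (Fin r) (Fin m) ℝ ℝ).trans
      ((WithLp.linearEquiv 2 ℝ (Fin r → ℝ)).symm.prodCongr
        (WithLp.linearEquiv 2 ℝ (Fin m → ℝ)).symm)).toContinuousLinearEquiv
  let τ := eq.toHomeomorph.trans (Homeomorph.addRight (-eq (e p)))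
  let χ := e.transHomeomorph τ
  have hτ : ContDiff ℝ ∞ τ := eq.contDiff.add contDiff_const
  have hτ' : ContDiff ℝ ∞ τ.symm := eq.symm.contDiff.comp (contDiff_id.add contDiff_const)
  have hχp : χ p = 0 := add_neg_cancel _
  have hχ : ContMDiffOn 𝓘(ℝ, V) 𝓘(ℝ, EuclideanSpace ℝ (Fin r) × EuclideanSpace ℝ (Fin m)) ∞
      χ χ.source := by
    have h : ContMDiff 𝓘(ℝ, V) 𝓘(ℝ, Fin r ⊕ Fin m → ℝ) ∞
        fun x i ↦ (Sum.elim t y i : C^∞⟮𝓘(ℝ, V), M; ℝ⟯) x :=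
      contMDiff_pi_space.2 fun i ↦ (Sum.elim t y i : C^∞⟮𝓘(ℝ, V), M; ℝ⟯).contMDiff
    exact ((hτ.contMDiff.comp h).contMDiffOn (s := e.source)).congr
      fun x hx ↦ congrArg τ (he x hx)
  have hχ' : ContMDiffOn 𝓘(ℝ, EuclideanSpace ℝ (Fin r) × EuclideanSpace ℝ (Fin m)) 𝓘(ℝ, V) ∞
      χ.symm χ.target := hes.comp hτ'.contMDiff.contMDiffOn fun x hx ↦ hx
  have hgood : χ.target ∩ χ.symm ⁻¹' G ∈
      𝓝 (0 : EuclideanSpace ℝ (Fin r) × EuclideanSpace ℝ (Fin m)) := by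
    have h1 : (0 : EuclideanSpace ℝ (Fin r) × EuclideanSpace ℝ (Fin m)) ∈ χ.target :=
      hχp ▸ χ.map_source hp
    refine inter_mem (χ.open_target.mem_nhds h1)
      ((χ.continuousAt_symm h1).preimage_mem_nhds ?_)
    rwa [← hχp, χ.left_inv hp]
  obtain ⟨u, hu, v, hv, huv⟩ := mem_nhds_prod_iff.1 hgood
  obtain ⟨ε, hε, hεu⟩ := exists_openBox_subset hu
  let O : Opens (EuclideanSpace ℝ (Fin m)) := ⟨interior v, isOpen_interior⟩
  let B := (openBox (fun _ : Fin r ↦ -ε) (fun _ ↦ ε) : Set (EuclideanSpace ℝ (Fin r)))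
    ×ˢ (O : Set (EuclideanSpace ℝ (Fin m)))
  have hB : IsOpen B := (openBox _ _).isOpen.prod O.isOpen
  have hBs : B ⊆ χ.target ∩ χ.symm ⁻¹' G :=
    (Set.prod_mono hεu interior_subset).trans huv
  -- The restriction is made on the target side, so that the target is exactly `B`.
  let ψ := (χ.symm.restrOpen B hB).symm
  have htar : ψ.target = B := inter_eq_right.2 fun z hz ↦ (hBs hz).1
  have h0 : (0 : EuclideanSpace ℝ (Fin r) × EuclideanSpace ℝ (Fin m)) ∈ ψ.target := by
    rw [htar]
    exact ⟨fun i ↦ ⟨neg_lt_zero.2 hε, hε⟩, mem_interior_iff_mem_nhds.2 hv⟩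
  have hsource : ψ.source ⊆ χ.source := fun x hx ↦ by
    have h := (hBs (htar ▸ ψ.map_source hx)).1
    have h1 := χ.symm.map_source h
    rwa [show χ.symm (ψ x) = x from ψ.left_inv hx] at h1
  refine ⟨ε, O, ψ, hε, ?_, fun x hx ↦ ?_, hχp, htar, fun x hx ↦ ?_, hχ.mono hsource,
    hχ'.mono fun z hz ↦ (hBs (htar ▸ hz)).1⟩
  · have h1 : ψ.symm 0 = p := by
      rw [← hχp]
      exact χ.left_inv hp
    exact h1 ▸ ψ.map_target h0
  · have h := (hBs (htar ▸ ψ.map_source hx)).2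
    rwa [mem_preimage, show χ.symm (ψ x) = x from ψ.left_inv hx] at h
  · have h1 : ψ x = eq (e x) + -eq (e p) := rfl
    rw [h1, he x (hsource hx), he p hp]
    exact ⟨fun i ↦ (sub_eq_add_neg _ _).symm, fun j ↦ (sub_eq_add_neg _ _).symm⟩

end BoxChart

/-! ### Derivatives of maps into open sets and products. -/

section Derivatives

variable {V H M : Type*} [NormedAddCommGroup V] [NormedSpace ℝ V] [TopologicalSpace H]
  {I : ModelWithCorners ℝ V H} [TopologicalSpace M] [ChartedSpace H M]
  {V' H' M' : Type*} [NormedAddCommGroup V'] [NormedSpace ℝ V'] [TopologicalSpace H']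
  {I' : ModelWithCorners ℝ V' H'} [TopologicalSpace M'] [ChartedSpace H' M']
  {V₂ H₂ M₂ : Type*} [NormedAddCommGroup V₂] [NormedSpace ℝ V₂] [TopologicalSpace H₂]
  {I₂ : ModelWithCorners ℝ V₂ H₂} [TopologicalSpace M₂] [ChartedSpace H₂ M₂]

theorem mfderiv_comp_map (q : C^∞⟮I, M; I', M'⟯) (f : C^∞⟮I', M'; I₂, M₂⟯) (x : M)
    (v : TangentSpace I x) :
    mfderiv I I₂ (f.comp q) x v = mfderiv I' I₂ f (q x) (mfderiv I I' q x v) := by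
  have h1 := (q.contMDiff.mdifferentiableAt (x := x) (by simp)).hasMFDerivAt
  have h2 := (f.contMDiff.mdifferentiableAt (x := q x) (by simp)).hasMFDerivAt
  exact congrArg (fun L : TangentSpace I x →L[ℝ] V₂ ↦ L v) (h2.comp x h1).mfderiv

theorem mfderiv_diffeomorph_injective (φ : M ≃ₘ^∞⟮I, I'⟯ M') (x : M) {v : TangentSpace I x}
    (h : mfderiv I I' φ x v = 0) : v = 0 := by
  have h1 := (φ.contMDiff.mdifferentiableAt (x := x) (by simp)).hasMFDerivAt
  have h2 := (φ.symm.contMDiff.mdifferentiableAt (x := φ x) (by simp)).hasMFDerivAt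
  have h3 := (h2.comp x h1).congr_of_eventuallyEq (f₁ := id)
    (Eventually.of_forall fun y ↦ (φ.symm_apply_apply y).symm)
  have h4 := congrArg (fun L : V →L[ℝ] V ↦ L v) (hasMFDerivAt_unique h3 (hasMFDerivAt_id x))
  exact h4.symm.trans ((congrArg (mfderiv I' I φ.symm (φ x)) h).trans (map_zero _))

theorem apply_mfderiv_of_coe {V₁ : Type*} [NormedAddCommGroup V₁] [NormedSpace ℝ V₁]
    {L : Opens V₁} (f : C^∞⟮I, M; 𝓘(ℝ, V₁), L⟯) (l : V₁ →L[ℝ] ℝ) (g : C^∞⟮I, M; ℝ⟯) {c : ℝ}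
    (h : ∀ x, l (f x) = g x - c) (x : M) (v : TangentSpace I x) :
    l (mfderiv I 𝓘(ℝ, V₁) f x v : V₁) = mvfderiv I g x v := by
  let k : C^∞⟮I, M; ℝ⟯ := ⟨fun _ ↦ c, contMDiff_const⟩
  have h1 : (linearCoord l).comp f = g - k := ContMDiffMap.ext h
  have h2 := mvfderiv_comp_map f (linearCoord l) x v
  refine (mvfderiv_linearCoord l (f x) _).symm.trans (h2.symm.trans ?_)
  have h3 : g = (g - k) + k := (sub_add_cancel g k).symm
  have h4 : mvfderiv I g x = mvfderiv I (g - k) x + mvfderiv I k x := by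
    conv_lhs => rw [h3]
    rw [ContMDiffMap.coe_add, mvfderiv_add (mdiffAt_map (g - k) x) (mdiffAt_map k x)]
  have h5 : mvfderiv I k x = 0 := mvfderiv_const c
  rw [h1, h4, h5, add_zero]

theorem mfderiv_eq_mk (q : C^∞⟮I, M; I'.prod I₂, M' × M₂⟯) (x : M) (v : TangentSpace I x) :
    mfderiv I (I'.prod I₂) q x v
      = ((mfderiv I I' (ContMDiffMap.fst.comp q) x v, mfderiv I I₂ (ContMDiffMap.snd.comp q) x v) :
        V' × V₂) := by
  refine Prod.ext ?_ ?_
  · refine Eq.trans ?_ (mfderiv_comp_map q ContMDiffMap.fst x v).symm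
    exact (congrArg (fun B : V' × V₂ →L[ℝ] V' ↦ B (mfderiv I (I'.prod I₂) q x v))
      (mfderiv_fst (I := I') (I' := I₂) (x := q x))).symm
  · refine Eq.trans ?_ (mfderiv_comp_map q ContMDiffMap.snd x v).symm
    exact (congrArg (fun B : V' × V₂ →L[ℝ] V₂ ↦ B (mfderiv I (I'.prod I₂) q x v))
      (mfderiv_snd (I := I') (I' := I₂) (x := q x))).symm

end Derivatives

/-! ### Tangent vectors in a product chart and transversality. -/

section ProductChart

variable {V M : Type*} [NormedAddCommGroup V] [NormedSpace ℝ V]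
  [TopologicalSpace M] [ChartedSpace V M] [IsManifold 𝓘(ℝ, V) ∞ M]
  {U : Opens M} {r m : ℕ} {L : Opens (EuclideanSpace ℝ (Fin r))}
  {O : Opens (EuclideanSpace ℝ (Fin m))}
  {N : Type*} [TopologicalSpace N] [ChartedSpace (EuclideanSpace ℝ (Fin m)) N]
  [IsManifold (𝓡 m) ∞ N]

theorem mfderiv_fst_apply (φ : U ≃ₘ^∞⟮𝓘(ℝ, V), (𝓡 r).prod (𝓡 m)⟯ (L × N))
    {i : Fin r} {t : C^∞⟮𝓘(ℝ, V), M; ℝ⟯} {c : ℝ}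
    (h : ∀ x : U, ((φ x).1 : EuclideanSpace ℝ (Fin r)) i = t x - c) (x : U)
    (v : TangentSpace 𝓘(ℝ, V) x) :
    (mfderiv 𝓘(ℝ, V) ((𝓡 r).prod (𝓡 m)) φ x v :
      EuclideanSpace ℝ (Fin r) × EuclideanSpace ℝ (Fin m)).1 i
      = mvfderiv 𝓘(ℝ, V) t x (mfderiv 𝓘(ℝ, V) 𝓘(ℝ, V) (openIncl 𝓘(ℝ, V) U) x v) := by
  let q : C^∞⟮𝓘(ℝ, V), U; (𝓡 r).prod (𝓡 m), L × N⟯ := ⟨φ, φ.contMDiff⟩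
  refine (congrArg (fun u : EuclideanSpace ℝ (Fin r) × EuclideanSpace ℝ (Fin m) ↦ u.1 i)
    (mfderiv_eq_mk q x v)).trans ?_
  exact (apply_mfderiv_of_coe (ContMDiffMap.fst.comp q) (EuclideanSpace.proj i)
    (t.comp (openIncl 𝓘(ℝ, V) U)) h x v).trans (mvfderiv_comp_map _ t x v)

/-- The derivative of the diffeomorphism `Ψ` is injective, and after composition with `Ψ` the
components are the `y j` up to constants. -/
theorem mfderiv_snd_eq_zero (φ : U ≃ₘ^∞⟮𝓘(ℝ, V), (𝓡 r).prod (𝓡 m)⟯ (L × N))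
    (Ψ : N ≃ₘ^∞⟮𝓡 m, 𝓡 m⟯ O) {y : Fin m → C^∞⟮𝓘(ℝ, V), M; ℝ⟯} {c : Fin m → ℝ}
    (h : ∀ (x : U) j, (Ψ (φ x).2 : EuclideanSpace ℝ (Fin m)) j = y j x - c j) (x : U)
    {v : TangentSpace 𝓘(ℝ, V) x}
    (hv : ∀ j, mvfderiv 𝓘(ℝ, V) (y j) x (mfderiv 𝓘(ℝ, V) 𝓘(ℝ, V) (openIncl 𝓘(ℝ, V) U) x v) = 0) :
    (mfderiv 𝓘(ℝ, V) ((𝓡 r).prod (𝓡 m)) φ x v :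
      EuclideanSpace ℝ (Fin r) × EuclideanSpace ℝ (Fin m)).2 = 0 := by
  let q : C^∞⟮𝓘(ℝ, V), U; (𝓡 r).prod (𝓡 m), L × N⟯ := ⟨φ, φ.contMDiff⟩
  let Q : C^∞⟮𝓡 m, N; 𝓡 m, O⟯ := ⟨Ψ, Ψ.contMDiff⟩
  refine (congrArg (fun u : EuclideanSpace ℝ (Fin r) × EuclideanSpace ℝ (Fin m) ↦ u.2)
    (mfderiv_eq_mk q x v)).trans ?_
  refine mfderiv_diffeomorph_injective Ψ _ ((mfderiv_comp_map (ContMDiffMap.snd.comp q) Q x v).symm.trans ?_)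
  refine PiLp.ext fun j ↦ ?_
  exact (apply_mfderiv_of_coe (Q.comp (ContMDiffMap.snd.comp q)) (EuclideanSpace.proj j)
    ((y j).comp (openIncl 𝓘(ℝ, V) U)) (fun x ↦ h x j) x v).trans
    ((mvfderiv_comp_map _ (y j) x v).trans (hv j))

/-- A slice `{l₀} × N` in a product chart is transverse to any subspaces that contain the vectors
tangent to the first factor. -/
theorem range_mfderiv_val_sup_eq_top [FiniteDimensional ℝ V] {N : Set M}
    [ChartedSpace (EuclideanSpace ℝ (Fin m)) N] [IsManifold (𝓡 m) ∞ N]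
    (hval : ContMDiff (𝓡 m) 𝓘(ℝ, V) ∞ (Subtype.val : N → M))
    (φ : U ≃ₘ^∞⟮𝓘(ℝ, V), (𝓡 r).prod (𝓡 m)⟯ (L × N)) {l₀ : L}
    (hφ : ∀ x : N, ∃ hx : (x : M) ∈ U, φ ⟨x, hx⟩ = (l₀, x))
    (W : ∀ x : M, Submodule ℝ (TangentSpace 𝓘(ℝ, V) x))
    (a : ∀ x : U, Fin r → TangentSpace 𝓘(ℝ, V) x)
    (ha : ∀ x i, mfderiv 𝓘(ℝ, V) ((𝓡 r).prod (𝓡 m)) φ x (a x i)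
      = ((EuclideanSpace.basisFun (Fin r) ℝ i, 0) :
        EuclideanSpace ℝ (Fin r) × EuclideanSpace ℝ (Fin m)))
    (haW : ∀ (x : U) i, mfderiv 𝓘(ℝ, V) 𝓘(ℝ, V) (openIncl 𝓘(ℝ, V) U) x (a x i) ∈ W (x : M)) (x : N) :
    LinearMap.range (mfderiv (𝓡 m) 𝓘(ℝ, V) (Subtype.val : N → M) x).toLinearMap ⊔ W x = ⊤ := by
  choose hU hφ using hφ
  let κ : C^∞⟮𝓡 m, N; 𝓘(ℝ, V), U⟯ := ⟨fun n ↦ ⟨n, hU n⟩, contMDiff_of_coe hval⟩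
  let q : C^∞⟮𝓘(ℝ, V), U; (𝓡 r).prod (𝓡 m), L × N⟯ := ⟨φ, φ.contMDiff⟩
  refine eq_top_iff.2 fun v _ ↦ ?_
  let w := (openInclDeriv 𝓘(ℝ, V) U (κ x)).symm v
  have hw : mfderiv 𝓘(ℝ, V) 𝓘(ℝ, V) (openIncl 𝓘(ℝ, V) U) (κ x) w = v :=
    (openInclDeriv 𝓘(ℝ, V) U (κ x)).apply_symm_apply v
  let u : EuclideanSpace ℝ (Fin r) × EuclideanSpace ℝ (Fin m) :=
    mfderiv 𝓘(ℝ, V) ((𝓡 r).prod (𝓡 m)) φ (κ x) w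
  let d : TangentSpace (𝓡 m) x := u.2
  have h1 : mfderiv 𝓘(ℝ, V) ((𝓡 r).prod (𝓡 m)) φ (κ x) (mfderiv (𝓡 m) 𝓘(ℝ, V) κ x d)
      = ((0, d) : EuclideanSpace ℝ (Fin r) × EuclideanSpace ℝ (Fin m)) := by
    refine (mfderiv_comp_map κ q x d).symm.trans ?_
    have h2 : ⇑(q.comp κ) = fun n ↦ (l₀, n) := funext hφ
    rw [h2]
    have h3 := mfderiv_prod_right (I := 𝓡 r) (I' := 𝓡 m) (x₀ := l₀) (y₀ := x)
    exact congrArg (fun B : EuclideanSpace ℝ (Fin m) →L[ℝ]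
      EuclideanSpace ℝ (Fin r) × EuclideanSpace ℝ (Fin m) ↦ B d) h3
  -- The derivative of `φ` is injective, so `w` splits as its image does: the second component is
  -- tangent to the slice, the first is a combination of the `a i`.
  have h4 : w = mfderiv (𝓡 m) 𝓘(ℝ, V) κ x d + ∑ i, u.1 i • a (κ x) i := by
    refine sub_eq_zero.1 (mfderiv_diffeomorph_injective φ (κ x) ?_)
    rw [map_sub, map_add, map_sum, h1]
    have h5 : ∑ i, mfderiv 𝓘(ℝ, V) ((𝓡 r).prod (𝓡 m)) φ (κ x) (u.1 i • a (κ x) i)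
        = ((u.1, 0) : EuclideanSpace ℝ (Fin r) × EuclideanSpace ℝ (Fin m)) := by
      have h6 (i) : mfderiv 𝓘(ℝ, V) ((𝓡 r).prod (𝓡 m)) φ (κ x) (u.1 i • a (κ x) i)
          = (u.1 i • (EuclideanSpace.basisFun (Fin r) ℝ i, 0) :
            EuclideanSpace ℝ (Fin r) × EuclideanSpace ℝ (Fin m)) :=
        (map_smul _ _ _).trans (congrArg (u.1 i • ·) (ha (κ x) i))
      have h7 : ∑ i, (u.1 i • (EuclideanSpace.basisFun (Fin r) ℝ i, 0) :
          EuclideanSpace ℝ (Fin r) × EuclideanSpace ℝ (Fin m)) = (u.1, 0) := by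
        refine Prod.ext ?_ ?_
        · rw [Prod.fst_sum]
          exact (EuclideanSpace.basisFun (Fin r) ℝ).sum_repr u.1
        · rw [Prod.snd_sum]
          exact Finset.sum_eq_zero fun i _ ↦ smul_zero _
      exact (Finset.sum_congr rfl fun i _ ↦ h6 i).trans h7
    rw [h5]
    refine sub_eq_zero.2 (Prod.ext (zero_add u.1).symm (add_zero u.2).symm)
  rw [← hw, h4, map_add, map_sum]
  refine Submodule.add_mem_sup ⟨d, ?_⟩ (Submodule.sum_mem _ fun i _ ↦ ?_)
  · exact mfderiv_comp_map κ (openIncl 𝓘(ℝ, V) U) x d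
  · rw [map_smul]
    exact Submodule.smul_mem _ _ (haW (κ x) i)

end ProductChart

/-! ### Frames over an open subset. -/

section RestrictedFrame

variable {V M : Type*} [NormedAddCommGroup V] [NormedSpace ℝ V]
  [TopologicalSpace M] [T2Space M] [ChartedSpace V M]
  {F : Type*} [NormedAddCommGroup F] [NormedSpace ℝ F] [FiniteDimensional ℝ F]
  {E : M → Type*} [TopologicalSpace (TotalSpace F E)]
  [∀ x, AddCommGroup (E x)] [∀ x, Module ℝ (E x)] [∀ x, TopologicalSpace (E x)]
  [FiberBundle F E] [VectorBundle ℝ F E]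

theorem exists_basis_restrict {ι : Type*} [Fintype ι] {s : ι → Cₛ^∞⟮𝓘(ℝ, V); F, E⟯} {U : Opens M}
    (hcard : Fintype.card ι = Module.finrank ℝ F)
    (hli : ∀ x ∈ U, LinearIndependent ℝ fun i ↦ s i x) :
    ∃ b : ∀ x : U, Module.Basis ι ℝ (restrictBundle 𝓘(ℝ, V) E U x),
      ∀ i x, b x i = pullbackSection (openIncl 𝓘(ℝ, V) U) (s i) x := by
  have h (x : U) : ⊤ ≤ Submodule.span ℝ (range fun i ↦ s i (x : M)) := by
    have := finiteDimensional_fiber F E (x : M)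
    exact ((hli x x.2).span_eq_top_of_card_eq_finrank' (by rw [hcard, finrank_fiber F E])).ge
  exact ⟨fun x ↦ Module.Basis.mk (hli x x.2) (h x), fun i x ↦ Module.Basis.mk_apply _ _ i⟩

end RestrictedFrame

end Courant

end

/-! ### The splitting theorem. -/

set_option maxHeartbeats 1000000 in
open Courant in
theorem mainTheorem1
    {V : Type*} [NormedAddCommGroup V] [NormedSpace ℝ V] [FiniteDimensional ℝ V]
    {M : Type*} [TopologicalSpace M] [T2Space M] [ChartedSpace V M] [IsManifold 𝓘(ℝ, V) ∞ M]
    {F : Type*} [NormedAddCommGroup F] [NormedSpace ℝ F] [FiniteDimensional ℝ F]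
    {E : M → Type*} [TopologicalSpace (TotalSpace F E)]
    [∀ x, AddCommGroup (E x)] [∀ x, Module ℝ (E x)] [∀ x, TopologicalSpace (E x)]
    [FiberBundle F E] [VectorBundle ℝ F E] [ContMDiffVectorBundle ∞ F E 𝓘(ℝ, V)]
    (A : CourantAlgebroid 𝓘(ℝ, V) F E) (p : M) (r : ℕ) (hr : 1 ≤ r)
    (hrank : Module.finrank ℝ (LinearMap.range (A.anchor p)) = r) :
    -- an open neighbourhood `U` of `p` and the restriction of `A` to `U`
    ∃ (U : Opens M) (AU : CourantAlgebroid 𝓘(ℝ, V) F (restrictBundle 𝓘(ℝ, V) E U)),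
      p ∈ U ∧ IsRestriction A U AU ∧
    -- a product `L` of `r` open intervals and the standard Courant algebroid on `𝕋L`
    ∃ (a b : Fin r → ℝ)
      (T : CourantAlgebroid (𝓡 r)
        (EuclideanSpace ℝ (Fin r) × (EuclideanSpace ℝ (Fin r) →L[ℝ] ℝ))
        (GenTangent (𝓡 r) (openBox a b))),
      (∀ i, a i < b i) ∧ IsStandard T ∧
    -- an embedded submanifold `N` through `p` of codimension `r`, transverse to the anchor
    ∃ (N : Set M) (m : ℕ) (_ : ChartedSpace (EuclideanSpace ℝ (Fin m)) N)
      (_ : IsManifold (𝓡 m) ∞ N),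
      m + r = Module.finrank ℝ V ∧
      IsSmoothEmbedding (𝓡 m) 𝓘(ℝ, V) ∞ (Subtype.val : N → M) ∧ p ∈ N ∧
      (∀ x : N, LinearMap.range (mfderiv (𝓡 m) 𝓘(ℝ, V) (Subtype.val : N → M) x).toLinearMap
        ⊔ LinearMap.range (A.anchor x) = ⊤) ∧
    -- a Courant algebroid `A'` on a smooth vector bundle `E' → N`
    ∃ (F' : Type) (_ : NormedAddCommGroup F') (_ : NormedSpace ℝ F')
      (_ : FiniteDimensional ℝ F') (E' : N → Type) (_ : TopologicalSpace (TotalSpace F' E'))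
      (_ : ∀ x, AddCommGroup (E' x)) (_ : ∀ x, Module ℝ (E' x))
      (_ : ∀ x, TopologicalSpace (E' x)) (_ : FiberBundle F' E') (_ : VectorBundle ℝ F' E')
      (_ : ContMDiffVectorBundle ∞ F' E' (𝓡 m)) (A' : CourantAlgebroid (𝓡 m) F' E'),
    -- the direct product, and an isomorphism that maps `N` onto the slice `{l₀} × N`
    ∃ (C : CourantAlgebroid ((𝓡 r).prod (𝓡 m))
        ((EuclideanSpace ℝ (Fin r) × (EuclideanSpace ℝ (Fin r) →L[ℝ] ℝ)) × F')
        (prodBundle (𝓡 r) (GenTangent (𝓡 r) (openBox a b)) (𝓡 m) E'))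
      (φ : CourantIso AU C),
      IsDirectProduct T A' C ∧
      ∃ l₀ : openBox a b, ∀ x : N, ∃ hx : (x : M) ∈ U, φ.base ⟨x, hx⟩ = (l₀, x) := by
  obtain ⟨m, ⟨S⟩⟩ := A.exists_splitting p hrank.ge
  obtain ⟨q, γ, hcard, hli, hγp, hγb⟩ := S.exists_frame
  let s (i : (Fin r ⊕ Fin r) ⊕ Fin q) : Cₛ^∞⟮𝓘(ℝ, V); F, E⟯ := Sum.elim (Sum.elim S.α S.β) γ i
  -- All identities known only near `p` are collected, so that the chart can be chosen inside the
  -- set where they hold simultaneously.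
  have hG := hli.and (hγp.and (hγb.and (S.der_t.and (S.der_y.and (S.pair_α.and (S.bracket_α.and
    (S.pair_β.and (S.pair_α_β.and (S.pair_β_β.and S.bracket_α_β)))))))))
  obtain ⟨ε, O, ψ, hε, hp, hψG, hψp, htar, hψ, hψs, hψs'⟩ := exists_boxChart S.t S.y p S.card
    S.inj hG
  let U : Opens M := ⟨ψ.source, ψ.open_source⟩
  have hl₀ : (0 : EuclideanSpace ℝ (Fin r)) ∈ openBox (fun _ : Fin r ↦ -ε) (fun _ ↦ ε) :=
    fun i ↦ ⟨neg_lt_zero.2 hε, hε⟩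
  obtain ⟨N, hN, hN', hpN, hval, φ, Ψ, hφψ, hφ⟩ := exists_slice htar hψs hψs'
    (by rw [finrank_euclideanSpace_fin, finrank_euclideanSpace_fin, S.card]) hp
    (l₀ := ⟨0, hl₀⟩) (congrArg Prod.fst hψp)
  obtain ⟨AU, hAU⟩ := A.exists_isRestriction U
  let b := (EuclideanSpace.basisFun (Fin r) ℝ).toBasis
  -- The basis of constant vector fields and dual one-forms: `.inl i` corresponds to `α i` and `.inr
  -- i` to `β i`.
  let c := b.prod (b.dualBasis.map LinearMap.toContinuousLinearMap)
  have hb (i) : b i = EuclideanSpace.basisFun (Fin r) ℝ i :=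
    (EuclideanSpace.basisFun (Fin r) ℝ).coe_toBasis ▸ rfl
  have hcl (i) : c (.inl i) = (b i, 0) :=
    Prod.ext (Module.Basis.prod_apply_inl_fst _ _ i) (Module.Basis.prod_apply_inl_snd _ _ i)
  have hcr (i) : c (.inr i) = (0, LinearMap.toContinuousLinearMap (b.dualBasis i)) :=
    Prod.ext (Module.Basis.prod_apply_inr_fst _ _ i) (Module.Basis.prod_apply_inr_snd _ _ i)
  have hdual (i j) : LinearMap.toContinuousLinearMap (b.dualBasis i) (b j)
      = if j = i then 1 else 0 :=
    b.dualBasis_apply_self i j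
  obtain ⟨bs, hbs⟩ := exists_basis_restrict (s := s) (U := U) hcard fun x hx ↦ (hψG hx).1
  let sU (i : (Fin r ⊕ Fin r) ⊕ Fin q) := pullbackSection (openIncl 𝓘(ℝ, V) U) (s i)
  have hpair (x : U) (i j) : AU.pair (sU i) (sU j) x = A.pair (s i) (s j) x := hAU.pairing x _ _
  have hbr (i j) (h : ∀ x ∈ U, A.bracket (s i) (s j) x = 0) : AU.bracket (sU i) (sU j) = 0 :=
    (hAU.bracket _ _).trans (ContMDiffSection.ext fun x ↦ h x x.2)
  have hfst (x : U) (i j) : (mfderiv 𝓘(ℝ, V) ((𝓡 r).prod (𝓡 m)) φ x (AU.anchor x (sU i x)) :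
      EuclideanSpace ℝ (Fin r) × EuclideanSpace ℝ (Fin m)).1 j = A.der (s i) (S.t j) x := by
    refine (mfderiv_fst_apply (c := S.t j p) φ (fun x ↦ ?_) x _).trans
      (congrArg (mvfderiv 𝓘(ℝ, V) (S.t j) x) (hAU.anchor x _))
    exact (congrArg (· j) (hφψ x).1).trans ((hψ x x.2).1 j)
  have hsnd (x : U) (i) (h : ∀ j, A.der (s i) (S.y j) x = 0) :
      (mfderiv 𝓘(ℝ, V) ((𝓡 r).prod (𝓡 m)) φ x (AU.anchor x (sU i x)) :
        EuclideanSpace ℝ (Fin r) × EuclideanSpace ℝ (Fin m)).2 = 0 :=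
    mfderiv_snd_eq_zero φ Ψ
      (fun x j ↦ (congrArg (· j) (hφψ x).2).trans ((hψ x x.2).2 j)) x
      fun j ↦ (congrArg (mvfderiv 𝓘(ℝ, V) (S.y j) x) (hAU.anchor x _)).trans (h j)
  -- In the chart the anchor of `α i` is the `i`-th basis field of `L`. This also gives the
  -- transversality of `N` at the end.
  have hanchor_α (x : U) (i) : mfderiv 𝓘(ℝ, V) ((𝓡 r).prod (𝓡 m)) φ x
      (AU.anchor x (sU (.inl (.inl i)) x)) = ((b i, 0) :
        EuclideanSpace ℝ (Fin r) × EuclideanSpace ℝ (Fin m)) := by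
    obtain ⟨-, -, -, h1, h2, -⟩ := hψG x.2
    refine Prod.ext (PiLp.ext fun j ↦ (hfst x _ j).trans ((h1 i j).trans ?_))
      (hsnd x _ fun j ↦ h2 i j)
    rw [hb, EuclideanSpace.basisFun_apply, PiLp.single_apply]
    exact if_congr eq_comm rfl rfl
  have hanchor (x : U) (i) : mfderiv 𝓘(ℝ, V) ((𝓡 r).prod (𝓡 m)) φ x
      (AU.anchor x (sU (.inl i) x)) = (((c i).1, 0) :
        EuclideanSpace ℝ (Fin r) × EuclideanSpace ℝ (Fin m)) := by
    rcases i with i | i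
    · rw [hcl]
      exact hanchor_α x i
    · rw [hcr]
      exact Prod.ext (PiLp.ext fun j ↦ (hfst x _ j).trans (congrArg (· (x : M)) (S.der_β i _)))
        (hsnd x _ fun j ↦ congrArg (· (x : M)) (S.der_β i _))
  have hanchor₂ (x : U) (a) : (mfderiv 𝓘(ℝ, V) ((𝓡 r).prod (𝓡 m)) φ x
      (AU.anchor x (sU (.inr a) x)) :
        EuclideanSpace ℝ (Fin r) × EuclideanSpace ℝ (Fin m)).1 = 0 := by
    obtain ⟨-, h1, -, -, -, -, -, h2, -⟩ := hψG x.2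
    refine PiLp.ext fun j ↦ (hfst x _ j).trans ((h2 j (γ a)).symm.trans ?_)
    rw [A.pair_comm]
    exact (h1 a j).2
  have hpp (x : U) (i j) : AU.pair (sU (.inl i)) (sU (.inl j)) x
      = (c j).2 (c i).1 + (c i).2 (c j).1 := by
    obtain ⟨-, -, -, -, -, h1, -, -, h2, h3, -⟩ := hψG x.2
    rw [hpair]
    rcases i with i | i <;> rcases j with j | j
    · simp only [hcl, zero_apply, add_zero]
      exact h1 i j
    · simp only [hcl, hcr, zero_apply, add_zero, hdual]
      exact h2 i j
    · simp only [hcl, hcr, zero_apply, zero_add, hdual]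
      rw [A.pair_comm]
      exact h2 j i
    · simp only [hcr, map_zero, add_zero]
      exact h3 i j
  have hp₁₂ (x : U) (i a) : AU.pair (sU (.inl i)) (sU (.inr a)) x = 0 := by
    obtain ⟨-, h1, -⟩ := hψG x.2
    rw [hpair, A.pair_comm]
    rcases i with i | i
    · exact (h1 a i).1
    · exact (h1 a i).2
  have hcc (i j) : AU.bracket (sU (.inl i)) (sU (.inl j)) = 0 := by
    refine hbr _ _ fun x hx ↦ ?_
    obtain ⟨-, -, -, -, -, -, h1, -, -, -, h2⟩ := hψG hx
    rcases i with i | i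
    · rcases j with j | j
      · exact h1 i j
      · exact h2 i j
    · exact congrArg (· x) (S.bracket_β i _)
  have hce (i a) : AU.bracket (sU (.inl i)) (sU (.inr a)) = 0 := by
    refine hbr _ _ fun x hx ↦ ?_
    obtain ⟨-, -, h1, -⟩ := hψG hx
    rcases i with i | i
    · exact h1 a i
    · exact congrArg (· x) (S.bracket_β i _)
  obtain ⟨T, A', C, Φ, hT, hC, hΦ⟩ := CourantAlgebroid.exists_courantIso_prod
    (isPreconnected_openBox (fun _ : Fin r ↦ -ε) (fun _ ↦ ε)) AU φ ⟨p, hp⟩ b c hcl hbs hpp hp₁₂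
    hanchor hanchor₂ hcc hce
  refine ⟨U, AU, hp, hAU, fun _ ↦ -ε, fun _ ↦ ε, T, fun _ ↦ neg_lt_self hε, hT, N, m, hN, hN',
    (add_comm m r).trans S.card, hval, hpN, ?_, Fin q → ℝ, inferInstance, inferInstance,
    inferInstance, Bundle.Trivial N (Fin q → ℝ), inferInstance, inferInstance, inferInstance,
    inferInstance, inferInstance, inferInstance, inferInstance, A', C, Φ, hC, ⟨0, hl₀⟩, ?_⟩
  · refine range_mfderiv_val_sup_eq_top hval.contMDiff φ hφ
      (fun x ↦ LinearMap.range (A.anchor x)) (fun x i ↦ AU.anchor x (sU (.inl (.inl i)) x))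
      (fun x i ↦ (hanchor_α x i).trans (by rw [hb])) fun x i ↦ ?_
    exact ⟨_, (hAU.anchor x _).symm⟩
  · rw [hΦ]
    exact hφ
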